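/- **Setting.** Let $S$ be a closed connected oriented surface with a metric. A *finite thick graph* $\mathbb G\subset S$ is a union of finitely many disjoint closed discs (*junctions*, with union $\mathbb V$) and finitely many *strips* $s$. The closure $\bar s$ of each strip carries a fixed homeomorphism $h_s:\bar s\to[0,1]^2$ with $s=h_s^{-1}((0,1)\times[0,1])$; the closures of different strips are disjoint, $\bar s$ meets $\mathbb V$ exactly in its two ends $h_s^{-1}(\{0,1\}\times[0,1])$, and these lie in junction boundaries. The pieces fit together by the standard local charts (a junction is a disc with the strips ending on it attached radially; near a leaf a strip is a product). Put $\mathbb E=\bigcup\bar s$. The *leaves* $h_s^{-1}(\{x\}\times[0,1])$, $0<x<1$, and the junctions are the *decomposition elements*. Every component of $S\setminus\mathbb G$ is an open disc, and $\mathbb G$ has the homotopy type of $S\setminus\{p\}$ for some $p\in S\setminus\mathbb G$. A *Markov thick graph map* is an orientation-preserving homeomorphism $F:S\to S$ such that: 1. $F(\mathbb G)\subset\operatorname{Int}\mathbb G$, decomposition elements are mapped into decomposition elements, and $\operatorname{diam}F^n(\gamma)\to0$ for every leaf $\gamma$. 2. For the induced map $f$ of the quotient graph $G$ (decomposition elements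 collapsed to points) there is a finite set $L\subset G$ such that $f^{-1}(x)\cap U$ is connected for every $x\in G$ and every component $U$ of $G\setminus L$; and every point of $G$ that $f$ does not map to a vertex has a neighbourhood on which $f$ is an embedding. 3. For each component $U$ of $S\setminus\mathbb G$ there is a least $n\ge1$ with $F^n(U)\subset\mathbb G$ or $F^n(U)\cap U\ne\emptyset$; if the first does not hold, then the second does and $U$ contains a point $p_U$ of least period $n$ with $F^{-kn}(x)\to p_U$ as $k\to\infty$ for all $x\in U$. 4. In the coordinates $h_s$, on each component of $s_i\cap F^{-1}(s_j)$ the map $F$ is affine (up to reflections of the coordinates), expanding the horizontal coordinate by a factor $\lambda_{ij}\ge1$ and contracting the vertical one by a factor $\mu_{ij}\in(0,1)$. 5. If $J,J'$ are junctions with $F(J)\subset J'$, then $F(J\cap\mathbb E)\subset J'\cap\mathbb E$. 6. If $J$ is a junction and $n\geq 1$ is least with $F^n(J)\subset J$, then $\operatorname{Int}J$ contains an attracting periodic point of least period $n$ whose basin contains $\operatorname{Int}J$. Let $A$ be the set of attracting periodic points of $F$. The *real edges* are the core arcs $\gamma_s=h_s^{-1}([0,1]\times\{1/2\})$, and their endpoints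 are the *switches*. A *generalized train track* $\tau$ for $(\mathbb G,A)$ consists of the real edges and of countably many *infinitesimal edges*: arcs that join switches (possibly a switch to itself), have their interiors in the interior of a junction minus $A$, are disjoint apart from endpoints, and are pairwise not *parallel*. Two arcs in a junction are parallel with respect to a family of arcs if they bound a disc (a bigon, whose two corners may coincide) in the junction that contains no point of $A$ and meets no other arc of the family. Let $\psi_0$ be the time-one map of a pseudo-isotopy, supported on disjoint disc neighbourhoods in $S\setminus A$ of the closed strips, that flattens each $\bar s$ onto $\gamma_s$ along the vertical segments $h_s^{-1}(\{x\}\times[0,1])$. The train track $F_*(\tau)$ consists of the real edges and of a maximal subset without parallel pairs of the edges of $\psi_0(F(\tau))$ in the junctions. Let $\tau=\bigcup_n\tau_n$ be the invariant train track obtained from $F$: up to isotopy supported on $\mathbb V\setminus A$, $\tau_0$ consists of the real edges only, $\tau_n\subset\tau_{n+1}=F_*(\tau_n)$, and $F_*(\tau)=\tau$, these identifications being induced by one isotopy and by inclusion. Let $\phi:\tau\to\tau$ be the associated train track map: $F$ followed by $\psi_0$, by the collapse of each edge of $\psi_0(F(\tau))$ onto the parallel edge of $F_*(\tau)$, and by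 the isotopy from $F_*(\tau)$ to $\tau$. Let $M=(m_{ij})$, where $m_{ij}$ is the number of times $\phi(e_j)$ crosses $e_i$, be its (possibly infinite) transition matrix, indexed by the edges of $\tau$; let $N$ (real to real), $B$ (real to infinitesimal) and $\Pi$ (infinitesimal to infinitesimal) be its blocks. Assume that $N$ is irreducible and aperiodic, i.e. some power $N^k$, $k\ge1$, has only positive entries, and that $N$ is not an identity matrix (that is, there is a real edge and $N$ is not the $1\times1$ matrix $(1)$). **Lemma.** The block of $M$ recording transitions from infinitesimal to real edges is zero, so $$M=\begin{bmatrix}N&0\\B&\Pi\end{bmatrix},$$ and the matrices $M$, $N$, $B$, $\Pi$ define bounded operators between the corresponding $\ell^1$ spaces. There is a real number $\lambda>1$ that is the Perron–Frobenius eigenvalue both of $N$ and of $M$: for each of the two matrices, $\lambda$ is the eigenvalue of a positive eigenvector in $\ell^1$, this vector is up to scale the only positive eigenvector in $\ell^1$ (for any eigenvalue), and $\lambda$ is the spectral radius of the operator on complex $\ell^1$. The operator $\lambda I-\Pi$ on $\ell^1$ is invertible. For every positive eigenvector $Y$ of $N$ with $NY=\lambda Y$, the vector $y=[Y,\ (\lambda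 I-\Pi)^{-1}BY]$ lies in $\ell^1$, all its entries are positive, $My=\lambda y$, and its entries satisfy the switch conditions: at every switch $q$, $$y(e_q)=\sum_{e}y(e)+2\sum_{e'}y(e'),$$ where $e_q$ is the real edge with endpoint $q$, $e$ ranges over the infinitesimal edges with exactly one endpoint at $q$, and $e'$ over those with both endpoints at $q$. -/

import Mathlib

open Set Filter Topology unitInterval

noncomputable section

namespace TrainTracks

/-! ### Orientation of topological surfaces -/

/-- A planar map `g` preserves the orientation at `z`: small circles around `z` are mapped to loops
of winding number one around `g z`. The winding number is computed with a continuous logarithm `a`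
of `θ ↦ g (z + r e^{iθ}) - g z`. -/
def PreservesOrientationAt (g : ℂ → ℂ) (z : ℂ) : Prop :=
  ∀ᶠ r : ℝ in 𝓝[>] 0, ∃ a : ℝ → ℂ, ContinuousOn a (Icc 0 (2 * Real.pi)) ∧
    (∀ θ ∈ Icc (0 : ℝ) (2 * Real.pi),
      Complex.exp (a θ) = g (z + r * Complex.exp (θ * Complex.I)) - g z) ∧
    a (2 * Real.pi) = a 0 + 2 * Real.pi * Complex.I

/-- The given atlas of the surface `S` is oriented. -/
def OrientedAtlas (S : Type*) [TopologicalSpace S] [ChartedSpace ℂ S] : Prop :=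
  ∀ c ∈ atlas ℂ S, ∀ c' ∈ atlas ℂ S, ∀ z ∈ (c.symm.trans c').source,
    PreservesOrientationAt (c' ∘ c.symm) z

/-- A self-homeomorphism of an oriented surface preserves the orientation. -/
def OrientationPreserving {S : Type*} [TopologicalSpace S] [ChartedSpace ℂ S] (F : S ≃ₜ S) : Prop :=
  ∀ c ∈ atlas ℂ S, ∀ c' ∈ atlas ℂ S, ∀ x ∈ c.source, F x ∈ c'.source →
    PreservesOrientationAt (c' ∘ F ∘ c.symm) (c x)

/-! ### Points of the unit interval -/

/-- The point `1/2` of the unit interval. -/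
def half : I := ⟨1 / 2, by norm_num, by norm_num⟩

/-- The point `(1 - t) a + t b`. -/
def mix (a b t : I) : I :=
  ⟨(1 - (t : ℝ)) * a + t * b, by
    have := a.2.1; have := b.2.1; have := t.2.1; have := t.2.2
    have h : 0 ≤ 1 - (t : ℝ) := by linarith
    positivity, by
    have h1 := a.2.2; have h2 := b.2.2; have h3 := t.2.1; have h4 := t.2.2
    nlinarith [mul_le_mul_of_nonneg_left h1 (sub_nonneg.2 h4), mul_le_mul_of_nonneg_left h2 h3]⟩

/-- The two ends `0` and `1` of the unit interval, and the point at distance `x` from an end. -/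
def fromEnd (b : Bool) (x : I) : I := if b then σ x else x

/-! ### Finite thick graphs -/

/-- A finite thick graph in the surface `S`: finitely many closed discs (the junctions, indexed by
`V`) and finitely many strips (indexed by `E`). The map `rect e` is the inverse of the structure
homeomorphism `h_e` from the closure of the strip `e` onto the closed unit square. The strip is the
image of `(0,1) × [0,1]`, its leaves are the images of the vertical segments `{x} × [0,1]` with
`0 < x < 1`, and its two ends, the images of `{0} × [0,1]` (`b = false`) and of `{1} × [0,1]`
(`b = true`), lie on the junctions `endVertex e b`. -/
structure FiniteThickGraph (S : Type*) [MetricSpace S] [ChartedSpace ℂ S] where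
  V : Type
  E : Type
  [finV : Fintype V]
  [finE : Fintype E]
  [decE : DecidableEq E]
  junction : V → Set S
  rect : E → C(I × I, S)
  endVertex : E → Bool → V
  junction_disjoint : ∀ v w, v ≠ w → Disjoint (junction v) (junction w)
  rect_injective : Function.Injective fun p : E × (I × I) => rect p.1 p.2
  rect_end : ∀ e b y, rect e (fromEnd b 0, y) ∈ junction (endVertex e b)
  rect_notMem : ∀ e x y v, 0 < x → x < 1 → rect e (x, y) ∉ junction v
  /-- Each junction lies in a chart in which it is the closed unit disc and the strips that end on
  it leave it radially, their leaves being concentric circular arcs. -/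
  junction_chart : ∀ v, ∃ c : OpenPartialHomeomorph S ℂ, ∃ ε : ℝ, 0 < ε ∧
    junction v ⊆ c.source ∧ c '' junction v = Metric.closedBall 0 1 ∧
    (∀ e b, endVertex e b = v → ∀ x y : I, (x : ℝ) < ε →
      rect e (fromEnd b x, y) ∈ c.source ∧
      c (rect e (fromEnd b x, y)) = (1 + ((x : ℝ) : ℂ)) * c (rect e (fromEnd b 0, y))) ∧
    c.source ∩ ((⋃ w, junction w) ∪ ⋃ e, range (rect e)) ⊆
      junction v ∪ {p | ∃ e b, endVertex e b = v ∧ ∃ x y : I, (x : ℝ) < ε ∧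
        p = rect e (fromEnd b x, y)}
  /-- Each leaf lies in a chart in which the strip is a product. -/
  leaf_chart : ∀ (e : E) (x : I), 0 < x → x < 1 →
    ∃ c : OpenPartialHomeomorph S ℂ, ∃ ε : ℝ, 0 < ε ∧
      (∀ x' y : I, |(x' : ℝ) - x| < ε →
        rect e (x', y) ∈ c.source ∧ c (rect e (x', y)) = ⟨x', y⟩) ∧
      c.source ∩ ((⋃ w, junction w) ∪ ⋃ e, range (rect e)) ⊆
        {p | ∃ x' y : I, |(x' : ℝ) - x| < ε ∧ p = rect e (x', y)}
  /-- Each component of the complement of the thick graph is an open disc. -/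
  compl_discs : ∀ p ∈ ((⋃ w, junction w) ∪ ⋃ e, range (rect e))ᶜ,
    Nonempty (connectedComponentIn ((⋃ w, junction w) ∪ ⋃ e, range (rect e))ᶜ p ≃ₜ
      Metric.ball (0 : ℂ) 1)

attribute [instance] FiniteThickGraph.finV FiniteThickGraph.finE FiniteThickGraph.decE

namespace FiniteThickGraph

variable {S : Type*} [MetricSpace S] [ChartedSpace ℂ S] (T : FiniteThickGraph S)

/-- The union of the junctions. -/
def junctions : Set S := ⋃ v, T.junction v

/-- The open strip `e`. -/
def strip (e : T.E) : Set S := {p | ∃ x y : I, 0 < x ∧ x < 1 ∧ p = T.rect e (x, y)}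

/-- The union of the closures of the strips. -/
def closedStrips : Set S := ⋃ e, range (T.rect e)

/-- The thick graph as a subset of the surface. -/
def body : Set S := T.junctions ∪ T.closedStrips

/-- The boundary of a junction in the thick graph: the arcs along which strips are attached. -/
def bdry (v : T.V) : Set S := T.junction v ∩ T.closedStrips

/-- The leaf of the strip `e` at horizontal coordinate `x`. -/
def leaf (e : T.E) (x : I) : Set S := range fun y : I => T.rect e (x, y)

/-- The leaves. -/
def leaves : Set (Set S) := {γ | ∃ e, ∃ x : I, 0 < x ∧ x < 1 ∧ γ = T.leaf e x}

/-- The decomposition elements: junctions and leaves. -/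
def elements : Set (Set S) := range T.junction ∪ T.leaves

/-- The quotient graph, obtained by collapsing each decomposition element to a point. -/
def Graph : Type _ := Quot fun x y : T.body => ∃ γ ∈ T.elements, (x : S) ∈ γ ∧ (y : S) ∈ γ

instance : TopologicalSpace T.Graph := inferInstanceAs (TopologicalSpace (Quot _))

/-- The projection onto the quotient graph. -/
def proj (x : T.body) : T.Graph := Quot.mk _ x

/-- The vertices of the quotient graph. -/
def vertices : Set T.Graph := {g | ∃ x : T.body, (x : S) ∈ T.junctions ∧ g = T.proj x}

/-- The switch at the end `b` of the real edge of the strip `e`. -/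
def switch (q : T.E × Bool) : S := T.rect q.1 (fromEnd q.2 0, half)

/-- The thick graph has the homotopy type of the once punctured surface. -/
def OncePunctured : Prop :=
  ∃ p ∉ T.body, Nonempty (ContinuousMap.HomotopyEquiv T.body ({p}ᶜ : Set S))

end FiniteThickGraph

/-! ### Markov thick graph maps -/

section Maps

variable {S : Type*} [MetricSpace S] [ChartedSpace ℂ S]

/-- Thick graph maps. -/
structure IsThickGraphMap (T : FiniteThickGraph S) (F : S ≃ₜ S) : Prop where
  orientation : OrientationPreserving F
  body_subset : F '' T.body ⊆ interior T.body
  element_subset : ∀ γ ∈ T.elements, ∃ γ' ∈ T.elements, F '' γ ⊆ γ'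
  diam_leaf : ∀ γ ∈ T.leaves, Tendsto (fun n : ℕ => Metric.diam (F^[n] '' γ)) atTop (𝓝 0)
  /-- The induced graph map is piecewise monotone, and strictly monotone away from the preimages of
  vertices. -/
  monotone : ∃ f : T.Graph → T.Graph,
    (∀ x y : T.body, F x = y → f (T.proj x) = T.proj y) ∧
    (∃ L : Set T.Graph, L.Finite ∧ ∀ z ∈ Lᶜ, ∀ x,
      IsPreconnected (f ⁻¹' {x} ∩ connectedComponentIn Lᶜ z)) ∧
    ∀ x, f x ∉ T.vertices → ∃ U ∈ 𝓝 x, IsEmbedding (U.domRestrict f)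
  /-- Each complementary component eventually enters the thick graph or lies in the immediate basin
  of a periodic source. -/
  complement : ∀ z ∈ T.bodyᶜ, ∃ n : ℕ, 0 < n ∧
    (∀ m, 0 < m → m < n → ¬ F^[m] '' connectedComponentIn T.bodyᶜ z ⊆ T.body ∧
      Disjoint (F^[m] '' connectedComponentIn T.bodyᶜ z) (connectedComponentIn T.bodyᶜ z)) ∧
    (F^[n] '' connectedComponentIn T.bodyᶜ z ⊆ T.body ∨
      ((F^[n] '' connectedComponentIn T.bodyᶜ z ∩ connectedComponentIn T.bodyᶜ z).Nonempty ∧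
        ∃ p ∈ connectedComponentIn T.bodyᶜ z, Function.minimalPeriod F p = n ∧
          ∀ x ∈ connectedComponentIn T.bodyᶜ z,
            Tendsto (fun k : ℕ => F.symm^[k * n] x) atTop (𝓝 p)))

/-- `p` is an (asymptotically stable) attracting point of `F`, fixed by `F^n`. -/
def IsAttracting (F : S ≃ₜ S) (n : ℕ) (p : S) : Prop :=
  0 < n ∧ Function.IsPeriodicPt F n p ∧
  (∀ U ∈ 𝓝 p, ∃ W ∈ 𝓝 p, ∀ k : ℕ, F^[n * k] '' W ⊆ U) ∧
  ∀ᶠ x in 𝓝 p, Tendsto (fun k : ℕ => F^[n * k] x) atTop (𝓝 p)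

/-- The union of the attracting periodic orbits of `F`. -/
def attractors (F : S ≃ₜ S) : Set S := {p | ∃ n, IsAttracting F n p}

/-- Markov thick graph maps. -/
structure IsMarkov (T : FiniteThickGraph S) (F : S ≃ₜ S) : Prop extends IsThickGraphMap T F where
  /-- On each component of `s_i ∩ F⁻¹(s_j)`, in the coordinates of the strips, `F` expands the
  horizontal coordinate by the factor `lam i j ≥ 1` and contracts the vertical one by the factor
  `mu i j < 1`; the signs `ε`, `ε'` allow for reflections. -/
  linear : ∃ lam mu : T.E → T.E → ℝ, ∀ i j, 1 ≤ lam i j ∧ 0 < mu i j ∧ mu i j < 1 ∧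
    ∀ z ∈ T.strip i ∩ F ⁻¹' T.strip j, ∃ a b ε ε' : ℝ, |ε| = 1 ∧ |ε'| = 1 ∧
      ∀ x y x' y' : I,
        T.rect i (x, y) ∈ connectedComponentIn (T.strip i ∩ F ⁻¹' T.strip j) z →
        F (T.rect i (x, y)) = T.rect j (x', y') →
        (x' : ℝ) = a + ε * lam i j * x ∧ (y' : ℝ) = b + ε' * mu i j * y
  bdry_subset : ∀ v w, F '' T.junction v ⊆ T.junction w → F '' T.bdry v ⊆ T.bdry w
  periodic_junction : ∀ v, ∀ n : ℕ, 0 < n → F^[n] '' T.junction v ⊆ T.junction v →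
    (∀ m, 0 < m → m < n → ¬ F^[m] '' T.junction v ⊆ T.junction v) →
    ∃ p ∈ interior (T.junction v), IsAttracting F n p ∧ Function.minimalPeriod F p = n ∧
      ∀ x ∈ interior (T.junction v), Tendsto (fun k : ℕ => F^[n * k] x) atTop (𝓝 p)

end Maps

/-! ### Generalized train tracks -/

section Tracks

variable {S : Type*} [MetricSpace S] [ChartedSpace ℂ S]

/-- Two arcs `p`, `q` of a family `path` of arcs in the junctions are parallel with respect to the
subfamily `K`: they bound a disc in a junction that contains no point of `A` and meets no other arc
of `K`. The disc is a bigon, parametrized by a square whose vertical sides are collapsed to the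
endpoints of the arcs (which may coincide). -/
def Parallel (T : FiniteThickGraph S) (A : Set S) {X : Type*} (path : X → I → S) (K : Set X)
    (p q : X) : Prop :=
  ∃ d : C(I × I, S),
    (∀ t, d (t, 0) = path p t) ∧
    ((∀ t, d (t, 1) = path q t) ∨ ∀ t, d (t, 1) = path q (σ t)) ∧
    (∀ s, d (0, s) = path p 0 ∧ d (1, s) = path p 1) ∧
    InjOn d (Ioo 0 1 ×ˢ univ) ∧
    ∃ v, ∀ t ∈ Ioo (0 : I) 1, ∀ s ∈ Ioo (0 : I) 1, d (t, s) ∈ interior (T.junction v) ∧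
      d (t, s) ∉ A ∧ ∀ k ∈ K, k ≠ p → k ≠ q → d (t, s) ∉ range (path k)

/-- The subfamily `K` contains no pair of parallel arcs. -/
def NoParallel (T : FiniteThickGraph S) (A : Set S) {X : Type*} (path : X → I → S) (K : Set X) :
    Prop :=
  ∀ p ∈ K, ∀ q ∈ K, p ≠ q → ¬ Parallel T A path K p q

/-- A (representative of a) generalized train track for `(𝔾, A)`, given by its countable family of
infinitesimal edges: arcs in the junctions and off `A`, which join switches, are disjoint apart from
their endpoints, and are pairwise not parallel. -/
structure GenTrainTrack (T : FiniteThickGraph S) (A : Set S) where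
  Inf : Type
  [countable_inf : Countable Inf]
  edge : Inf → C(I, S)
  edge_ends : ∀ i, edge i 0 ∈ range T.switch ∧ edge i 1 ∈ range T.switch
  edge_interior : ∀ i, ∃ v, ∀ t, 0 < t → t < 1 → edge i t ∈ interior (T.junction v) \ A
  edge_disjoint : ∀ i j t t', 0 < t → t < 1 → edge i t = edge j t' → i = j ∧ t = t'
  noParallel : NoParallel T A (fun i t => edge i t) univ

namespace GenTrainTrack

variable {T : FiniteThickGraph S} {A : Set S} (τ : GenTrainTrack T A)

/-- The edges of the train track: real edges `γ_e` (the horizontal core arcs of the strips) and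
infinitesimal edges. -/
abbrev Edge : Type := T.E ⊕ τ.Inf

/-- The edges as paths. -/
def path : τ.Edge → I → S :=
  Sum.elim (fun e t => T.rect e (t, half)) (fun i t => τ.edge i t)

/-- The switch conditions for a family of weights: at each switch `q` the weight of the real edge
ending at `q` is the sum of the weights of the infinitesimal edges with exactly one endpoint at `q`
plus twice the sum of the weights of those with both endpoints at `q`. -/
def SwitchConditions (y : τ.Edge → ℝ) : Prop :=
  (∀ e, 0 ≤ y e) ∧ ∀ q : T.E × Bool, ∃ a b : ℝ,
    HasSum (fun i : {i // Xor (τ.edge i 0 = T.switch q) (τ.edge i 1 = T.switch q)} =>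
      y (Sum.inr i)) a ∧
    HasSum (fun i : {i // τ.edge i 0 = T.switch q ∧ τ.edge i 1 = T.switch q} =>
      y (Sum.inr i)) b ∧
    y (Sum.inl q.1) = a + 2 * b

end GenTrainTrack

/-! ### The action of a thick graph map on train tracks -/

/-- The pseudo-isotopy `ψ₀` that flattens each strip onto its core arc. It is supported on disjoint
disc neighbourhoods `U e` of the closed strips which contain no point of `A`. -/
structure Flattening (T : FiniteThickGraph S) (A : Set S) where
  U : T.E → Set S
  isOpen_U : ∀ e, IsOpen (U e)
  disc_U : ∀ e, Nonempty (U e ≃ₜ Metric.ball (0 : ℂ) 1)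
  rect_subset : ∀ e, range (T.rect e) ⊆ U e
  disjoint_U : ∀ e e', e ≠ e' → Disjoint (U e) (U e')
  disjoint_A : ∀ e, Disjoint (U e) A
  map : C(S × I, S)
  map_zero : ∀ x, map (x, 0) = x
  map_embedding : ∀ t, t < 1 → IsEmbedding fun x => map (x, t)
  map_rect : ∀ e x y t, map (T.rect e (x, y), t) = T.rect e (x, mix y half t)
  /-- Outside the closed strips the slices are embeddings for all times, including `t = 1`. -/
  map_off_strips : ∀ t, IsEmbedding ((T.closedStripsᶜ).domRestrict fun x => map (x, t))
  map_off_U : ∀ x t, (∀ e, x ∉ U e) → map (x, t) = x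

/-- Isotopies of the surface, starting at the identity and supported on `W`. -/
structure SupportedIsotopy (W : Set S) where
  map : C(S × I, S)
  map_zero : ∀ x, map (x, 0) = x
  map_homeo : ∀ t, IsHomeomorph fun x => map (x, t)
  map_off : ∀ x t, x ∉ W → map (x, t) = x

section Push

variable {T : FiniteThickGraph S} {A : Set S}

/-- The edges of `ψ₀(F(τ))` inside the junctions: one for each nondegenerate component `[a, b]` of
the part of an edge `src` of `τ` that `F` maps into the junctions. -/
structure PushedEdge (τ : GenTrainTrack T A) (F : S ≃ₜ S) where
  src : τ.Edge
  a : I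
  b : I
  lt : a < b
  comp : connectedComponentIn {t | F (τ.path src t) ∈ T.junctions} a = Icc a b

/-- A pushed edge as a path, with endpoints at switches. -/
def PushedEdge.path {τ : GenTrainTrack T A} {F : S ≃ₜ S} (ψ : Flattening T A)
    (p : PushedEdge τ F) (t : I) : S :=
  ψ.map (F (τ.path p.src (mix p.a p.b t)), 1)

/-- The edges of `ψ₀(F(τ'))`, where `τ'` is the part of `τ` that consists of the real edges and of
the infinitesimal edges in `J`. -/
def pushedFrom (τ : GenTrainTrack T A) (F : S ≃ₜ S) (J : Set τ.Inf) : Set (PushedEdge τ F) :=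
  {p | ∀ i, p.src = Sum.inr i → i ∈ J}

/-- `K` is the set of infinitesimal edges of a representative of `F_*(τ')`, where `τ'` is the part
of `τ` that consists of the real edges and of the infinitesimal edges in `J`: a maximal set of edges
of `ψ₀(F(τ'))` without parallel pairs. -/
def IsPushForward (τ : GenTrainTrack T A) (F : S ≃ₜ S) (ψ : Flattening T A) (J : Set τ.Inf)
    (K : Set (PushedEdge τ F)) : Prop :=
  Maximal (fun K' => K' ⊆ pushedFrom τ F J ∧ NoParallel T A (PushedEdge.path ψ) K') K

/-- The train track `τ` is the `F`-invariant train track obtained from the real edges by iterating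
`F_*`, and `carry` describes the associated train track map `φ : τ → τ`.

Up to the isotopy `isotopy`, which is supported on the junctions minus `A`, the train track `F_*(τ)`
with infinitesimal edges `K` is `τ`. The map `φ` is `F`, followed by the flattening `ψ₀`, by the
collapse of every edge of `ψ₀(F(τ))` onto the parallel edge of `F_*(τ)`, and by the isotopy:
`carry p` is the infinitesimal edge of `τ` onto which the pushed edge `p` is mapped.

The train track is the increasing union of the finite train tracks `τ_n`, with infinitesimal edges
`stage n`, where `τ_0` has no infinitesimal edges and `τ_(n+1)` is `F_*(τ_n)`, the set of
infinitesimal edges of the latter being `stageK n`. -/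
structure InvariantTrackMap (T : FiniteThickGraph S) (F : S ≃ₜ S)
    (τ : GenTrainTrack T (attractors F)) where
  ψ : Flattening T (attractors F)
  K : Set (PushedEdge τ F)
  isPushForward : IsPushForward τ F ψ univ K
  isotopy : SupportedIsotopy (T.junctions \ attractors F)
  carry : PushedEdge τ F → τ.Inf
  carry_bijOn : BijOn carry K univ
  carry_isotopy : ∀ p ∈ K, ∃ r : I ≃ₜ I, ∀ t,
    isotopy.map (p.path ψ (r t), 1) = τ.edge (carry p) t
  carry_parallel : ∀ p ∉ K, ∃ k ∈ K, Parallel T (attractors F) (PushedEdge.path ψ) (insert p K) p k ∧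
    carry p = carry k
  stage : ℕ → Set τ.Inf
  stage_zero : stage 0 = ∅
  stage_mono : Monotone stage
  stage_iUnion : ⋃ n, stage n = univ
  stageK : ℕ → Set (PushedEdge τ F)
  stageK_mono : Monotone stageK
  stageK_subset : ∀ n, stageK n ⊆ K
  stageK_isPushForward : ∀ n, IsPushForward τ F ψ (stage n) (stageK n)
  stage_succ : ∀ n, stage (n + 1) = carry '' stageK n

/-- The transition matrix of `φ`: the entry `(i, j)` is the number of times `φ(e_j)` crosses `e_i`.
The image of an edge `e_j` crosses a real edge once for each component of the part of `e_j` that `F`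
maps into the corresponding strip, and an infinitesimal edge once for each pushed edge of `e_j` that
`φ` carries onto it. -/
def InvariantTrackMap.transition {F : S ≃ₜ S} {τ : GenTrainTrack T (attractors F)}
    (φ : InvariantTrackMap T F τ) : Matrix τ.Edge τ.Edge ℕ :=
  fun i j => match i with
  | Sum.inl e => Set.ncard {C : Set I | ∃ t, F (τ.path j t) ∈ T.strip e ∧
      C = connectedComponentIn {t | F (τ.path j t) ∈ T.strip e} t}
  | Sum.inr i => Set.ncard {p : PushedEdge τ F | p.src = j ∧ φ.carry p = i}

end Push

end Tracks

/-! ### Matrices acting on summable sequences -/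

/-- The space of summable families. -/
abbrev L1 (𝕜 : Type*) [RCLike 𝕜] (α : Type*) : Type _ := lp (fun _ : α => 𝕜) 1

/-- The bounded operator `A` is given by the matrix `M`. -/
def ActsAs {𝕜 : Type*} [RCLike 𝕜] {α β : Type*} (M : Matrix β α ℕ) (A : L1 𝕜 α →L[𝕜] L1 𝕜 β) :
    Prop :=
  ∀ y i, HasSum (fun j => (M i j : 𝕜) * y j) (A y i)

/-- `lam` is the Perron-Frobenius eigenvalue of the nonnegative matrix `M`, as an operator on
summable sequences: it is the eigenvalue of a positive eigenvector, which is the only positive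
eigenvector up to scale, and it is the spectral radius. -/
structure IsPerronFrobenius {α : Type*} (M : Matrix α α ℕ) (lam : ℝ) : Prop where
  eigenvector : ∃ A : L1 ℝ α →L[ℝ] L1 ℝ α, ActsAs M A ∧
    ∃ y : L1 ℝ α, (∀ i, 0 < y i) ∧ A y = lam • y ∧
      ∀ (z : L1 ℝ α) (mu : ℝ), (∀ i, 0 < z i) → A z = mu • z → mu = lam ∧ ∃ c : ℝ, z = c • y
  spectralRadius_eq : ∃ A : L1 ℂ α →L[ℂ] L1 ℂ α, ActsAs M A ∧
    spectralRadius ℂ A = ENNReal.ofReal lam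

end TrainTracks

end

/-!
The transition matrix `M` is block triangular because `F` maps junctions into junctions: an
infinitesimal edge, which lies in a junction, never enters a strip. It also has exactly one pushed
edge, its whole image, so every column of `Π` has sum one. A core arc has finitely many pushed
edges, as its image crosses each strip affinely, from end to end, in a fixed time
(`IsMarkov.exists_crossing_length`). Hence all blocks act on summable families, and `‖Π‖ ≤ 1`.

The spectral statements follow from the Perron–Frobenius theorem for the finite primitive matrix
`N`, whose eigenvalue `lam` exceeds one as the entries are integers (`exists_perronFrobenius_nat`).
Since `‖Π‖ ≤ 1 < lam`, the operator `lam - Π` is invertible by the Neumann series, which also shows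
that `(lam - Π)⁻¹ B Y` is nonnegative. Its entries are positive because every infinitesimal edge
arises from the real edges in finitely many steps (`InvariantTrackMap.reachable`). The spectral
radius of `M` is bounded with a weighted `ℓ¹` norm, whose weights are a left eigenvector of `N` on
the real edges and a small constant on the infinitesimal edges (`spectralRadius_le_of_blocks`).
These facts are collected in `perronFrobenius_of_blocks`.

For the switch conditions, the ends of pushed edges at a switch `q = (e, b)` are counted. Whenever
the image of a core arc is at the end `b` of the strip `e`, it passes between the strip and the
junction, by openness of `F`; at the two endpoints of the core arc it enters a strip at once,
because otherwise `F` would map a neighbourhood of a switch into a junction although it maps the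
switch to the boundary. So the pushed edges of the core arc `j` have `N e j` ends at `q`, minus the
number of endpoints of `j` that `F` maps to the end `(e, b)`
(`IsMarkov.ncard_mem_endArc`). An end at the switch `q'` of an infinitesimal edge gives one end at
the switch `θ q'` in the end arc that contains `F q'`. For an eigenvector `y`, the defect
`d q = y (e_q) - ∑ y e - 2 ∑ y e'` therefore satisfies `lam * d q = ∑ d q'`, the sum being over the
`q'` with `θ q' = q`. Summation of absolute values gives `lam * ∑ |d q| ≤ ∑ |d q|`, so `d = 0`
(`eq_zero_of_fiber_sums`, `InvariantTrackMap.switchConditions`).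
-/

noncomputable section

namespace TrainTracks

/-! ### Perron–Frobenius theory of finite primitive matrices -/

section PerronFrobenius

open Matrix

variable {n : Type*} [Fintype n]

/-- A matrix with positive entries maps a nonzero nonnegative vector to a positive one. -/
theorem mulVec_pos_of_pos {P : Matrix n n ℝ} (hP : ∀ i j, 0 < P i j) {x : n → ℝ}
    (hx : ∀ i, 0 ≤ x i) (hx0 : x ≠ 0) (i : n) : 0 < (P *ᵥ x) i := by
  obtain ⟨j, hj⟩ := Function.ne_iff.1 hx0
  have hj' : 0 < x j := lt_of_le_of_ne (hx j) (Ne.symm hj)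
  exact Finset.sum_pos' (fun k _ => mul_nonneg (hP i k).le (hx k))
    ⟨j, Finset.mem_univ _, mul_pos (hP i j) hj'⟩

/-- A positive right and a positive left eigenvector belong to the same eigenvalue. -/
theorem eigenvalue_eq_of_vecMul [Nonempty n] {A : Matrix n n ℝ} {r s : ℝ} {v x : n → ℝ}
    (hv : ∀ i, 0 < v i)
    (hx : ∀ i, 0 < x i) (h : A *ᵥ v = r • v) (h' : x ᵥ* A = s • x) : r = s := by
  have h1 : x ⬝ᵥ A *ᵥ v = (x ᵥ* A) ⬝ᵥ v := dotProduct_mulVec x A v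
  rw [h, h', dotProduct_smul, smul_dotProduct] at h1
  have h2 : 0 < x ⬝ᵥ v := Finset.sum_pos (fun i _ => mul_pos (hx i) (hv i)) Finset.univ_nonempty
  exact mul_right_cancel₀ h2.ne' h1

variable [DecidableEq n] {A : Matrix n n ℝ}

theorem pow_mulVec_of_mulVec_eq_smul {r : ℝ} {v : n → ℝ} (h : A *ᵥ v = r • v) (k : ℕ) :
    (A ^ k) *ᵥ v = r ^ k • v := by
  induction k with
  | zero => simp
  | succ k ih => rw [pow_succ, ← mulVec_mulVec, h, mulVec_smul, ih, smul_smul, pow_succ, mul_comm]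

/-- A nonnegative nonzero eigenvector of a primitive matrix is positive. -/
theorem eigenvector_pos_of_nonneg {k : ℕ} (hk : ∀ i j, 0 < (A ^ k) i j) {r : ℝ} (hr : 0 ≤ r)
    {v : n → ℝ} (hv : ∀ i, 0 ≤ v i) (hv0 : v ≠ 0) (h : A *ᵥ v = r • v) (i : n) : 0 < v i := by
  have h1 := mulVec_pos_of_pos hk hv hv0 i
  rw [pow_mulVec_of_mulVec_eq_smul h] at h1
  exact pos_of_mul_pos_right (by simpa using h1) (pow_nonneg hr k)

/-- Existence in the Perron–Frobenius theorem. The eigenvalue is the largest `r` such that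
`r x ≤ A x` for some `x` in the standard simplex. -/
theorem exists_pos_eigenvector [Nonempty n] (hA : A.IsPrimitive) :
    ∃ r : ℝ, 0 ≤ r ∧ ∃ v : n → ℝ, (∀ i, 0 < v i) ∧ A *ᵥ v = r • v := by
  obtain ⟨k, hk0, hk⟩ := hA.exists_pos_pow
  set R : ℝ := ∑ i, ∑ j, A i j with hR
  have hbound : ∀ x ∈ stdSimplex ℝ n, ∀ r : ℝ, (∀ i, r * x i ≤ (A *ᵥ x) i) → r ≤ R := by
    intro x hx r h
    have hx1 : ∀ j, x j ≤ 1 := fun j => by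
      rw [← hx.2]; exact Finset.single_le_sum (fun i _ => hx.1 i) (Finset.mem_univ j)
    calc r = ∑ i, r * x i := by rw [← Finset.mul_sum, hx.2, mul_one]
      _ ≤ ∑ i, (A *ᵥ x) i := Finset.sum_le_sum fun i _ => h i
      _ ≤ R := Finset.sum_le_sum fun i _ => Finset.sum_le_sum fun j _ =>
          mul_le_of_le_one_right (hA.nonneg i j) (hx1 j)
  have hR0 : 0 ≤ R := Finset.sum_nonneg fun i _ => Finset.sum_nonneg fun j _ => hA.nonneg i j
  let K : Set ((n → ℝ) × ℝ) :=
    (stdSimplex ℝ n ×ˢ Icc 0 R) ∩ {p | ∀ i, p.2 * p.1 i ≤ (A *ᵥ p.1) i}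
  have hKc : IsCompact K := by
    refine ((isCompact_stdSimplex ℝ n).prod isCompact_Icc).inter_right ?_
    simp only [ofPred_forall]
    refine isClosed_iInter fun i => isClosed_le (by fun_prop) ?_
    simp only [mulVec, dotProduct]
    fun_prop
  have hKne : K.Nonempty := by
    obtain ⟨x, hx⟩ : (stdSimplex ℝ n).Nonempty :=
      ⟨_, single_mem_stdSimplex ℝ (Classical.arbitrary n)⟩
    refine ⟨(x, 0), ⟨hx, ⟨le_rfl, hR0⟩⟩, fun i => ?_⟩
    rw [zero_mul]
    exact Finset.sum_nonneg fun j _ => mul_nonneg (hA.nonneg i j) (hx.1 j)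
  obtain ⟨⟨x, r⟩, ⟨⟨hx, hr⟩, hxr⟩, hmax⟩ := hKc.exists_isMaxOn hKne continuous_snd.continuousOn
  simp only [mem_ofPred_eq] at hxr
  have hx0 : x ≠ 0 := by
    rintro rfl
    simpa using hx.2
  have heig : A *ᵥ x = r • x := by
    by_contra hne
    -- otherwise `w = A ^ k x` satisfies `r w < A w` in every entry, so `r` is not maximal
    set w := (A ^ k) *ᵥ x
    have hw : ∀ i, 0 < w i := mulVec_pos_of_pos hk hx.1 hx0
    have hd : ∀ i, r * w i < (A *ᵥ w) i := by
      intro i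
      have := mulVec_pos_of_pos hk (x := A *ᵥ x - r • x)
        (fun i => by simpa using hxr i) (sub_ne_zero.2 hne) i
      rw [mulVec_sub, mulVec_mulVec, mulVec_smul, ← pow_succ, pow_succ', ← mulVec_mulVec] at this
      exact sub_pos.1 this
    obtain ⟨i₀, -, hi₀⟩ := Finset.exists_min_image Finset.univ (fun i => (A *ᵥ w) i / w i)
      Finset.univ_nonempty
    set r' := (A *ᵥ w) i₀ / w i₀
    have hr' : r < r' := (lt_div_iff₀ (hw i₀)).2 (hd i₀)
    set s := ∑ i, w i
    have hs : 0 < s := Finset.sum_pos (fun i _ => hw i) Finset.univ_nonempty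
    have hx' : s⁻¹ • w ∈ stdSimplex ℝ n := by
      refine ⟨fun i => mul_nonneg (inv_nonneg.2 hs.le) (hw i).le, ?_⟩
      simp only [Pi.smul_apply, smul_eq_mul, ← Finset.mul_sum]
      exact inv_mul_cancel₀ hs.ne'
    have hle : ∀ i, r' * (s⁻¹ • w) i ≤ (A *ᵥ (s⁻¹ • w)) i := by
      intro i
      rw [mulVec_smul]
      simp only [Pi.smul_apply, smul_eq_mul]
      rw [mul_left_comm]
      exact mul_le_mul_of_nonneg_left ((le_div_iff₀ (hw i)).1 (hi₀ i (Finset.mem_univ _)))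
        (inv_nonneg.2 hs.le)
    have hmem : (s⁻¹ • w, r') ∈ K :=
      ⟨⟨hx', hr.1.trans hr'.le, hbound _ hx' _ hle⟩, hle⟩
    exact absurd (hmax hmem) (not_le.2 hr')
  exact ⟨r, hr.1, x, eigenvector_pos_of_nonneg hk hr.1 hx.1 hx0 heig, heig⟩

/-- Two positive eigenvectors of a primitive matrix with the same eigenvalue are proportional. -/
theorem exists_eq_smul_of_pos_eigenvector [Nonempty n] {k : ℕ} (hk : ∀ i j, 0 < (A ^ k) i j) {r : ℝ}
    (hr : 0 ≤ r) {v z : n → ℝ} (hv : ∀ i, 0 < v i) (h : A *ᵥ v = r • v)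
    (h' : A *ᵥ z = r • z) : ∃ c : ℝ, z = c • v := by
  obtain ⟨i₀, -, hi₀⟩ := Finset.exists_min_image Finset.univ (fun i => z i / v i)
    Finset.univ_nonempty
  refine ⟨z i₀ / v i₀, sub_eq_zero.1 ?_⟩
  -- for the largest `c` with `c v ≤ z` the eigenvector `z - c v` has a zero entry
  by_contra hne
  have := eigenvector_pos_of_nonneg hk hr (v := z - (z i₀ / v i₀) • v)
    (fun i => sub_nonneg.2 ((le_div_iff₀ (hv i)).1 (hi₀ i (Finset.mem_univ _)))) hne
    (by rw [mulVec_sub, mulVec_smul, h, h', smul_sub, smul_comm]) i₀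
  simp [div_mul_cancel₀ _ (hv i₀).ne'] at this

/-- Perron–Frobenius for a primitive matrix of natural numbers other than `(1)`: a positive right
and a positive left eigenvector for an eigenvalue `lam > 1`. -/
theorem exists_perronFrobenius_nat {N : Matrix n n ℕ} {k : ℕ} (hk0 : 0 < k)
    (hk : ∀ i j, 0 < (N ^ k) i j) (hN : N ≠ 1) :
    ∃ lam : ℝ, 1 < lam ∧ ∃ v x : n → ℝ, (∀ i, 0 < v i) ∧ (∀ i, 0 < x i) ∧
      N.map (Nat.cast : ℕ → ℝ) *ᵥ v = lam • v ∧ x ᵥ* N.map (Nat.cast : ℕ → ℝ) = lam • x := by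
  have : Nonempty n := by
    by_contra h
    rw [not_nonempty_iff] at h
    exact hN (Subsingleton.elim _ _)
  set A : Matrix n n ℝ := N.map (Nat.cast : ℕ → ℝ) with hA
  have hpow : ∀ m, A ^ m = (N ^ m).map (Nat.cast : ℕ → ℝ) := fun m =>
    (Matrix.map_pow N (Nat.castRingHom ℝ) m).symm
  have hk' : ∀ i j, 1 ≤ (A ^ k) i j := fun i j => by
    rw [hpow]; exact Nat.one_le_cast.2 (hk i j)
  have hprim : A.IsPrimitive :=
    ⟨fun i j => Nat.cast_nonneg _, k, hk0, fun i j => one_pos.trans_le (hk' i j)⟩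
  have hprimT : Aᵀ.IsPrimitive := by
    refine ⟨fun i j => Nat.cast_nonneg _, k, hk0, fun i j => ?_⟩
    rw [← transpose_pow]
    exact one_pos.trans_le (hk' j i)
  obtain ⟨r, hr0, v, hv, hAv⟩ := exists_pos_eigenvector hprim
  obtain ⟨s, hs0, x, hx, hAx⟩ := exists_pos_eigenvector hprimT
  rw [mulVec_transpose] at hAx
  obtain rfl := eigenvalue_eq_of_vecMul hv hx hAv hAx
  refine ⟨r, ?_, v, x, hv, hx, hAv, hAx⟩
  rcases subsingleton_or_nontrivial n with h1 | h1
  · let i : n := Classical.arbitrary n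
    have hri : r = N i i := by
      have := congrFun hAv i
      simp only [mulVec, dotProduct, Pi.smul_apply, smul_eq_mul] at this
      rw [Fintype.sum_subsingleton _ i] at this
      exact (mul_right_cancel₀ (hv i).ne' this).symm
    have h01 : N i i ≠ 1 := fun h => hN <| by
      ext a b
      rw [Subsingleton.elim a i, Subsingleton.elim b i, h, one_apply_eq]
    have h00 : N i i ≠ 0 := fun h => by
      have h0 : N = 0 := by
        ext a b
        rw [Subsingleton.elim a i, Subsingleton.elim b i, h]; rfl
      have := hk i i
      rw [h0, zero_pow hk0.ne'] at this
      simp at this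
    rw [hri]
    exact_mod_cast (by omega : 1 < N i i)
  · -- every entry of `A ^ k` is at least one, so `A ^ k` multiplies the sum by at least `card n`
    by_contra hr1
    rw [not_lt] at hr1
    have hvk := pow_mulVec_of_mulVec_eq_smul hAv k
    obtain ⟨i, j, hij⟩ := exists_pair_ne n
    have hi : v i + v j ≤ r ^ k * v i := by
      have := congrFun hvk i
      simp only [mulVec, dotProduct, Pi.smul_apply, smul_eq_mul] at this
      rw [← this, ← Finset.sum_pair hij]
      refine (Finset.sum_le_sum (fun l _ => ?_)).trans (Finset.sum_le_sum_of_subset_of_nonneg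
        (Finset.subset_univ {i, j}) fun l _ _ => ?_)
      · exact le_mul_of_one_le_left (hv l).le (hk' i l)
      · exact mul_nonneg (zero_le_one.trans (hk' i l)) (hv l).le
    have := mul_le_of_le_one_left (hv i).le (pow_le_one₀ hr0 hr1 (n := k))
    linarith [hv j]

end PerronFrobenius

/-! ### Nonnegative matrices as operators on summable families -/

section Operators

open scoped ENNReal NNReal

variable {𝕜 : Type*} [RCLike 𝕜] {α β : Type*}

theorem memℓp_one_iff {f : α → 𝕜} : Memℓp f 1 ↔ Summable fun i => ‖f i‖ := by
  rw [memℓp_gen_iff (by simp)]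
  simp

theorem enorm_eq_tsum (y : L1 𝕜 α) : ‖y‖ₑ = ∑' i, ‖y i‖ₑ := by
  have h := lp.hasSum_norm (p := 1) (by simp) y
  simp only [ENNReal.toReal_one, Real.rpow_one] at h
  have h1 : HasSum (fun i => ‖y i‖₊) ‖y‖₊ := NNReal.hasSum_coe.1 h
  simp only [enorm_eq_nnnorm]
  exact (ENNReal.hasSum_coe.2 h1).tsum_eq.symm

theorem enorm_natCast_mul (m : ℕ) (x : 𝕜) : ‖(m : 𝕜) * x‖ₑ = m * ‖x‖ₑ := by
  rw [enorm_mul]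
  congr 1
  rw [← ofReal_norm, RCLike.norm_natCast, ENNReal.ofReal_natCast]

/-- A weighted `ℓ¹` norm of `M y` is at most the sum of the weighted norms of the columns of `M`,
multiplied by the entries of `y`. -/
theorem tsum_mul_enorm_le (M : Matrix β α ℕ) (u : β → ℝ≥0∞) (y : α → 𝕜) :
    ∑' i, u i * ‖∑' j, (M i j : 𝕜) * y j‖ₑ ≤ ∑' j, (∑' i, u i * M i j) * ‖y j‖ₑ := by
  calc ∑' i, u i * ‖∑' j, (M i j : 𝕜) * y j‖ₑ
      ≤ ∑' i, ∑' j, u i * M i j * ‖y j‖ₑ := by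
        refine ENNReal.tsum_le_tsum fun i => ?_
        simp_rw [mul_assoc, ENNReal.tsum_mul_left]
        gcongr
        simpa only [enorm_natCast_mul] using
          enorm_tsum_le_tsum_enorm (f := fun j => (M i j : 𝕜) * y j)
    _ = ∑' j, (∑' i, u i * M i j) * ‖y j‖ₑ := by
        rw [ENNReal.tsum_comm]
        simp_rw [ENNReal.tsum_mul_right]

theorem summable_natCast_mul {M : Matrix β α ℕ} {C : ℝ≥0} (h : ∀ j, ∑' i, (M i j : ℝ≥0∞) ≤ C)
    (y : L1 𝕜 α) (i : β) : Summable fun j => (M i j : 𝕜) * y j := by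
  refine Summable.of_norm_bounded ((memℓp_one_iff.1 y.2).mul_left (C : ℝ)) fun j => ?_
  rw [norm_mul, RCLike.norm_natCast]
  gcongr
  have := (ENNReal.le_tsum i).trans (h j)
  exact_mod_cast this

/-- A matrix with bounded column sums acts on summable families. -/
theorem exists_actsAs (𝕜 : Type*) [RCLike 𝕜] {M : Matrix β α ℕ} {C : ℝ≥0}
    (h : ∀ j, ∑' i, (M i j : ℝ≥0∞) ≤ C) :
    ∃ A : L1 𝕜 α →L[𝕜] L1 𝕜 β, ActsAs M A ∧ ‖A‖ ≤ C := by
  have hle : ∀ y : L1 𝕜 α, ∑' i, ‖∑' j, (M i j : 𝕜) * y j‖ₑ ≤ C * ‖y‖ₑ := by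
    intro y
    have := tsum_mul_enorm_le M (fun _ => 1) (fun j => y j)
    simp only [one_mul] at this
    refine this.trans ?_
    rw [enorm_eq_tsum, ← ENNReal.tsum_mul_left]
    gcongr
    exact h _
  have hmem : ∀ y : L1 𝕜 α, Memℓp (fun i => ∑' j, (M i j : 𝕜) * y j) 1 := fun y =>
    memℓp_one_iff.2 <| tsum_enorm_ne_top_iff_summable_norm.1 <|
      ne_top_of_le_ne_top (ENNReal.mul_ne_top ENNReal.coe_ne_top enorm_ne_top) (hle y)
  let A₀ : L1 𝕜 α →ₗ[𝕜] L1 𝕜 β :=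
    { toFun := fun y => ⟨_, hmem y⟩
      map_add' := fun y z => by
        ext i
        change ∑' j, (M i j : 𝕜) * (y j + z j) = _
        simp only [mul_add]
        exact (summable_natCast_mul h y i).tsum_add (summable_natCast_mul h z i)
      map_smul' := fun c y => by
        ext i
        change ∑' j, (M i j : 𝕜) * (c * y j) = c * ∑' j, (M i j : 𝕜) * y j
        rw [← tsum_mul_left]
        simp only [mul_left_comm] }
  have hA₀ : ∀ y, ‖A₀ y‖ ≤ C * ‖y‖ := fun y => by
    have := hle y
    rw [show ∑' i, ‖∑' j, (M i j : 𝕜) * y j‖ₑ = ‖A₀ y‖ₑ from (enorm_eq_tsum (A₀ y)).symm,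
      enorm_eq_nnnorm, enorm_eq_nnnorm] at this
    exact_mod_cast this
  exact ⟨A₀.mkContinuous C hA₀, fun y i => (summable_natCast_mul h y i).hasSum,
    A₀.mkContinuous_norm_le C.2 hA₀⟩

/-- If the weights `u` are bounded and bounded away from zero and satisfy `u M ≤ r u`, then the
spectral radius of `M` is at most `r`. -/
theorem spectralRadius_le_of_weights {M : Matrix α α ℕ} {A : L1 ℂ α →L[ℂ] L1 ℂ α}
    (hA : ActsAs M A) {u : α → ℝ≥0∞} {c C r : ℝ≥0} (hc : c ≠ 0) (hcu : ∀ i, c ≤ u i)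
    (huC : ∀ i, u i ≤ C) (h : ∀ j, ∑' i, u i * M i j ≤ r * u j) :
    spectralRadius ℂ A ≤ r := by
  have hstep : ∀ y : L1 ℂ α, ∑' i, u i * ‖A y i‖ₑ ≤ r * ∑' i, u i * ‖y i‖ₑ := by
    intro y
    have := tsum_mul_enorm_le M u (fun j => y j)
    simp only [fun i => (hA y i).tsum_eq] at this
    refine this.trans ?_
    rw [← ENNReal.tsum_mul_left]
    refine ENNReal.tsum_le_tsum fun j => ?_
    rw [← mul_assoc]
    gcongr
    exact h j
  have hpow : ∀ (n : ℕ) (y : L1 ℂ α),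
      ∑' i, u i * ‖(A ^ n) y i‖ₑ ≤ r ^ n * ∑' i, u i * ‖y i‖ₑ := by
    intro n
    induction n with
    | zero => intro y; simp
    | succ n ih =>
      intro y
      rw [pow_succ', pow_succ', mul_apply_eq_comp, mul_assoc]
      exact (hstep _).trans (by gcongr; exact ih y)
  have hnorm : ∀ n : ℕ, ‖A ^ n‖ ≤ C / c * (r : ℝ) ^ n := by
    intro n
    refine ContinuousLinearMap.opNorm_le_bound _ (by positivity) fun y => ?_
    have h1 : c * ‖(A ^ n) y‖ₑ ≤ r ^ n * (C * ‖y‖ₑ) := by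
      rw [enorm_eq_tsum, enorm_eq_tsum, ← ENNReal.tsum_mul_left, ← ENNReal.tsum_mul_left]
      refine le_trans (ENNReal.tsum_le_tsum fun i => ?_) ((hpow n y).trans ?_)
      · gcongr; exact hcu i
      · gcongr; exact huC _
    rw [enorm_eq_nnnorm, enorm_eq_nnnorm] at h1
    have h2 : (c : ℝ) * ‖(A ^ n) y‖ ≤ r ^ n * (C * ‖y‖) := by exact_mod_cast h1
    have hc' : (0 : ℝ) < c := by positivity
    rw [← mul_le_mul_iff_right₀ hc']
    refine h2.trans_eq ?_
    field_simp
  refine iSup₂_le fun k hk => ?_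
  by_contra hlt
  rw [not_le] at hlt
  have hlt' : (r : ℝ) < ‖k‖ := by exact_mod_cast hlt
  have hk0 : 0 < ‖k‖ := r.2.trans_lt hlt'
  have hlim : Tendsto (fun n : ℕ => (C : ℝ) / c * ((r : ℝ) / ‖k‖) ^ n) atTop (𝓝 ((C : ℝ) / c * 0)) :=
    (tendsto_pow_atTop_nhds_zero_of_lt_one (by positivity) ((div_lt_one hk0).2 hlt')).const_mul _
  have hge : ∀ n : ℕ, 1 ≤ (C : ℝ) / c * ((r : ℝ) / ‖k‖) ^ n := by
    intro n
    have h1 : ‖k ^ n‖ ≤ ‖A ^ n‖ * ‖(1 : L1 ℂ α →L[ℂ] L1 ℂ α)‖ :=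
      spectrum.norm_le_norm_mul_of_mem (spectrum.pow_mem_pow A n hk)
    have h2 : ‖k‖ ^ n ≤ C / c * (r : ℝ) ^ n := by
      rw [← norm_pow]
      refine h1.trans (le_trans ?_ (hnorm n))
      exact mul_le_of_le_one_right (norm_nonneg _) ContinuousLinearMap.norm_id_le
    rw [div_pow, ← mul_div_assoc, one_le_div (pow_pos hk0 n)]
    exact h2
  have := ge_of_tendsto' hlim hge
  norm_num at this

/-- A positive eigenvector is also an eigenvector over the complex numbers, so its eigenvalue is a
lower bound for the spectral radius. -/
theorem le_spectralRadius_of_eigenvector [Nonempty α] {M : Matrix α α ℕ} {A : L1 ℝ α →L[ℝ] L1 ℝ α}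
    {A' : L1 ℂ α →L[ℂ] L1 ℂ α} (hA : ActsAs M A) (hA' : ActsAs M A') {y : L1 ℝ α} {lam : ℝ}
    (hlam : 0 ≤ lam) (hy : ∀ i, 0 < y i) (h : A y = lam • y) :
    ENNReal.ofReal lam ≤ spectralRadius ℂ A' := by
  have hmem : Memℓp (fun i => (y i : ℂ)) 1 := memℓp_one_iff.2 <| by
    simpa using memℓp_one_iff.1 y.2
  let y' : L1 ℂ α := ⟨_, hmem⟩
  have hy' : A' y' = (lam : ℂ) • y' := by
    ext i
    refine (hA' y' i).unique ?_
    have h1 := hA y i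
    rw [h] at h1
    have h2 := h1.mapL Complex.ofRealCLM
    simpa [y'] using! h2
  have hspec : (lam : ℂ) ∈ spectrum ℂ A' := by
    intro hu
    have hinj := (Module.End.isUnit_iff _).1
      (hu.map (ContinuousLinearMap.toLinearMapRingHom (R₁ := ℂ) (M₁ := L1 ℂ α)))
    have h0 : y' = 0 := hinj.1 <| by
      change (algebraMap ℂ (L1 ℂ α →L[ℂ] L1 ℂ α) lam - A') y' = _
      rw [map_zero, sub_apply, hy', Algebra.algebraMap_eq_smul_one]
      exact sub_self ((lam : ℂ) • y')
    have h1 := congrArg (fun z : L1 ℂ α => z (Classical.arbitrary α)) h0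
    exact (hy (Classical.arbitrary α)).ne' (by simpa [y'] using! h1)
  refine le_trans ?_ (le_iSup₂ (f := fun (k : ℂ) (_ : k ∈ spectrum ℂ A') => (‖k‖₊ : ℝ≥0∞)) _ hspec)
  rw [← enorm_eq_nnnorm, ← ofReal_norm]
  simp [abs_of_nonneg hlam]

end Operators

/-! ### Block triangular matrices -/

section Blocks

open scoped ENNReal NNReal

variable {𝕜 : Type*} [RCLike 𝕜] {E J : Type*}

/-- The restriction of a summable family on a disjoint union to the first part. -/
def L1.fst (y : L1 𝕜 (E ⊕ J)) : L1 𝕜 E :=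
  ⟨fun e => y (Sum.inl e), memℓp_one_iff.2 ((memℓp_one_iff.1 y.2).comp_injective Sum.inl_injective)⟩

/-- The restriction of a summable family on a disjoint union to the second part. -/
def L1.snd (y : L1 𝕜 (E ⊕ J)) : L1 𝕜 J :=
  ⟨fun i => y (Sum.inr i), memℓp_one_iff.2 ((memℓp_one_iff.1 y.2).comp_injective Sum.inr_injective)⟩

/-- The summable family on a disjoint union with given restrictions to the two parts. -/
def L1.join (Y : L1 𝕜 E) (w : L1 𝕜 J) : L1 𝕜 (E ⊕ J) :=
  ⟨Sum.elim Y w, memℓp_one_iff.2 (Summable.sum _ (memℓp_one_iff.1 Y.2) (memℓp_one_iff.1 w.2))⟩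

variable {M : Matrix (E ⊕ J) (E ⊕ J) ℕ} {A : L1 𝕜 (E ⊕ J) →L[𝕜] L1 𝕜 (E ⊕ J)}
  {N : L1 𝕜 E →L[𝕜] L1 𝕜 E} {B : L1 𝕜 E →L[𝕜] L1 𝕜 J} {P : L1 𝕜 J →L[𝕜] L1 𝕜 J}

theorem fst_apply_of_blocks (hM : ActsAs M A) (hN : ActsAs M.toBlocks₁₁ N)
    (h12 : M.toBlocks₁₂ = 0) (y : L1 𝕜 (E ⊕ J)) : (A y).fst = N y.fst := by
  ext e
  refine (hM y (Sum.inl e)).unique ?_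
  have h2 : HasSum ((fun j => (M (Sum.inl e) j : 𝕜) * y j) ∘ Sum.inr) 0 := by
    have h0 : ((fun j => (M (Sum.inl e) j : 𝕜) * y j) ∘ Sum.inr) = fun _ => 0 := funext fun i => by
      have : M (Sum.inl e) (Sum.inr i) = 0 := congrFun (congrFun h12 e) i
      rw [Function.comp_apply, this, Nat.cast_zero, zero_mul]
    rw [h0]
    exact hasSum_zero
  have h3 := HasSum.sum (f := fun j => (M (Sum.inl e) j : 𝕜) * y j) (hN y.fst e) h2
  rwa [add_zero] at h3

theorem snd_apply_of_blocks (hM : ActsAs M A) (hB : ActsAs M.toBlocks₂₁ B)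
    (hP : ActsAs M.toBlocks₂₂ P) (y : L1 𝕜 (E ⊕ J)) : (A y).snd = B y.fst + P y.snd := by
  ext i
  exact (hM y (Sum.inr i)).unique (HasSum.sum (hB y.fst i) (hP y.snd i))

/-- The eigenvector equation of a block triangular matrix. -/
theorem eigenvector_iff_of_blocks (hM : ActsAs M A) (hN : ActsAs M.toBlocks₁₁ N)
    (hB : ActsAs M.toBlocks₂₁ B) (hP : ActsAs M.toBlocks₂₂ P) (h12 : M.toBlocks₁₂ = 0)
    (y : L1 𝕜 (E ⊕ J)) (mu : 𝕜) :
    A y = mu • y ↔ N y.fst = mu • y.fst ∧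
      (mu • ContinuousLinearMap.id 𝕜 (L1 𝕜 J) - P) y.snd = B y.fst := by
  have hR : (mu • ContinuousLinearMap.id 𝕜 (L1 𝕜 J) - P) y.snd = mu • y.snd - P y.snd := rfl
  rw [hR, sub_eq_iff_eq_add, ← fst_apply_of_blocks hM hN h12, ← snd_apply_of_blocks hM hB hP]
  constructor
  · intro h
    rw [h]
    exact ⟨rfl, rfl⟩
  · rintro ⟨h1, h2⟩
    ext (e | i)
    · exact congrArg (fun z : L1 𝕜 E => z e) h1
    · exact congrArg (fun z : L1 𝕜 J => z i) h2.symm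

/-- The coordinates of a convergent series of summable families converge. -/
theorem hasSum_apply {ι : Type*} {f : ι → L1 ℝ J} {y : L1 ℝ J} (h : HasSum f y) (i : J) :
    HasSum (fun k => f k i) (y i) := by
  let ev : L1 ℝ J →ₗ[ℝ] ℝ :=
    { toFun := fun y => y i, map_add' := fun _ _ => rfl, map_smul' := fun _ _ => rfl }
  exact h.mapL (ev.mkContinuous 1 fun y => by
    rw [one_mul]
    exact lp.norm_apply_le_norm one_ne_zero y i)

/-- If `P` has norm at most one and preserves nonnegative vectors, then for `lam > 1` the solution
`w` of `(lam - P) w = v` is nonnegative when `v` is: it is given by the Neumann series. -/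
theorem nonneg_of_neumann {P : L1 ℝ J →L[ℝ] L1 ℝ J} (hP : ‖P‖ ≤ 1)
    (hpos : ∀ y : L1 ℝ J, (∀ i, 0 ≤ y i) → ∀ i, 0 ≤ P y i) {lam : ℝ} (hlam : 1 < lam)
    {v w : L1 ℝ J} (hv : ∀ i, 0 ≤ v i)
    (hw : (lam • ContinuousLinearMap.id ℝ (L1 ℝ J) - P) w = v) (i : J) : 0 ≤ w i := by
  have hlam0 : 0 < lam := one_pos.trans hlam
  have hlt : ‖lam⁻¹ • P‖ < 1 := by
    rw [norm_smul, norm_inv, Real.norm_of_nonneg hlam0.le]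
    exact (mul_le_of_le_one_right (inv_nonneg.2 hlam0.le) hP).trans_lt (inv_lt_one_of_one_lt₀ hlam)
  have hsum : HasSum (fun n : ℕ => ((lam⁻¹ • P) ^ n) (lam⁻¹ • v)) w := by
    have h1 := (summable_geometric_of_norm_lt_one hlt).hasSum
    have h2 := h1.mapL (ContinuousLinearMap.apply ℝ (L1 ℝ J) (lam⁻¹ • v))
    convert! h2 using 1
    have h3 : lam⁻¹ • v = (1 - lam⁻¹ • P) w := by
      have : (lam • w - P w) = v := hw
      rw [← this, smul_sub, inv_smul_smul₀ hlam0.ne']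
      rfl
    change w = (∑' n : ℕ, (lam⁻¹ • P) ^ n) (lam⁻¹ • v)
    rw [h3, ← mul_apply_eq_comp, geom_series_mul_neg _ hlt]
    rfl
  have hn : ∀ (n : ℕ) i, 0 ≤ ((lam⁻¹ • P) ^ n) (lam⁻¹ • v) i := by
    intro n
    induction n with
    | zero => exact fun i => mul_nonneg (inv_nonneg.2 hlam0.le) (hv i)
    | succ n ih =>
      intro i
      rw [pow_succ', mul_apply_eq_comp]
      exact mul_nonneg (inv_nonneg.2 hlam0.le) (hpos _ ih i)
  exact (hasSum_apply hsum i).nonneg fun n => hn n i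

theorem isUnit_smul_id_sub {P : L1 ℝ J →L[ℝ] L1 ℝ J} (hP : ‖P‖ ≤ 1) {lam : ℝ} (hlam : 1 < lam) :
    IsUnit (lam • ContinuousLinearMap.id ℝ (L1 ℝ J) - P) := by
  have hlam0 : 0 < lam := one_pos.trans hlam
  have hlt : ‖lam⁻¹ • P‖ < 1 := by
    rw [norm_smul, norm_inv, Real.norm_of_nonneg hlam0.le]
    exact (mul_le_of_le_one_right (inv_nonneg.2 hlam0.le) hP).trans_lt (inv_lt_one_of_one_lt₀ hlam)
  have h := (isUnit_one_sub_of_norm_lt_one hlt).smul (Units.mk0 lam hlam0.ne')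
  convert! h using 1
  change _ = lam • (1 - lam⁻¹ • P)
  rw [smul_sub, smul_inv_smul₀ hlam0.ne']
  rfl

theorem ActsAs.nonneg {α β : Type*} {M : Matrix β α ℕ} {A : L1 ℝ α →L[ℝ] L1 ℝ β}
    (h : ActsAs M A) {y : L1 ℝ α} (hy : ∀ i, 0 ≤ y i) (i : β) : 0 ≤ A y i :=
  (h y i).nonneg fun j => mul_nonneg (Nat.cast_nonneg _) (hy j)

theorem ActsAs.pos {α β : Type*} {M : Matrix β α ℕ} {A : L1 ℝ α →L[ℝ] L1 ℝ β}
    (h : ActsAs M A) {y : L1 ℝ α} (hy : ∀ i, 0 ≤ y i) {i : β} {j : α} (hij : 0 < M i j)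
    (hj : 0 < y j) : 0 < A y i :=
  (mul_pos (Nat.cast_pos.2 hij) hj).trans_le <|
    le_hasSum (h y i) j fun k _ => mul_nonneg (Nat.cast_nonneg _) (hy k)

/-- Weights for a block triangular matrix whose lower right block has column sums at most one: a
positive left eigenvector of the upper left block for the eigenvalue `lam > 1`, and a small constant
on the other indices. -/
theorem spectralRadius_le_of_blocks [Fintype E] [Nonempty E] {M : Matrix (E ⊕ J) (E ⊕ J) ℕ}
    {A : L1 ℂ (E ⊕ J) →L[ℂ] L1 ℂ (E ⊕ J)} (hM : ActsAs M A) (h12 : M.toBlocks₁₂ = 0) {b : ℝ≥0}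
    (hb : ∀ e, ∑' i, (M.toBlocks₂₁ i e : ℝ≥0∞) ≤ b)
    (hP : ∀ j, ∑' i, (M.toBlocks₂₂ i j : ℝ≥0∞) ≤ 1) {lam : ℝ} (hlam : 1 < lam) {x : E → ℝ}
    (hx : ∀ e, 0 < x e)
    (hxN : Matrix.vecMul x (M.toBlocks₁₁.map (Nat.cast : ℕ → ℝ)) = lam • x) :
    spectralRadius ℂ A ≤ ENNReal.ofReal lam := by
  obtain ⟨e₀, -, he₀⟩ := Finset.exists_min_image Finset.univ x Finset.univ_nonempty
  lift x to E → ℝ≥0 using fun e => (hx e).le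
  lift lam to ℝ≥0 using (zero_le_one.trans hlam.le)
  replace hx : ∀ e, 0 < x e := hx
  rw [ENNReal.ofReal_coe_nnreal]
  refine ENNReal.le_of_forall_pos_le_add fun ε hε _ => ?_
  have hlam' : 1 ≤ lam := by exact_mod_cast hlam.le
  set δ : ℝ≥0 := ε * x e₀ / (b + 1)
  have hδ : 0 < δ := by have := hx e₀; positivity
  have hδb : δ * b ≤ ε * x e₀ := by
    calc δ * b ≤ δ * (b + 1) := by gcongr; exact le_self_add
      _ = ε * x e₀ := div_mul_cancel₀ _ (by positivity)
  have hcol : ∀ e, ∑ e', x e' * M.toBlocks₁₁ e' e = lam * x e := fun e => by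
    have := congrFun hxN e
    simp only [Matrix.vecMul, dotProduct, Matrix.map_apply, Pi.smul_apply, smul_eq_mul] at this
    exact_mod_cast this
  have hE : ∀ e, x e ≤ ∑ e, x e := fun e =>
    Finset.single_le_sum (fun _ _ => zero_le) (Finset.mem_univ e)
  rw [← ENNReal.coe_add]
  refine spectralRadius_le_of_weights hM (u := Sum.elim (fun e => (x e : ℝ≥0∞)) fun _ => δ)
    (c := min (x e₀) δ) (C := ∑ e, x e + δ) (lt_min (hx e₀) hδ).ne' ?_ ?_ ?_
  · rintro (e | i)
    · exact ENNReal.coe_le_coe.2 ((min_le_left _ _).trans (he₀ e (Finset.mem_univ e)))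
    · exact ENNReal.coe_le_coe.2 (min_le_right _ _)
  · rintro (e | i)
    · exact ENNReal.coe_le_coe.2 ((hE e).trans le_self_add)
    · exact ENNReal.coe_le_coe.2 le_add_self
  · rintro (e | j)
    · rw [ENNReal.summable.tsum_sum ENNReal.summable, tsum_fintype]
      simp only [Sum.elim_inl, Sum.elim_inr]
      rw [ENNReal.tsum_mul_left]
      have h1 : ∑ e', (x e' : ℝ≥0∞) * (M (Sum.inl e') (Sum.inl e)) = (lam * x e : ℝ≥0) := by
        rw [← hcol e]; push_cast; rfl
      have h2 : (δ : ℝ≥0∞) * ∑' i, (M (Sum.inr i) (Sum.inl e) : ℝ≥0∞) ≤ (ε * x e : ℝ≥0) := by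
        refine (mul_le_mul_right (hb e) _).trans ?_
        rw [← ENNReal.coe_mul]
        refine ENNReal.coe_le_coe.2 (hδb.trans ?_)
        gcongr
        exact he₀ e (Finset.mem_univ e)
      rw [h1, ← ENNReal.coe_mul, add_mul, ENNReal.coe_add]
      gcongr
    · rw [ENNReal.summable.tsum_sum ENNReal.summable, tsum_fintype]
      simp only [Sum.elim_inl, Sum.elim_inr]
      have h0 : ∀ e, M (Sum.inl e) (Sum.inr j) = 0 := fun e => congrFun (congrFun h12 e) j
      simp only [h0, Nat.cast_zero, mul_zero, Finset.sum_const_zero, zero_add]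
      rw [ENNReal.tsum_mul_left, mul_comm]
      gcongr
      refine (hP j).trans ?_
      exact_mod_cast hlam'.trans le_self_add

theorem isPerronFrobenius_of_eigenvector {α : Type*} [Nonempty α] {M : Matrix α α ℕ}
    {A : L1 ℝ α →L[ℝ] L1 ℝ α} {A' : L1 ℂ α →L[ℂ] L1 ℂ α} (hA : ActsAs M A) (hA' : ActsAs M A')
    {lam : ℝ} (hlam : 0 ≤ lam) {y : L1 ℝ α} (hy : ∀ i, 0 < y i) (h : A y = lam • y)
    (huniq : ∀ (z : L1 ℝ α) (mu : ℝ), (∀ i, 0 < z i) → A z = mu • z →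
      mu = lam ∧ ∃ c : ℝ, z = c • y)
    (hr : spectralRadius ℂ A' ≤ ENNReal.ofReal lam) : IsPerronFrobenius M lam :=
  ⟨⟨A, hA, y, hy, h, huniq⟩,
    ⟨A', hA', hr.antisymm (le_spectralRadius_of_eigenvector hA hA' hlam hy h)⟩⟩

theorem spectralRadius_le_of_vecMul [Fintype E] [Nonempty E] {M : Matrix E E ℕ}
    {A : L1 ℂ E →L[ℂ] L1 ℂ E} (hM : ActsAs M A) {lam : ℝ} (hlam : 0 ≤ lam) {x : E → ℝ}
    (hx : ∀ e, 0 < x e) (hxN : Matrix.vecMul x (M.map (Nat.cast : ℕ → ℝ)) = lam • x) :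
    spectralRadius ℂ A ≤ ENNReal.ofReal lam := by
  obtain ⟨e₀, -, he₀⟩ := Finset.exists_min_image Finset.univ x Finset.univ_nonempty
  lift x to E → ℝ≥0 using fun e => (hx e).le
  lift lam to ℝ≥0 using hlam
  replace hx : ∀ e, 0 < x e := hx
  rw [ENNReal.ofReal_coe_nnreal]
  refine spectralRadius_le_of_weights hM (u := fun e => (x e : ℝ≥0∞)) (c := x e₀)
    (C := ∑ e, x e) (hx e₀).ne' (fun e => ENNReal.coe_le_coe.2 (he₀ e (Finset.mem_univ e)))
    (fun e => ENNReal.coe_le_coe.2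
      (Finset.single_le_sum (fun _ _ => zero_le) (Finset.mem_univ e))) fun e => ?_
  have := congrFun hxN e
  simp only [Matrix.vecMul, dotProduct, Matrix.map_apply, Pi.smul_apply, smul_eq_mul] at this
  have h : ∑ e', x e' * M e' e = lam * x e := by exact_mod_cast this
  rw [tsum_fintype, ← ENNReal.coe_mul, ← h]
  push_cast
  rfl

/-- On a finite index set every vector is summable. -/
def L1.ofFintype [Finite E] (v : E → 𝕜) : L1 𝕜 E := ⟨v, Memℓp.all v⟩

theorem mulVec_eq_smul_of_actsAs [Fintype E] {M : Matrix E E ℕ} {N : L1 ℝ E →L[ℝ] L1 ℝ E}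
    (hN : ActsAs M N) {z : L1 ℝ E} {mu : ℝ} :
    Matrix.mulVec (M.map (Nat.cast : ℕ → ℝ)) z = mu • (z : E → ℝ) ↔ N z = mu • z := by
  have h : ∀ e, Matrix.mulVec (M.map (Nat.cast : ℕ → ℝ)) z e = N z e := fun e =>
    (hasSum_fintype _).unique (hN z e)
  constructor
  · intro h1
    ext e
    exact (h e).symm.trans (congrFun h1 e)
  · intro h1
    ext e
    rw [h, h1]
    rfl

/-- A block triangular matrix of natural numbers whose finite upper left block is primitive and
not `(1)`, whose lower left block has bounded column sums, and whose lower right block has column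
sums at most one, satisfies the Perron–Frobenius theorem on summable families, provided that every
index can be reached from the upper left block. -/
theorem perronFrobenius_of_blocks [Fintype E] [DecidableEq E] {M : Matrix (E ⊕ J) (E ⊕ J) ℕ}
    (h12 : M.toBlocks₁₂ = 0) {b : ℝ≥0} (hb : ∀ e, ∑' i, (M.toBlocks₂₁ i e : ℝ≥0∞) ≤ b)
    (hQ : ∀ j, ∑' i, (M.toBlocks₂₂ i j : ℝ≥0∞) ≤ 1)
    (hreach : ∀ p : J → Prop, (∀ i e, 0 < M (Sum.inr i) (Sum.inl e) → p i) →
      (∀ i j, p j → 0 < M (Sum.inr i) (Sum.inr j) → p i) → ∀ i, p i)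
    (hprim : ∃ k : ℕ, 0 < k ∧ ∀ i j, 0 < (M.toBlocks₁₁ ^ k) i j) (hone : M.toBlocks₁₁ ≠ 1) :
    ∃ lam : ℝ, 1 < lam ∧ IsPerronFrobenius M.toBlocks₁₁ lam ∧ IsPerronFrobenius M lam ∧
      ∃ (A : L1 ℝ (E ⊕ J) →L[ℝ] L1 ℝ (E ⊕ J)) (N : L1 ℝ E →L[ℝ] L1 ℝ E)
        (B : L1 ℝ E →L[ℝ] L1 ℝ J) (P : L1 ℝ J →L[ℝ] L1 ℝ J),
        ActsAs M A ∧ ActsAs M.toBlocks₁₁ N ∧ ActsAs M.toBlocks₂₁ B ∧ ActsAs M.toBlocks₂₂ P ∧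
        IsUnit (lam • ContinuousLinearMap.id ℝ (L1 ℝ J) - P) ∧
        ∀ Y : L1 ℝ E, (∀ e, 0 < Y e) → N Y = lam • Y →
          ∃ y : L1 ℝ (E ⊕ J), (∀ e, y (Sum.inl e) = Y e) ∧
            (∀ i, y (Sum.inr i) =
              Ring.inverse (lam • ContinuousLinearMap.id ℝ (L1 ℝ J) - P) (B Y) i) ∧
            (∀ e, 0 < y e) ∧ A y = lam • y := by
  obtain ⟨k, hk0, hk⟩ := hprim
  obtain ⟨lam, hlam, v, x, hv, hx, hNv, hxN⟩ := exists_perronFrobenius_nat hk0 hk hone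
  have hne : Nonempty E := by
    by_contra h
    rw [not_nonempty_iff] at h
    exact hone (Subsingleton.elim _ _)
  have hlam0 : 0 < lam := one_pos.trans hlam
  set n : ℝ≥0 := ∑ e', ∑ e, (M.toBlocks₁₁ e e' : ℝ≥0)
  have hn : ∀ e', ∑' e, (M.toBlocks₁₁ e e' : ℝ≥0∞) ≤ n := fun e' => by
    rw [tsum_fintype]
    have : ∑ e, (M.toBlocks₁₁ e e' : ℝ≥0) ≤ n :=
      Finset.single_le_sum (f := fun e' => ∑ e, (M.toBlocks₁₁ e e' : ℝ≥0)) (fun _ _ => zero_le)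
        (Finset.mem_univ e')
    exact_mod_cast this
  have hM : ∀ j, ∑' i, (M i j : ℝ≥0∞) ≤ (n + b + 1 : ℝ≥0) := by
    push_cast
    rintro (e | j) <;> rw [ENNReal.summable.tsum_sum ENNReal.summable]
    · exact (add_le_add (hn e) (hb e)).trans le_self_add
    · have h0 : ∀ e, M (Sum.inl e) (Sum.inr j) = 0 := fun e => congrFun (congrFun h12 e) j
      simp only [h0, Nat.cast_zero, tsum_zero, zero_add]
      exact (hQ j).trans le_add_self
  obtain ⟨A, hA, -⟩ := exists_actsAs ℝ hM
  obtain ⟨A', hA', -⟩ := exists_actsAs ℂ hM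
  obtain ⟨N, hN, -⟩ := exists_actsAs ℝ hn
  obtain ⟨N', hN', -⟩ := exists_actsAs ℂ hn
  obtain ⟨B, hB, -⟩ := exists_actsAs ℝ hb
  obtain ⟨P, hP, hP1⟩ := exists_actsAs ℝ (C := 1) (fun j => by simpa using hQ j)
  replace hP1 : ‖P‖ ≤ 1 := hP1
  have hunit := isUnit_smul_id_sub hP1 hlam
  have heig : ∀ y mu, A y = mu • y ↔ N y.fst = mu • y.fst ∧
      (mu • ContinuousLinearMap.id ℝ (L1 ℝ J) - P) y.snd = B y.fst :=
    eigenvector_iff_of_blocks hA hN hB hP h12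
  set R := lam • ContinuousLinearMap.id ℝ (L1 ℝ J) - P
  have hRinv : ∀ w, R (Ring.inverse R w) = w := fun w => by
    rw [← mul_apply_eq_comp, Ring.mul_inverse_cancel _ hunit]; rfl
  have hRinj : Function.Injective R := fun a c hac => by
    have : ∀ w, Ring.inverse R (R w) = w := fun w => by
      rw [← mul_apply_eq_comp, Ring.inverse_mul_cancel _ hunit]; rfl
    rw [← this a, hac, this]
  have hext : ∀ Y : L1 ℝ E, (∀ e, 0 < Y e) → N Y = lam • Y →
      (∀ e, 0 < (Y.join (Ring.inverse R (B Y))) e) ∧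
        A (Y.join (Ring.inverse R (B Y))) = lam • Y.join (Ring.inverse R (B Y)) := by
    intro Y hY hNY
    set w := Ring.inverse R (B Y) with hw
    have hAy : A (Y.join w) = lam • Y.join w := (heig _ _).2 ⟨hNY, hRinv _⟩
    have hw0 : ∀ i, 0 ≤ w i := nonneg_of_neumann hP1 (fun y hy => hP.nonneg hy) hlam
      (hB.nonneg fun e => (hY e).le) (hRinv _)
    have hy0 : ∀ j, 0 ≤ (Y.join w) j := by
      rintro (e | i)
      exacts [(hY e).le, hw0 i]
    have hstep : ∀ i j, 0 < M (Sum.inr i) j → 0 < (Y.join w) j → 0 < w i := by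
      intro i j hij hj
      have h1 := hA.pos hy0 hij hj
      rw [hAy] at h1
      exact pos_of_mul_pos_right h1 hlam0.le
    refine ⟨?_, hAy⟩
    rintro (e | i)
    · exact hY e
    · exact hreach (fun i => 0 < w i) (fun i e h => hstep i _ h (hY e))
        (fun i j hj h => hstep i _ h hj) i
  have huniq : ∀ (z : L1 ℝ E) (mu : ℝ), (∀ i, 0 < z i) → N z = mu • z →
      mu = lam ∧ ∃ c : ℝ, z = c • L1.ofFintype v := by
    intro z mu hz hNz
    rw [← mulVec_eq_smul_of_actsAs hN] at hNz
    obtain rfl := eigenvalue_eq_of_vecMul hz hx hNz hxN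
    refine ⟨rfl, ?_⟩
    have hk' : ∀ i j, 0 < ((M.toBlocks₁₁.map (Nat.cast : ℕ → ℝ)) ^ k) i j := fun i j => by
      have := Matrix.map_pow M.toBlocks₁₁ (Nat.castRingHom ℝ) k
      change 0 < ((M.toBlocks₁₁.map (Nat.castRingHom ℝ)) ^ k) i j
      rw [← this]
      exact Nat.cast_pos.2 (hk i j)
    obtain ⟨c, hc⟩ := exists_eq_smul_of_pos_eigenvector hk' hlam0.le hv hNv hNz
    exact ⟨c, by ext e; exact congrFun hc e⟩
  have hNV : N (L1.ofFintype v) = lam • L1.ofFintype v := (mulVec_eq_smul_of_actsAs hN).1 hNv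
  obtain ⟨hypos, hAy⟩ := hext (L1.ofFintype v) hv hNV
  refine ⟨lam, hlam, ?_, ?_, A, N, B, P, hA, hN, hB, hP, hunit, fun Y hY hNY => ?_⟩
  · exact isPerronFrobenius_of_eigenvector hN hN' hlam0.le (y := L1.ofFintype v) hv hNV huniq
      (spectralRadius_le_of_vecMul hN' hlam0.le hx hxN)
  · refine isPerronFrobenius_of_eigenvector hA hA' hlam0.le hypos hAy (fun z mu hz hAz => ?_)
      (spectralRadius_le_of_blocks hA' h12 hb hQ hlam hx hxN)
    obtain ⟨h1, h2⟩ := (heig z mu).1 hAz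
    obtain ⟨rfl, c, hc⟩ := huniq z.fst mu (fun e => hz _) h1
    refine ⟨rfl, c, ?_⟩
    have h3 : z.snd = c • Ring.inverse R (B (L1.ofFintype v)) := by
      apply hRinj
      rw [map_smul, hRinv, ← map_smul, ← hc]
      exact h2
    ext (e | i)
    · exact congrArg (fun z : L1 ℝ E => z e) hc
    · exact congrArg (fun z : L1 ℝ J => z i) h3
  · obtain ⟨h1, h2⟩ := hext Y hY hNY
    exact ⟨_, fun e => rfl, fun i => rfl, h1, h2⟩

end Blocks

/-! ### Topology of thick graphs -/

theorem half_pos' : (0 : I) < half := by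
  rw [← Subtype.coe_lt_coe]; norm_num [half]

theorem half_lt_one' : half < (1 : I) := by
  rw [← Subtype.coe_lt_coe]; norm_num [half]

theorem continuous_fromEnd (b : Bool) : Continuous (fromEnd b) := by
  cases b
  · exact continuous_id
  · simpa [fromEnd] using! continuous_symm

theorem fromEnd_zero_inj {b b' : Bool} (h : fromEnd b 0 = fromEnd b' 0) : b = b' := by
  cases b <;> cases b' <;> simp [fromEnd] at h <;> rfl

theorem fromEnd_mem_Ioo {b : Bool} {x : I} (h0 : 0 < x) (h1 : x < 1) :
    0 < fromEnd b x ∧ fromEnd b x < 1 := by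
  cases b
  · exact ⟨h0, h1⟩
  · have h0' : (0 : ℝ) < x := h0
    have h1' : (x : ℝ) < 1 := h1
    refine ⟨?_, ?_⟩ <;> rw [← Subtype.coe_lt_coe] <;> simp [fromEnd, h0', h1']

theorem exists_fromEnd_eq {x : I} (h : ¬ (0 < x ∧ x < 1)) : ∃ b, x = fromEnd b 0 := by
  by_cases h0 : 0 < x
  · exact ⟨true, by simpa [fromEnd] using le_antisymm x.2.2 (not_lt.1 fun h1 => h ⟨h0, h1⟩)⟩
  · exact ⟨false, le_antisymm (not_lt.1 h0) x.2.1⟩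

namespace FiniteThickGraph

variable {S : Type*} [MetricSpace S] [ChartedSpace ℂ S] (T : FiniteThickGraph S)

/-- The end `b` of the closed strip `e`: the arc along which the strip is attached to a
junction. -/
def endArc (q : T.E × Bool) : Set S := range fun y : I => T.rect q.1 (fromEnd q.2 0, y)

variable {T}

theorem rect_eq_iff {e e' : T.E} {p p' : I × I} : T.rect e p = T.rect e' p' ↔ e = e' ∧ p = p' := by
  constructor
  · intro h
    simpa using T.rect_injective (a₁ := (e, p)) (a₂ := (e', p')) h
  · rintro ⟨rfl, rfl⟩; rfl

theorem switch_mem_endArc (q : T.E × Bool) : T.switch q ∈ T.endArc q := ⟨half, rfl⟩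

theorem switch_injective : Function.Injective T.switch := by
  rintro ⟨e, b⟩ ⟨e', b'⟩ h
  obtain ⟨rfl, h2⟩ := rect_eq_iff.1 h
  exact Prod.ext rfl (fromEnd_zero_inj (Prod.ext_iff.1 h2).1)

theorem endArc_eq {p : S} {q q' : T.E × Bool} (h : p ∈ T.endArc q) (h' : p ∈ T.endArc q') :
    q = q' := by
  obtain ⟨y, rfl⟩ := h
  obtain ⟨y', h'⟩ := h'
  obtain ⟨h1, h2⟩ := rect_eq_iff.1 h'
  exact Prod.ext h1.symm (fromEnd_zero_inj (Prod.ext_iff.1 h2).1).symm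

theorem endArc_subset_junction (q : T.E × Bool) :
    T.endArc q ⊆ T.junction (T.endVertex q.1 q.2) := by
  rintro _ ⟨y, rfl⟩
  exact T.rect_end q.1 q.2 y

theorem endArc_subset_junctions (q : T.E × Bool) : T.endArc q ⊆ T.junctions :=
  (endArc_subset_junction q).trans (subset_iUnion _ _)

theorem endArc_subset_range (q : T.E × Bool) : T.endArc q ⊆ range (T.rect q.1) := by
  rintro _ ⟨y, rfl⟩
  exact mem_range_self _

theorem endArc_subset_bdry (q : T.E × Bool) : T.endArc q ⊆ T.bdry (T.endVertex q.1 q.2) :=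
  fun _ h => ⟨endArc_subset_junction q h, mem_iUnion.2 ⟨q.1, endArc_subset_range q h⟩⟩

theorem notMem_junctions_of_mem_strip {p : S} {e : T.E} (h : p ∈ T.strip e) : p ∉ T.junctions := by
  obtain ⟨x, y, h0, h1, rfl⟩ := h
  simp only [junctions, mem_iUnion, not_exists]
  exact fun v => T.rect_notMem e x y v h0 h1

theorem strip_subset_range (e : T.E) : T.strip e ⊆ range (T.rect e) := by
  rintro _ ⟨x, y, -, -, rfl⟩
  exact mem_range_self _

theorem mem_strip_or_endArc {p : S} {e : T.E} (h : p ∈ range (T.rect e)) :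
    p ∈ T.strip e ∨ ∃ b, p ∈ T.endArc (e, b) := by
  obtain ⟨⟨x, y⟩, rfl⟩ := h
  by_cases hx : 0 < x ∧ x < 1
  · exact Or.inl ⟨x, y, hx.1, hx.2, rfl⟩
  · obtain ⟨b, hb⟩ := exists_fromEnd_eq hx
    exact Or.inr ⟨b, y, by rw [hb]⟩

theorem mem_junctions_or_strip {p : S} (h : p ∈ T.body) :
    p ∈ T.junctions ∨ ∃ e, p ∈ T.strip e := by
  rcases h with h | h
  · exact Or.inl h
  · obtain ⟨e, he⟩ := mem_iUnion.1 h
    rcases mem_strip_or_endArc he with h | ⟨b, h⟩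
    · exact Or.inr ⟨e, h⟩
    · exact Or.inl (endArc_subset_junctions _ h)

theorem exists_mem_endArc {p : S} {v : T.V} (h : p ∈ T.bdry v) : ∃ q, p ∈ T.endArc q := by
  obtain ⟨e, he⟩ := mem_iUnion.1 h.2
  rcases mem_strip_or_endArc he with h' | ⟨b, h'⟩
  · exact absurd (mem_iUnion.2 ⟨v, h.1⟩) (notMem_junctions_of_mem_strip h')
  · exact ⟨_, h'⟩

theorem eq_of_mem_junction {p : S} {v w : T.V} (h : p ∈ T.junction v) (h' : p ∈ T.junction w) :
    v = w := by
  by_contra hne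
  exact (T.junction_disjoint v w hne).le_bot ⟨h, h'⟩

theorem isClosed_junction (v : T.V) : IsClosed (T.junction v) := by
  obtain ⟨c, ε, -, hsub, him, -⟩ := T.junction_chart v
  have h : T.junction v = c.symm '' Metric.closedBall 0 1 := by
    rw [← him]
    exact (c.toPartialEquiv.symm_image_image_of_subset_source hsub).symm
  rw [h]
  refine ((isCompact_closedBall _ _).image_of_continuousOn
    (c.continuousOn_symm.mono ?_)).isClosed
  rw [← him]
  rintro _ ⟨p, hp, rfl⟩
  exact c.map_source (hsub hp)

theorem isClosed_junctions : IsClosed T.junctions := isClosed_iUnion_of_finite isClosed_junction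

theorem isClosed_range_rect (e : T.E) : IsClosed (range (T.rect e)) :=
  (isCompact_range (T.rect e).continuous).isClosed

theorem isEmbedding_rect (e : T.E) : IsEmbedding (T.rect e) :=
  ((T.rect e).continuous.isClosedEmbedding fun _ _ h => (rect_eq_iff.1 h).2).isEmbedding

/-- A junction is the closure of its interior. -/
theorem junction_subset_closure_interior (v : T.V) :
    T.junction v ⊆ closure (interior (T.junction v)) := by
  obtain ⟨c, ε, -, hsub, him, -⟩ := T.junction_chart v
  intro p hp
  have hball : Metric.ball (0 : ℂ) 1 ⊆ c.target := by
    refine Metric.ball_subset_closedBall.trans ?_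
    rw [← him]
    rintro _ ⟨p, hp, rfl⟩
    exact c.map_source (hsub hp)
  have hopen : IsOpen (c.symm '' Metric.ball 0 1) :=
    c.isOpen_image_symm_of_subset_target Metric.isOpen_ball hball
  have hint : c.symm '' Metric.ball 0 1 ⊆ interior (T.junction v) := by
    refine interior_maximal ?_ hopen
    have h : c.symm '' (c '' T.junction v) = T.junction v :=
      c.toPartialEquiv.symm_image_image_of_subset_source hsub
    rw [← h, him]
    exact image_mono Metric.ball_subset_closedBall
  refine closure_mono hint ?_
  have hcp : c p ∈ closure (Metric.ball (0 : ℂ) 1) := by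
    rw [closure_ball _ one_ne_zero, ← him]
    exact mem_image_of_mem _ hp
  have := mem_closure_image (c.continuousAt_symm (c.map_source (hsub hp))) hcp
  rwa [c.left_inv (hsub hp)] at this

theorem tendsto_rect_fromEnd (e : T.E) (b : Bool) (y : I) :
    Tendsto (fun x => T.rect e (fromEnd b x, y)) (𝓝[>] 0) (𝓝 (T.rect e (fromEnd b 0, y))) := by
  have : Continuous fun x => T.rect e (fromEnd b x, y) :=
    (T.rect e).continuous.comp ((continuous_fromEnd b).prodMk continuous_const)
  exact this.continuousAt.mono_left nhdsWithin_le_nhds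

theorem eventually_lt_nhdsGT {a u : I} (h : a < u) : ∀ᶠ x in 𝓝[>] a, x < u :=
  (eventually_lt_nhds h).filter_mono nhdsWithin_le_nhds

instance nhdsGT_zero_neBot : (𝓝[>] (0 : I)).NeBot := nhdsGT_neBot_of_exists_gt ⟨1, one_pos⟩

/-- The ends of the strips lie on the boundaries of the junctions. -/
theorem notMem_interior_junctions {p : S} {q : T.E × Bool} (h : p ∈ T.endArc q) :
    p ∉ interior T.junctions := by
  obtain ⟨y, rfl⟩ := h
  intro hp
  have h1 := (tendsto_rect_fromEnd q.1 q.2 y).eventually (isOpen_interior.mem_nhds hp)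
  obtain ⟨x, hx, hx0, hx1⟩ := (h1.and ((eventually_mem_nhdsWithin (s := Ioi 0)).and
    (eventually_lt_nhdsGT (zero_lt_one' I)))).exists
  obtain ⟨h0, h1⟩ := fromEnd_mem_Ioo (b := q.2) hx0 hx1
  exact notMem_junctions_of_mem_strip ⟨_, y, h0, h1, rfl⟩ (interior_subset hx)

/-- The points of a strip near an interior leaf form a neighbourhood of the core of the leaf. -/
theorem image_rect_mem_nhds (e : T.E) {x y : I} (hx0 : 0 < x) (hx1 : x < 1) (hy0 : 0 < y)
    (hy1 : y < 1) {U : Set I} (hU : U ∈ 𝓝 x) :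
    T.rect e '' (U ×ˢ univ) ∈ 𝓝 (T.rect e (x, y)) := by
  obtain ⟨c, ε, hε, hc, -⟩ := T.leaf_chart e x hx0 hx1
  obtain ⟨hp, hcp⟩ := hc x y (by simpa using hε)
  rw [nhds_subtype_eq_comap] at hU
  obtain ⟨V, hV, hVU⟩ := hU
  have hcont := c.continuousAt hp
  have hre : Tendsto (fun s => (c s).re) (𝓝 (T.rect e (x, y))) (𝓝 (x : ℝ)) := by
    have := Complex.continuous_re.continuousAt.tendsto.comp hcont
    rwa [hcp] at this
  have him : Tendsto (fun s => (c s).im) (𝓝 (T.rect e (x, y))) (𝓝 (y : ℝ)) := by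
    have := Complex.continuous_im.continuousAt.tendsto.comp hcont
    rwa [hcp] at this
  filter_upwards [c.open_source.mem_nhds hp, hre.eventually hV,
    hre.eventually (Ioo_mem_nhds (show (0 : ℝ) < x from hx0) hx1),
    him.eventually (Ioo_mem_nhds (show (0 : ℝ) < y from hy0) hy1),
    hre.eventually (Metric.ball_mem_nhds _ hε)] with s hs h1 h2 h3 h4
  let x' : I := ⟨(c s).re, h2.1.le, h2.2.le⟩
  let y' : I := ⟨(c s).im, h3.1.le, h3.2.le⟩
  obtain ⟨h5, h6⟩ := hc x' y' h4
  exact ⟨(x', y'), ⟨hVU h1, mem_univ _⟩, c.injOn h5 hs h6⟩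

/-- An injective continuous curve in the unit circle covers a neighbourhood of its interior
points. -/
theorem mem_image_of_injective_circle {w : I → ℂ} (hw : Continuous w) (hinj : Function.Injective w)
    (hnorm : ∀ y, ‖w y‖ = 1) {y₀ : I} (h0 : 0 < y₀) (h1 : y₀ < 1) :
    ∀ᶠ z in 𝓝 (w y₀), ∃ y, z = ‖z‖ * w y := by
  have hne : ∀ y, w y ≠ 0 := fun y => norm_ne_zero_iff.1 (by rw [hnorm]; exact one_ne_zero)
  -- the argument relative to `w y₀` is continuous and injective near `y₀`, hence monotone
  set a : I → ℝ := fun y => (w y / w y₀).arg with ha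
  have hslit : w y₀ / w y₀ ∈ Complex.slitPlane := by
    rw [div_self (hne _)]; exact Complex.one_mem_slitPlane
  have hcont : Continuous fun y => w y / w y₀ := hw.div_const _
  have hev : ∀ᶠ y in 𝓝 y₀, w y / w y₀ ∈ Complex.slitPlane :=
    hcont.continuousAt.eventually (Complex.isOpen_slitPlane.mem_nhds hslit)
  obtain ⟨l', u', hy₀, hlu⟩ := (mem_nhds_iff_exists_Ioo_subset' ⟨0, h0⟩ ⟨1, h1⟩).1 hev
  obtain ⟨l, hl1, hl2⟩ := exists_between hy₀.1
  obtain ⟨u, hu1, hu2⟩ := exists_between hy₀.2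
  have hsub : ∀ y ∈ Icc l u, w y / w y₀ ∈ Complex.slitPlane := fun y hy =>
    hlu ⟨hl1.trans_le hy.1, hy.2.trans_lt hu2⟩
  have hac : ContinuousOn a (Icc l u) := fun y hy =>
    (ContinuousAt.comp (f := fun y => w y / w y₀) (Complex.continuousAt_arg (hsub y hy))
      hcont.continuousAt).continuousWithinAt
  have hpolar : ∀ y, w y / w y₀ = Complex.exp (a y * Complex.I) := fun y => by
    have := Complex.norm_mul_exp_arg_mul_I (w y / w y₀)
    rw [norm_div, hnorm, hnorm, div_one, Complex.ofReal_one, one_mul] at this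
    exact this.symm
  have hai : InjOn a (Icc l u) := fun y _ y' _ h => hinj <| by
    have : w y / w y₀ = w y' / w y₀ := by rw [hpolar, hpolar, h]
    exact (div_left_inj' (hne _)).1 this
  have hlu' : l ≤ u := (hl2.trans hu1).le
  have ha0 : a y₀ = 0 := by simp [ha]
  have hmem0 : y₀ ∈ Icc l u := ⟨hl2.le, hu1.le⟩
  have hcover : a '' Icc l u ∈ 𝓝 (0 : ℝ) := by
    rcases hac.strictMonoOn_of_injOn_Icc' hlu' hai with hm | hm
    · refine mem_of_superset (Icc_mem_nhds ?_ ?_) (intermediate_value_Icc hlu' hac)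
      · rw [← ha0]; exact hm (left_mem_Icc.2 hlu') hmem0 hl2
      · rw [← ha0]; exact hm hmem0 (right_mem_Icc.2 hlu') hu1
    · refine mem_of_superset (Icc_mem_nhds ?_ ?_) (intermediate_value_Icc' hlu' hac)
      · rw [← ha0]; exact hm hmem0 (right_mem_Icc.2 hlu') hu1
      · rw [← ha0]; exact hm (left_mem_Icc.2 hlu') hmem0 hl2
  have harg : Tendsto (fun z => (z / w y₀).arg) (𝓝 (w y₀)) (𝓝 0) := by
    have h2 : ContinuousAt (fun z : ℂ => (z / w y₀).arg) (w y₀) :=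
      ContinuousAt.comp (f := fun z : ℂ => z / w y₀) (Complex.continuousAt_arg hslit)
        (continuous_id.div_const _).continuousAt
    have h3 := h2.tendsto
    rwa [div_self (hne _), Complex.arg_one] at h3
  filter_upwards [harg.eventually hcover] with z hz
  obtain ⟨y, -, hy⟩ := hz
  refine ⟨y, ?_⟩
  have h2 := Complex.norm_mul_exp_arg_mul_I (z / w y₀)
  rw [← hy, ← hpolar, norm_div, hnorm, div_one, ← mul_div_assoc] at h2
  exact ((div_left_inj' (hne _)).1 h2).symm

/-- The junction and the strip that meet at a switch together form a neighbourhood of it. -/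
theorem junction_union_mem_nhds_switch (q : T.E × Bool) {δ : I} (hδ : 0 < δ) :
    T.junction (T.endVertex q.1 q.2) ∪ {p | ∃ x y : I, 0 < x ∧ x < δ ∧
      p = T.rect q.1 (fromEnd q.2 x, y)} ∈ 𝓝 (T.switch q) := by
  obtain ⟨e, b⟩ := q
  obtain ⟨c, ε, hε, hsub, him, hc, -⟩ := T.junction_chart (T.endVertex e b)
  simp only at *
  have hrect := hc e b rfl
  set w : I → ℂ := fun y => c (T.rect e (fromEnd b 0, y)) with hw
  have hsource : ∀ y, T.rect e (fromEnd b 0, y) ∈ c.source := fun y => hsub (T.rect_end e b y)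
  have hwc : Continuous w := by
    refine c.continuousOn.comp_continuous ?_ hsource
    exact (T.rect e).continuous.comp (continuous_const.prodMk continuous_id)
  have hwi : Function.Injective w := fun y y' h =>
    (Prod.ext_iff.1 (rect_eq_iff.1 (c.injOn (hsource y) (hsource y') h)).2).2
  have hmem : ∀ s ∈ c.source, ‖c s‖ ≤ 1 → s ∈ T.junction (T.endVertex e b) := by
    intro s hs h
    have : c s ∈ c '' T.junction (T.endVertex e b) := by
      rw [him]; simpa using h
    obtain ⟨s', hs', h'⟩ := this
    rwa [← c.injOn (hsub hs') hs h']
  -- an end of a strip lies on the unit circle, as the adjacent points are not in the junction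
  have hnorm : ∀ y, ‖w y‖ = 1 := by
    intro y
    refine le_antisymm ?_ ?_
    · have : w y ∈ c '' T.junction (T.endVertex e b) := mem_image_of_mem _ (T.rect_end e b y)
      rw [him] at this
      simpa using this
    · have hlim : Tendsto (fun x : I => (1 + (x : ℝ)) * ‖w y‖) (𝓝[>] 0) (𝓝 ((1 + 0) * ‖w y‖)) := by
        have : Continuous fun x : I => (1 + (x : ℝ)) * ‖w y‖ := by fun_prop
        exact (this.tendsto 0).mono_left nhdsWithin_le_nhds
      rw [add_zero, one_mul] at hlim
      refine ge_of_tendsto hlim ?_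
      have hxε : ∀ᶠ x : I in 𝓝[>] 0, (x : ℝ) < ε :=
        (continuous_subtype_val.tendsto (0 : I)).mono_left nhdsWithin_le_nhds
          |>.eventually (eventually_lt_nhds hε)
      filter_upwards [hxε, self_mem_nhdsWithin, eventually_lt_nhdsGT (zero_lt_one' I)]
        with x h1 h2 h3
      obtain ⟨h4, h5⟩ := hrect x y h1
      by_contra hlt
      obtain ⟨h6, h7⟩ := fromEnd_mem_Ioo (b := b) h2 h3
      refine T.rect_notMem e _ y _ h6 h7 (hmem _ h4 ?_)
      have h0 : (0 : ℝ) ≤ 1 + x := add_nonneg zero_le_one x.2.1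
      rw [h5, norm_mul, ← Complex.ofReal_one, ← Complex.ofReal_add, Complex.norm_of_nonneg h0]
      exact (not_le.1 hlt).le
  have hcont := c.continuousAt (hsource half)
  have h1 := hcont.eventually (mem_image_of_injective_circle hwc hwi hnorm half_pos' half_lt_one')
  have h2 : Tendsto (fun s => ‖c s‖) (𝓝 (T.switch (e, b))) (𝓝 1) := by
    have := hcont.norm.tendsto
    rwa [show ‖c (T.rect e (fromEnd b 0, half))‖ = 1 from hnorm half] at this
  have hpos : (0 : ℝ) < min ε δ := lt_min hε hδ
  filter_upwards [c.open_source.mem_nhds (hsource half), h1,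
    h2.eventually (eventually_lt_nhds (lt_add_of_pos_right 1 hpos))] with s hs hy hlt
  by_cases hle : ‖c s‖ ≤ 1
  · exact Or.inl (hmem s hs hle)
  · right
    obtain ⟨y, hy⟩ := hy
    rw [not_le] at hle
    have h3 : ‖c s‖ - 1 < min ε δ := by linarith
    let x : I := ⟨‖c s‖ - 1, by linarith, by
      have := δ.2.2
      have := min_le_right ε (δ : ℝ)
      linarith⟩
    obtain ⟨h4, h5⟩ := hrect x y (h3.trans_le (min_le_left _ _))
    refine ⟨x, y, ?_, h3.trans_le (min_le_right _ _), ?_⟩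
    · rw [← Subtype.coe_lt_coe]
      simpa [x] using hle
    · refine c.injOn hs h4 ?_
      have h6 : (1 + ((x : ℝ) : ℂ)) = ‖c s‖ := by simp [x]
      rw [h5, h6]
      exact hy

end FiniteThickGraph

/-! ### Images of junctions, leaves and core arcs -/

section Maps

variable {S : Type*} [MetricSpace S] [ChartedSpace ℂ S] {T : FiniteThickGraph S} {F : S ≃ₜ S}

open FiniteThickGraph

/-- The image under `F` of the core arc of the strip `j`, as a path. -/
def coreImage (T : FiniteThickGraph S) (F : S ≃ₜ S) (j : T.E) (t : I) : S := F (T.rect j (t, half))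

theorem continuous_coreImage (j : T.E) : Continuous (coreImage T F j) :=
  F.continuous.comp ((T.rect j).continuous.comp (continuous_id.prodMk continuous_const))

/-- A homeomorphism maps junctions into junctions when it maps elements into elements: a leaf has no
interior. -/
theorem IsThickGraphMap.exists_image_junction_subset (hF : IsThickGraphMap T F) (v : T.V) :
    ∃ w, F '' T.junction v ⊆ T.junction w := by
  obtain ⟨γ, hγ, hsub⟩ := hF.element_subset (T.junction v) (Or.inl ⟨v, rfl⟩)
  rcases hγ with ⟨w, rfl⟩ | ⟨e, x, h0, h1, rfl⟩
  · exact ⟨w, hsub⟩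
  · exfalso
    obtain ⟨c, ε, -, hsrc, him, -⟩ := T.junction_chart v
    obtain ⟨p, hp⟩ : (T.junction v).Nonempty := by
      rw [← image_nonempty (f := c), him]
      exact ⟨0, by simp⟩
    obtain ⟨p', hp'⟩ : (interior (T.junction v)).Nonempty :=
      closure_nonempty_iff.1 ⟨p, junction_subset_closure_interior v hp⟩
    have hO : IsOpen (F '' interior (T.junction v)) := F.isOpenMap _ isOpen_interior
    obtain ⟨y, hy⟩ := hsub (mem_image_of_mem F (interior_subset hp'))
    have hcont : Continuous fun x' : I => T.rect e (x', y) :=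
      (T.rect e).continuous.comp (continuous_id.prodMk continuous_const)
    have hev : ∀ᶠ x' in 𝓝 x, T.rect e (x', y) ∈ F '' interior (T.junction v) :=
      hcont.continuousAt.eventually (hO.mem_nhds (by
        beta_reduce; rw [show T.rect e (x, y) = F p' from hy]; exact mem_image_of_mem F hp'))
    have := nhdsGT_neBot_of_exists_gt (a := x) ⟨1, h1⟩
    obtain ⟨x', hx', hlt⟩ := ((hev.filter_mono nhdsWithin_le_nhds).and
      (eventually_mem_nhdsWithin (s := Ioi x))).exists
    obtain ⟨y', hy'⟩ := hsub (image_mono interior_subset hx')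
    have h2 := (Prod.ext_iff.1 (rect_eq_iff.1 hy').2).1
    exact (ne_of_gt hlt) h2.symm

theorem IsThickGraphMap.map_mem_junctions (hF : IsThickGraphMap T F) {p : S}
    (hp : p ∈ T.junctions) : F p ∈ T.junctions := by
  obtain ⟨v, hv⟩ := mem_iUnion.1 hp
  obtain ⟨w, hw⟩ := hF.exists_image_junction_subset v
  exact mem_iUnion.2 ⟨w, hw (mem_image_of_mem F hv)⟩

theorem IsMarkov.exists_map_mem_endArc (hF : IsMarkov T F) {p : S} {q : T.E × Bool}
    (hp : p ∈ T.endArc q) : ∃ q', F p ∈ T.endArc q' := by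
  obtain ⟨w, hw⟩ := hF.exists_image_junction_subset (T.endVertex q.1 q.2)
  exact exists_mem_endArc (hF.bdry_subset _ w hw (mem_image_of_mem F (endArc_subset_bdry q hp)))

/-- If one point of a leaf is mapped into a junction, then so is the whole leaf. -/
theorem IsThickGraphMap.map_leaf_mem_junction (hF : IsThickGraphMap T F) {j : T.E} {t y : I}
    (h0 : 0 < t) (h1 : t < 1) {w : T.V} (h : F (T.rect j (t, y)) ∈ T.junction w) (y' : I) :
    F (T.rect j (t, y')) ∈ T.junction w := by
  obtain ⟨γ, hγ, hsub⟩ := hF.element_subset (T.leaf j t) (Or.inr ⟨j, t, h0, h1, rfl⟩)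
  have hy : F (T.rect j (t, y)) ∈ γ := hsub ⟨_, ⟨y, rfl⟩, rfl⟩
  have hy' : F (T.rect j (t, y')) ∈ γ := hsub ⟨_, ⟨y', rfl⟩, rfl⟩
  rcases hγ with ⟨w', rfl⟩ | ⟨e, x, h0', h1', rfl⟩
  · rwa [eq_of_mem_junction h hy]
  · obtain ⟨z, hz⟩ := hy
    rw [← show T.rect e (x, z) = _ from hz] at h
    exact absurd h (T.rect_notMem e x z w h0' h1')

theorem IsThickGraphMap.coreImage_mem (hF : IsThickGraphMap T F) (j : T.E) (t : I) :
    coreImage T F j t ∈ T.junctions ∨ ∃ e, coreImage T F j t ∈ T.strip e :=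
  mem_junctions_or_strip <| interior_subset <| hF.body_subset <| mem_image_of_mem F <|
    Or.inr <| mem_iUnion.2 ⟨j, mem_range_self _⟩

theorem coreImage_fromEnd (j : T.E) (b : Bool) :
    coreImage T F j (fromEnd b 0) = F (T.switch (j, b)) := rfl

theorem IsThickGraphMap.coreImage_fromEnd_mem_junctions (hF : IsThickGraphMap T F) (j : T.E)
    (b : Bool) : coreImage T F j (fromEnd b 0) ∈ T.junctions :=
  hF.map_mem_junctions (endArc_subset_junctions _ (switch_mem_endArc (j, b)))

/-- The image of a core arc does not touch the boundary of a junction from inside, as `F` is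
open. -/
theorem IsThickGraphMap.not_eventually_mem_junctions (hF : IsThickGraphMap T F) {j : T.E} {t : I}
    (h0 : 0 < t) (h1 : t < 1) {q : T.E × Bool} (h : coreImage T F j t ∈ T.endArc q) :
    ¬ ∀ᶠ s in 𝓝 t, coreImage T F j s ∈ T.junctions := by
  intro hev
  have hU := hev.and (Ioo_mem_nhds h0 h1)
  have hnhds := F.isOpenMap.image_mem_nhds
    (image_rect_mem_nhds j h0 h1 half_pos' half_lt_one' hU)
  refine notMem_interior_junctions h (mem_interior_iff_mem_nhds.2 (mem_of_superset hnhds ?_))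
  rintro _ ⟨_, ⟨⟨s, y⟩, ⟨⟨hs, hs0, hs1⟩, -⟩, rfl⟩, rfl⟩
  obtain ⟨w, hw⟩ := mem_iUnion.1 hs
  exact mem_iUnion.2 ⟨w, hF.map_leaf_mem_junction hs0 hs1 hw y⟩

/-- The image of a core arc leaves the junction immediately at its two ends: otherwise `F` would map
a neighbourhood of a switch into the junctions. -/
theorem IsMarkov.not_eventually_mem_junctions_end (hF : IsMarkov T F) (j : T.E) (b : Bool) :
    ¬ ∀ᶠ x in 𝓝[>] 0, coreImage T F j (fromEnd b x) ∈ T.junctions := by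
  intro hev
  obtain ⟨δ, hδ, hsub⟩ := (mem_nhdsGT_iff_exists_Ioo_subset' (zero_lt_one' I)).1
    (hev.and (eventually_lt_nhdsGT (zero_lt_one' I)))
  have hnhds := F.isOpenMap.image_mem_nhds (junction_union_mem_nhds_switch (j, b) hδ)
  obtain ⟨q, hq⟩ := hF.exists_map_mem_endArc (switch_mem_endArc (j, b))
  refine notMem_interior_junctions hq (mem_interior_iff_mem_nhds.2 (mem_of_superset hnhds ?_))
  rintro _ ⟨p, hp | ⟨x, y, h0, h1, rfl⟩, rfl⟩
  · exact hF.map_mem_junctions (mem_iUnion.2 ⟨_, hp⟩)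
  · obtain ⟨h2, h3⟩ := hsub ⟨h0, h1⟩
    obtain ⟨w, hw⟩ := mem_iUnion.1 h2
    obtain ⟨h4, h5⟩ := fromEnd_mem_Ioo (b := b) h0 h3
    exact mem_iUnion.2 ⟨w, hF.map_leaf_mem_junction h4 h5 hw y⟩

instance nhdsNE_unitInterval_neBot (t : I) : (𝓝[≠] t).NeBot := by
  by_cases h : t < 1
  · have := nhdsGT_neBot_of_exists_gt ⟨1, h⟩
    exact NeBot.mono this (nhdsWithin_mono _ fun _ hx => ne_of_gt hx)
  · have h' : 0 < t := (zero_lt_one' I).trans_le (not_lt.1 h)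
    have := nhdsLT_neBot_of_exists_lt ⟨0, h'⟩
    exact NeBot.mono this (nhdsWithin_mono _ fun _ hx => ne_of_lt hx)

/-- The image of the interior of a core arc does not touch a junction in an isolated point: points
of the interior of the junction have preimages on nearby leaves. -/
theorem IsThickGraphMap.not_eventually_notMem_junctions (hF : IsThickGraphMap T F) {j : T.E}
    {t : I} (h0 : 0 < t) (h1 : t < 1) (h : coreImage T F j t ∈ T.junctions) :
    ¬ ∀ᶠ s in 𝓝[≠] t, coreImage T F j s ∉ T.junctions := by
  intro hev
  rw [eventually_nhdsWithin_iff] at hev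
  have hU := hev.and (Ioo_mem_nhds h0 h1)
  obtain ⟨w, hw⟩ := mem_iUnion.1 h
  have hclos := junction_subset_closure_interior w hw
  obtain ⟨_, ⟨_, ⟨⟨t', y⟩, ⟨⟨hne, h0', h1'⟩, -⟩, rfl⟩, rfl⟩, hint⟩ := mem_closure_iff_nhds.1 hclos
    _ (F.isOpenMap.image_mem_nhds (image_rect_mem_nhds j h0 h1 half_pos' half_lt_one' hU))
  have hcore : ∀ s : I, 0 < s → s < 1 → F (T.rect j (s, y)) ∈ T.junction w →
      coreImage T F j s ∈ T.junctions := fun s hs0 hs1 hs =>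
    mem_iUnion.2 ⟨w, hF.map_leaf_mem_junction hs0 hs1 hs half⟩
  obtain rfl : t' = t := by
    by_contra hne'
    exact hne hne' (hcore t' h0' h1' (interior_subset hint))
  have hcont : Continuous fun s : I => F (T.rect j (s, y)) :=
    F.continuous.comp ((T.rect j).continuous.comp (continuous_id.prodMk continuous_const))
  have hO : ∀ᶠ s in 𝓝[≠] t', F (T.rect j (s, y)) ∈ interior (T.junction w) :=
    (hcont.continuousAt.eventually (isOpen_interior.mem_nhds hint)).filter_mono nhdsWithin_le_nhds
  obtain ⟨s, ⟨hs1, hs2⟩, hs3⟩ := ((hO.and (hU.filter_mono nhdsWithin_le_nhds)).and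
    (eventually_mem_nhdsWithin (s := {t'}ᶜ))).exists
  exact hs2.1 hs3 (hcore s hs2.2.1 hs2.2.2 (interior_subset hs1))

end Maps

/-! ### Crossings of strips by images of core arcs -/

section Crossings

variable {S : Type*} [MetricSpace S] [ChartedSpace ℂ S] {T : FiniteThickGraph S} {F : S ≃ₜ S}

open FiniteThickGraph

/-- On the interval `(c, d)` the image of the core arc of the strip `j` runs through the strip `e`,
from one junction to another. -/
structure IsCrossing (T : FiniteThickGraph S) (F : S ≃ₜ S) (j e : T.E) (c d : I) : Prop where
  lt : c < d
  mem_strip : ∀ t ∈ Ioo c d, coreImage T F j t ∈ T.strip e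
  left : coreImage T F j c ∈ T.junctions
  right : coreImage T F j d ∈ T.junctions

theorem IsThickGraphMap.isOpen_coreImage_mem_strip (hF : IsThickGraphMap T F) (j e : T.E) :
    IsOpen {t | coreImage T F j t ∈ T.strip e} := by
  have h : {t | coreImage T F j t ∈ T.strip e} =
      (coreImage T F j ⁻¹' (T.junctions ∪ ⋃ e' ∈ ({e}ᶜ : Set T.E), range (T.rect e')))ᶜ := by
    ext t
    simp only [mem_ofPred_eq, mem_compl_iff, mem_preimage, mem_union, mem_iUnion, mem_singleton_iff,
      not_or, not_exists]
    constructor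
    · intro ht
      refine ⟨notMem_junctions_of_mem_strip ht, fun e' he' ⟨p, hp⟩ => ?_⟩
      obtain ⟨p', hp'⟩ := strip_subset_range e ht
      exact he' (rect_eq_iff.1 (hp.trans hp'.symm)).1
    · rintro ⟨h1, h2⟩
      obtain h3 | ⟨e', he'⟩ := hF.coreImage_mem j t
      · exact absurd h3 h1
      · by_cases hee : e' = e
        · rwa [← hee]
        · exact absurd (strip_subset_range e' he') (h2 e' hee)
  rw [h]
  refine (IsClosed.preimage (continuous_coreImage j) ?_).isOpen_compl
  exact isClosed_junctions.union
    ((toFinite _).isClosed_biUnion fun e' _ => isClosed_range_rect e')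

theorem isClosed_coreImage_mem_junctions (j : T.E) :
    IsClosed {t | coreImage T F j t ∈ T.junctions} :=
  isClosed_junctions.preimage (continuous_coreImage j)

/-- A limit of points of a strip that are images of points of a core arc, if it is not itself in the
strip, lies on an end of the strip. -/
theorem mem_endArc_of_eventually {j e : T.E} {t : I} {l : Filter I} [l.NeBot] (hl : l ≤ 𝓝 t)
    (h : ∀ᶠ s in l, coreImage T F j s ∈ T.strip e) (ht : coreImage T F j t ∉ T.strip e) :
    ∃ b, coreImage T F j t ∈ T.endArc (e, b) := by
  have hmem : coreImage T F j t ∈ range (T.rect e) :=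
    (isClosed_range_rect e).mem_of_tendsto ((continuous_coreImage j).continuousAt.mono_left hl)
      (h.mono fun s hs => strip_subset_range e hs)
  exact (mem_strip_or_endArc hmem).resolve_left ht

theorem IsCrossing.nhdsGT_neBot {j e : T.E} {c d : I} (h : IsCrossing T F j e c d) :
    (𝓝[>] c).NeBot := nhdsGT_neBot_of_exists_gt ⟨d, h.lt⟩

theorem IsCrossing.nhdsLT_neBot {j e : T.E} {c d : I} (h : IsCrossing T F j e c d) :
    (𝓝[<] d).NeBot := nhdsLT_neBot_of_exists_lt ⟨c, h.lt⟩

theorem IsCrossing.eventually_mem_nhdsGT {j e : T.E} {c d : I} (h : IsCrossing T F j e c d) :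
    ∀ᶠ t in 𝓝[>] c, t ∈ Ioo c d := Ioo_mem_nhdsGT h.lt

theorem IsCrossing.eventually_mem_nhdsLT {j e : T.E} {c d : I} (h : IsCrossing T F j e c d) :
    ∀ᶠ t in 𝓝[<] d, t ∈ Ioo c d := Ioo_mem_nhdsLT h.lt

theorem IsCrossing.left_mem_endArc {j e : T.E} {c d : I} (h : IsCrossing T F j e c d) :
    ∃ b, coreImage T F j c ∈ T.endArc (e, b) :=
  have := h.nhdsGT_neBot
  mem_endArc_of_eventually nhdsWithin_le_nhds (h.eventually_mem_nhdsGT.mono h.mem_strip)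
    fun h' => notMem_junctions_of_mem_strip h' h.left

theorem IsCrossing.right_mem_endArc {j e : T.E} {c d : I} (h : IsCrossing T F j e c d) :
    ∃ b, coreImage T F j d ∈ T.endArc (e, b) :=
  have := h.nhdsLT_neBot
  mem_endArc_of_eventually nhdsWithin_le_nhds (h.eventually_mem_nhdsLT.mono h.mem_strip)
    fun h' => notMem_junctions_of_mem_strip h' h.right

/-- Every point of a core arc that is mapped into a strip lies in a crossing, as the two endpoints of
the core arc are mapped into junctions. -/
theorem IsThickGraphMap.exists_isCrossing (hF : IsThickGraphMap T F) {j e : T.E} {t : I}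
    (ht : coreImage T F j t ∈ T.strip e) : ∃ c d, IsCrossing T F j e c d ∧ t ∈ Ioo c d := by
  set U := {t | coreImage T F j t ∈ T.strip e} with hU
  have hUc : IsClosed Uᶜ := (hF.isOpen_coreImage_mem_strip j e).isClosed_compl
  have h0 : (0 : I) ∈ Uᶜ := fun h =>
    notMem_junctions_of_mem_strip h (hF.coreImage_fromEnd_mem_junctions j false)
  have h1 : (1 : I) ∈ Uᶜ := fun h => notMem_junctions_of_mem_strip h
    (by simpa [fromEnd] using hF.coreImage_fromEnd_mem_junctions j true)
  obtain ⟨c, ⟨hcU, hct⟩, hc⟩ := (hUc.inter isClosed_Iic).isCompact.exists_isGreatest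
    ⟨0, h0, (t.2.1 : 0 ≤ t)⟩
  obtain ⟨d, ⟨hdU, htd⟩, hd⟩ := (hUc.inter isClosed_Ici).isCompact.exists_isLeast
    ⟨1, h1, (t.2.2 : t ≤ 1)⟩
  have hct' : c < t := lt_of_le_of_ne hct (by rintro rfl; exact hcU ht)
  have htd' : t < d := lt_of_le_of_ne htd (by rintro rfl; exact hdU ht)
  have hsub : ∀ s ∈ Ioo c d, coreImage T F j s ∈ T.strip e := by
    intro s hs
    by_contra hsU
    rcases le_total s t with h | h
    · exact (hc ⟨hsU, h⟩).not_gt hs.1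
    · exact (hd ⟨hsU, h⟩).not_gt hs.2
  have hlt := hct'.trans htd'
  have := nhdsGT_neBot_of_exists_gt ⟨d, hlt⟩
  have := nhdsLT_neBot_of_exists_lt ⟨c, hlt⟩
  obtain ⟨b, hb⟩ := mem_endArc_of_eventually (l := 𝓝[>] c) nhdsWithin_le_nhds
    (Eventually.mono (Ioo_mem_nhdsGT hlt) hsub) hcU
  obtain ⟨b', hb'⟩ := mem_endArc_of_eventually (l := 𝓝[<] d) nhdsWithin_le_nhds
    (Eventually.mono (Ioo_mem_nhdsLT hlt) hsub) hdU
  exact ⟨c, d, ⟨hlt, hsub, endArc_subset_junctions _ hb, endArc_subset_junctions _ hb'⟩,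
    hct', htd'⟩

theorem IsCrossing.connectedComponentIn_eq {j e : T.E} {c d t : I} (h : IsCrossing T F j e c d)
    (ht : t ∈ Ioo c d) :
    connectedComponentIn {t | coreImage T F j t ∈ T.strip e} t = Ioo c d := by
  refine Subset.antisymm (fun s hs => ?_)
    (isPreconnected_Ioo.subset_connectedComponentIn ht h.mem_strip)
  have hconn : OrdConnected (connectedComponentIn {t | coreImage T F j t ∈ T.strip e} t) :=
    isPreconnected_connectedComponentIn.ordConnected
  have htt : t ∈ connectedComponentIn {t | coreImage T F j t ∈ T.strip e} t :=
    mem_connectedComponentIn (h.mem_strip t ht)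
  have hsub : ∀ s ∈ connectedComponentIn {t | coreImage T F j t ∈ T.strip e} t,
      coreImage T F j s ∈ T.strip e := fun s hs =>
    (connectedComponentIn_subset {t | coreImage T F j t ∈ T.strip e} t) hs
  constructor
  · by_contra hle
    exact notMem_junctions_of_mem_strip (hsub c
      (hconn.out hs htt ⟨not_lt.1 hle, ht.1.le⟩)) h.left
  · by_contra hle
    exact notMem_junctions_of_mem_strip (hsub d
      (hconn.out htt hs ⟨ht.2.le, not_lt.1 hle⟩)) h.right

/-- In the coordinates of the strips `F` is affine, so the image of a core arc crosses a strip from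
one end to the other, and all crossings of the same strip take the same time. -/
theorem IsMarkov.exists_crossing_length (hF : IsMarkov T F) (j e : T.E) :
    ∃ ℓ : ℝ, 0 < ℓ ∧ ∀ c d, IsCrossing T F j e c d → (d : ℝ) - c = ℓ ∧
      ∃ b, coreImage T F j c ∈ T.endArc (e, b) ∧ coreImage T F j d ∈ T.endArc (e, !b) := by
  obtain ⟨lam, mu, hlin⟩ := hF.linear
  obtain ⟨hlam, -, -, hlin⟩ := hlin j e
  have hlam0 : 0 < lam j e := one_pos.trans_le hlam
  refine ⟨(lam j e)⁻¹, inv_pos.2 hlam0, fun c d h => ?_⟩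
  obtain ⟨t₀, ht₀⟩ := nonempty_Ioo.2 h.lt
  have hsub : (fun t : I => T.rect j (t, half)) '' Ioo c d ⊆ T.strip j ∩ F ⁻¹' T.strip e := by
    rintro _ ⟨t, ht, rfl⟩
    exact ⟨⟨t, half, (c.2.1 : 0 ≤ c).trans_lt ht.1, ht.2.trans_le (d.2.2 : d ≤ 1), rfl⟩,
      h.mem_strip t ht⟩
  obtain ⟨a, b, ε, ε', hε, -, haff⟩ := hlin _ (hsub (mem_image_of_mem _ ht₀))
  have hcomp : (fun t : I => T.rect j (t, half)) '' Ioo c d ⊆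
      connectedComponentIn (T.strip j ∩ F ⁻¹' T.strip e) (T.rect j (t₀, half)) := by
    refine IsPreconnected.subset_connectedComponentIn ?_ (mem_image_of_mem _ ht₀) hsub
    refine isPreconnected_Ioo.image _ (Continuous.continuousOn ?_)
    exact (T.rect j).continuous.comp (continuous_id.prodMk continuous_const)
  have hex : ∀ t, ∃ p : I × I, t ∈ Ioo c d →
      T.rect e p = coreImage T F j t ∧ (p.1 : ℝ) = a + ε * lam j e * t := by
    intro t
    by_cases ht : t ∈ Ioo c d
    · obtain ⟨x, y, -, -, hxy⟩ := h.mem_strip t ht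
      exact ⟨(x, y), fun _ => ⟨hxy.symm,
        (haff t half x y (hcomp (mem_image_of_mem _ ht)) hxy).1⟩⟩
    · exact ⟨(0, 0), fun h => absurd h ht⟩
  choose p hp using hex
  -- the affine formula for the horizontal coordinate extends to the endpoints of the crossing
  have hlim : ∀ (s : I) (l : Filter I) [l.NeBot], l ≤ 𝓝 s → Ioo c d ∈ l → ∀ z : I × I,
      coreImage T F j s = T.rect e z → (z.1 : ℝ) = a + ε * lam j e * s := by
    intro s l _ hl hIoo z hz
    have h1 : Tendsto (T.rect e ∘ p) l (𝓝 (T.rect e z)) := by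
      rw [← hz]
      refine Tendsto.congr' ?_ ((continuous_coreImage j).continuousAt.mono_left hl)
      filter_upwards [hIoo] with t ht
      exact (hp t ht).1.symm
    have h2 : Tendsto p l (𝓝 z) := (isEmbedding_rect e).tendsto_nhds_iff.2 h1
    have h3 : Tendsto (fun t => ((p t).1 : ℝ)) l (𝓝 (z.1 : ℝ)) :=
      (continuous_subtype_val.comp continuous_fst).continuousAt.tendsto.comp h2
    have h4 : Tendsto (fun t : I => a + ε * lam j e * t) l (𝓝 (a + ε * lam j e * s)) := by
      have : Continuous fun t : I => a + ε * lam j e * t := by fun_prop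
      exact this.continuousAt.mono_left hl
    refine tendsto_nhds_unique h3 (h4.congr' ?_)
    filter_upwards [hIoo] with t ht
    exact (hp t ht).2.symm
  obtain ⟨b, y, hy⟩ := h.left_mem_endArc
  obtain ⟨b', y', hy'⟩ := h.right_mem_endArc
  have := h.nhdsGT_neBot
  have := h.nhdsLT_neBot
  have hc := hlim c (𝓝[>] c) nhdsWithin_le_nhds (Ioo_mem_nhdsGT h.lt) _ hy.symm
  have hd := hlim d (𝓝[<] d) nhdsWithin_le_nhds (Ioo_mem_nhdsLT h.lt) _ hy'.symm
  have hcd : (0 : ℝ) < d - c := sub_pos.2 h.lt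
  have hdiff : |((fromEnd b' 0 : I) : ℝ) - (fromEnd b 0 : I)| = lam j e * (d - c) := by
    simp only at hc hd
    rw [hc, hd, show a + ε * lam j e * (d : ℝ) - (a + ε * lam j e * c) =
      ε * (lam j e * (d - c)) by ring, abs_mul, hε, one_mul, abs_of_pos (mul_pos hlam0 hcd)]
  have hpos : 0 < lam j e * (d - c) := mul_pos hlam0 hcd
  have hbb : b' = !b ∧ lam j e * ((d : ℝ) - c) = 1 := by
    cases b <;> cases b' <;> simp [fromEnd, hlam0.ne', hcd.ne'] at hdiff ⊢ <;> linarith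
  refine ⟨?_, b, ⟨y, hy⟩, y', by rw [← hbb.1]; exact hy'⟩
  rw [← mul_right_inj' hlam0.ne', hbb.2, mul_inv_cancel₀ hlam0.ne']

theorem IsCrossing.le_of_lt {j e e' : T.E} {c d c' d' : I} (h : IsCrossing T F j e c d)
    (h' : IsCrossing T F j e' c' d') (hlt : c < c') : d ≤ c' := by
  by_contra hle
  exact notMem_junctions_of_mem_strip (h.mem_strip c' ⟨hlt, not_le.1 hle⟩) h'.left

theorem IsCrossing.right_unique {j e e' : T.E} {c d d' : I} (h : IsCrossing T F j e c d)
    (h' : IsCrossing T F j e' c d') : d = d' := by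
  rcases lt_trichotomy d d' with hlt | rfl | hlt
  · exact absurd h.right (notMem_junctions_of_mem_strip (h'.mem_strip d ⟨h.lt, hlt⟩))
  · rfl
  · exact absurd h'.right (notMem_junctions_of_mem_strip (h.mem_strip d' ⟨h'.lt, hlt⟩))

theorem IsCrossing.left_unique {j e e' : T.E} {c c' d : I} (h : IsCrossing T F j e c d)
    (h' : IsCrossing T F j e' c' d) : c = c' := by
  rcases lt_trichotomy c c' with hlt | rfl | hlt
  · exact absurd h'.left (notMem_junctions_of_mem_strip (h.mem_strip c' ⟨hlt, h'.lt⟩))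
  · rfl
  · exact absurd h.left (notMem_junctions_of_mem_strip (h'.mem_strip c ⟨hlt, h.lt⟩))

/-- Crossings of the same strip are disjoint intervals of the same length, so there are finitely
many. -/
theorem IsMarkov.finite_crossings (hF : IsMarkov T F) (j e : T.E) :
    {x : I × I | IsCrossing T F j e x.1 x.2}.Finite := by
  obtain ⟨ℓ, hℓ, hcr⟩ := hF.exists_crossing_length j e
  refine Finite.of_injOn (f := fun x : I × I => ⌊(x.1 : ℝ) / ℓ⌋) (t := Icc 0 ⌊1 / ℓ⌋) ?_ ?_
    (finite_Icc _ _)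
  · rintro ⟨c, d⟩ -
    refine ⟨Int.floor_nonneg.2 (div_nonneg c.2.1 hℓ.le), Int.floor_le_floor ?_⟩
    gcongr
    exact c.2.2
  · have hlt : ∀ c d c' d', IsCrossing T F j e c d → IsCrossing T F j e c' d' → c < c' →
        ⌊(c : ℝ) / ℓ⌋ < ⌊(c' : ℝ) / ℓ⌋ := by
      intro c d c' d' h h' hcc
      have h1 : (d : ℝ) ≤ c' := h.le_of_lt h' hcc
      have h2 := (hcr c d h).1
      have h3 : (c : ℝ) / ℓ + 1 ≤ c' / ℓ := by
        rw [div_add_one hℓ.ne']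
        gcongr
        linarith
      have h4 := Int.floor_le_floor h3
      rw [Int.floor_add_one] at h4
      omega
    rintro ⟨c, d⟩ h ⟨c', d'⟩ h' heq
    obtain rfl : c = c' := by
      rcases lt_trichotomy c c' with hcc | hcc | hcc
      · exact absurd heq (hlt c d c' d' h h' hcc).ne
      · exact hcc
      · exact absurd heq (hlt c' d' c d h' h hcc).ne'
    exact Prod.ext rfl (IsCrossing.right_unique h h')

theorem IsMarkov.finite_all_crossings (hF : IsMarkov T F) (j : T.E) :
    {x : T.E × I × I | IsCrossing T F j x.1 x.2.1 x.2.2}.Finite := by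
  have h : {x : T.E × I × I | IsCrossing T F j x.1 x.2.1 x.2.2} =
      ⋃ e, Prod.mk e '' {x : I × I | IsCrossing T F j e x.1 x.2} := by
    ext ⟨e, x⟩
    simp
  rw [h]
  exact finite_iUnion fun e => (hF.finite_crossings j e).image _

/-- To the right of a point that is mapped into a junction, the image of a core arc stays in the
junctions or begins to cross a strip. -/
theorem IsMarkov.right_dichotomy (hF : IsMarkov T F) {j : T.E} {t : I}
    (ht : coreImage T F j t ∈ T.junctions) :
    (∀ᶠ s in 𝓝[>] t, coreImage T F j s ∈ T.junctions) ∨ ∃ e d, IsCrossing T F j e t d := by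
  by_cases hex : ∃ e d, IsCrossing T F j e t d
  · exact Or.inr hex
  left
  have hev : ∀ x ∈ {x : T.E × I × I | IsCrossing T F j x.1 x.2.1 x.2.2},
      ∀ᶠ s in 𝓝[>] t, s ∉ Ioo x.2.1 x.2.2 := by
    rintro ⟨e, c, d⟩ hx
    replace hx : IsCrossing T F j e c d := hx
    rcases lt_trichotomy t c with hlt | rfl | hlt
    · filter_upwards [eventually_lt_nhdsGT hlt] with s hs hs'
      exact hs.not_gt hs'.1
    · exact absurd ⟨e, d, hx⟩ hex
    · have hdt : d ≤ t := not_lt.1 fun h =>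
        notMem_junctions_of_mem_strip (hx.mem_strip t ⟨hlt, h⟩) ht
      filter_upwards [eventually_mem_nhdsWithin] with s hs hs'
      exact (hs'.2.trans_le hdt).not_gt hs
  filter_upwards [(hF.finite_all_crossings j).eventually_all.2 hev] with s hs
  refine (hF.coreImage_mem j s).resolve_right fun ⟨e, he⟩ => ?_
  obtain ⟨c, d, hcd, hsc⟩ := hF.exists_isCrossing he
  exact hs (e, c, d) hcd hsc

/-- To the left of a point that is mapped into a junction, the image of a core arc is in the
junctions or finishes to cross a strip. -/
theorem IsMarkov.left_dichotomy (hF : IsMarkov T F) {j : T.E} {t : I}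
    (ht : coreImage T F j t ∈ T.junctions) :
    (∀ᶠ s in 𝓝[<] t, coreImage T F j s ∈ T.junctions) ∨ ∃ e c, IsCrossing T F j e c t := by
  by_cases hex : ∃ e c, IsCrossing T F j e c t
  · exact Or.inr hex
  left
  have hev : ∀ x ∈ {x : T.E × I × I | IsCrossing T F j x.1 x.2.1 x.2.2},
      ∀ᶠ s in 𝓝[<] t, s ∉ Ioo x.2.1 x.2.2 := by
    rintro ⟨e, c, d⟩ hx
    replace hx : IsCrossing T F j e c d := hx
    rcases lt_trichotomy d t with hlt | rfl | hlt
    · filter_upwards [(eventually_gt_nhds hlt).filter_mono nhdsWithin_le_nhds] with s hs hs'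
      exact hs.not_gt hs'.2
    · exact absurd ⟨e, c, hx⟩ hex
    · have hdt : t ≤ c := not_lt.1 fun h =>
        notMem_junctions_of_mem_strip (hx.mem_strip t ⟨h, hlt⟩) ht
      filter_upwards [eventually_mem_nhdsWithin] with s hs hs'
      exact (hdt.trans_lt hs'.1).not_gt hs
  filter_upwards [(hF.finite_all_crossings j).eventually_all.2 hev] with s hs
  refine (hF.coreImage_mem j s).resolve_right fun ⟨e, he⟩ => ?_
  obtain ⟨c, d, hcd, hsc⟩ := hF.exists_isCrossing he
  exact hs (e, c, d) hcd hsc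

/-- The image of a core arc does not pass directly from one crossing to another: between them it
spends a nondegenerate interval of time in a junction. -/
theorem IsMarkov.not_both_crossing (hF : IsMarkov T F) {j e e' : T.E} {c t d : I}
    (h : IsCrossing T F j e c t) (h' : IsCrossing T F j e' t d) : False := by
  refine hF.not_eventually_notMem_junctions ((c.2.1 : 0 ≤ c).trans_lt h.lt)
    (h'.lt.trans_le (d.2.2 : d ≤ 1)) h.right ?_
  rw [← nhdsLT_sup_nhdsGT, eventually_sup]
  exact ⟨h.eventually_mem_nhdsLT.mono fun s hs => notMem_junctions_of_mem_strip (h.mem_strip s hs),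
    h'.eventually_mem_nhdsGT.mono fun s hs => notMem_junctions_of_mem_strip (h'.mem_strip s hs)⟩

theorem IsMarkov.exists_crossing_zero (hF : IsMarkov T F) (j : T.E) :
    ∃ e d, IsCrossing T F j e 0 d :=
  (hF.right_dichotomy (hF.coreImage_fromEnd_mem_junctions j false)).resolve_left
    (hF.not_eventually_mem_junctions_end j false)

theorem IsMarkov.exists_crossing_one (hF : IsMarkov T F) (j : T.E) :
    ∃ e c, IsCrossing T F j e c 1 := by
  have h1 : fromEnd true 0 = (1 : I) := by simp [fromEnd]
  refine (hF.left_dichotomy (t := 1) ?_).resolve_left fun hev => ?_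
  · rw [← h1]; exact hF.coreImage_fromEnd_mem_junctions j true
  · refine hF.not_eventually_mem_junctions_end j true ?_
    have hσ : Tendsto (fromEnd true) (𝓝[>] 0) (𝓝[<] (1 : I)) := by
      refine tendsto_nhdsWithin_iff.2 ⟨?_, ?_⟩
      · have := ((continuous_fromEnd true).tendsto 0).mono_left
          (nhdsWithin_le_nhds (s := Ioi (0 : I)))
        rwa [h1] at this
      · filter_upwards [eventually_mem_nhdsWithin, eventually_lt_nhdsGT (zero_lt_one' I)]
          with x hx hx'
        exact (fromEnd_mem_Ioo hx hx').2
    exact hσ.eventually hev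

end Crossings

/-! ### Ends of crossings and ends of pushed edges -/

section Counting

variable {S : Type*} [MetricSpace S] [ChartedSpace ℂ S] {T : FiniteThickGraph S} {F : S ≃ₜ S}

open FiniteThickGraph

/-- The interval `[a, b]` is a nondegenerate component of the part of the core arc of the strip `j`
that `F` maps into the junctions. -/
structure IsPushed (T : FiniteThickGraph S) (F : S ≃ₜ S) (j : T.E) (a b : I) : Prop where
  lt : a < b
  comp : connectedComponentIn {t | coreImage T F j t ∈ T.junctions} a = Icc a b

theorem IsPushed.mem_junctions {j : T.E} {a b t : I} (h : IsPushed T F j a b) (ht : t ∈ Icc a b) :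
    coreImage T F j t ∈ T.junctions := by
  rw [← h.comp] at ht
  exact (connectedComponentIn_subset {t | coreImage T F j t ∈ T.junctions} a) ht

theorem IsPushed.comp_eq {j : T.E} {a b t : I} (h : IsPushed T F j a b) (ht : t ∈ Icc a b) :
    connectedComponentIn {t | coreImage T F j t ∈ T.junctions} t = Icc a b := by
  rw [← h.comp]
  rw [← h.comp] at ht
  exact (connectedComponentIn_eq ht).symm

/-- An interval that is mapped into the junctions and meets a component `[a, b]` is contained in
it. -/
theorem IsPushed.mem_Icc_of_subset {j : T.E} {a b s t u : I} (h : IsPushed T F j a b)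
    (ht : t ∈ Icc a b) (hsub : ∀ r ∈ uIcc s t, coreImage T F j r ∈ T.junctions) (hu : u ∈ uIcc s t) :
    u ∈ Icc a b := by
  rw [← h.comp_eq ht]
  exact isPreconnected_uIcc.subset_connectedComponentIn right_mem_uIcc hsub hu

theorem IsPushed.right_unique {j : T.E} {a b b' : I} (h : IsPushed T F j a b)
    (h' : IsPushed T F j a b') : b = b' := by
  have := h.comp.symm.trans h'.comp
  exact ((Icc_eq_Icc_iff h.lt.le).1 this).2

theorem IsPushed.left_unique {j : T.E} {a a' b : I} (h : IsPushed T F j a b)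
    (h' : IsPushed T F j a' b) : a = a' := by
  have := (h.comp_eq (right_mem_Icc.2 h.lt.le)).symm.trans (h'.comp_eq (right_mem_Icc.2 h'.lt.le))
  exact ((Icc_eq_Icc_iff h.lt.le).1 this).1

theorem IsMarkov.exists_crossing_left (hF : IsMarkov T F) {j : T.E} {a b : I}
    (h : IsPushed T F j a b) : ∃ e c, IsCrossing T F j e c a := by
  have ha : a ∈ Icc a b := left_mem_Icc.2 h.lt.le
  have h0 : 0 < a := by
    by_contra h0
    obtain rfl : a = 0 := le_antisymm (not_lt.1 h0) a.2.1
    obtain ⟨e, d, hd⟩ := hF.exists_crossing_zero j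
    obtain ⟨s, hs0, hs1⟩ := exists_between (lt_min hd.lt h.lt)
    exact notMem_junctions_of_mem_strip (hd.mem_strip s ⟨hs0, hs1.trans_le (min_le_left _ _)⟩)
      (h.mem_junctions ⟨hs0.le, hs1.le.trans (min_le_right _ _)⟩)
  refine (hF.left_dichotomy (h.mem_junctions ha)).resolve_left fun hev => ?_
  obtain ⟨l, hl, hsub⟩ := (mem_nhdsLT_iff_exists_Ioo_subset' h0).1 hev
  obtain ⟨s, hs0, hs1⟩ := exists_between (mem_Iio.1 hl)
  have hs : s ∈ Icc a b := by
    refine h.mem_Icc_of_subset (s := s) ha (fun r hr => ?_) left_mem_uIcc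
    rw [uIcc_of_le hs1.le] at hr
    rcases hr.2.lt_or_eq with hra | rfl
    · exact hsub ⟨hs0.trans_le hr.1, hra⟩
    · exact h.mem_junctions ha
  exact hs.1.not_gt hs1

theorem IsMarkov.exists_crossing_right (hF : IsMarkov T F) {j : T.E} {a b : I}
    (h : IsPushed T F j a b) : ∃ e d, IsCrossing T F j e b d := by
  have hb : b ∈ Icc a b := right_mem_Icc.2 h.lt.le
  have h1 : b < 1 := by
    by_contra h1
    obtain rfl : b = 1 := le_antisymm b.2.2 (not_lt.1 h1)
    obtain ⟨e, c, hc⟩ := hF.exists_crossing_one j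
    obtain ⟨s, hs0, hs1⟩ := exists_between (max_lt hc.lt h.lt)
    exact notMem_junctions_of_mem_strip (hc.mem_strip s ⟨(le_max_left _ _).trans_lt hs0, hs1⟩)
      (h.mem_junctions ⟨(le_max_right _ _).trans hs0.le, hs1.le⟩)
  refine (hF.right_dichotomy (h.mem_junctions hb)).resolve_left fun hev => ?_
  obtain ⟨u, hu, hsub⟩ := (mem_nhdsGT_iff_exists_Ioo_subset' h1).1 hev
  obtain ⟨s, hs0, hs1⟩ := exists_between (mem_Ioi.1 hu)
  have hs : s ∈ Icc a b := by
    refine h.mem_Icc_of_subset (s := s) hb (fun r hr => ?_) left_mem_uIcc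
    rw [uIcc_of_ge hs0.le] at hr
    rcases hr.1.lt_or_eq with hra | rfl
    · exact hsub ⟨hra, hr.2.trans_lt hs1⟩
    · exact h.mem_junctions hb
  exact hs.2.not_gt hs0

theorem isCompact_connectedComponentIn_junctions (j : T.E) (t : I) :
    IsCompact (connectedComponentIn {t | coreImage T F j t ∈ T.junctions} t) := by
  by_cases ht : t ∈ {t | coreImage T F j t ∈ T.junctions}
  · refine (isClosed_of_closure_subset ?_).isCompact
    exact isPreconnected_connectedComponentIn.closure.subset_connectedComponentIn
      (subset_closure (mem_connectedComponentIn ht))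
      (closure_minimal (connectedComponentIn_subset _ _) (isClosed_coreImage_mem_junctions j))
  · rw [connectedComponentIn_eq_empty ht]
    exact isCompact_empty

theorem IsMarkov.exists_isPushed_right (hF : IsMarkov T F) {j e : T.E} {c t : I}
    (h : IsCrossing T F j e c t) (h1 : t < 1) : ∃ b, IsPushed T F j t b := by
  set Z := {t | coreImage T F j t ∈ T.junctions} with hZ
  have htK : t ∈ connectedComponentIn Z t := mem_connectedComponentIn h.right
  have hsubZ : ∀ s ∈ connectedComponentIn Z t, coreImage T F j s ∈ T.junctions := fun s hs =>
    (connectedComponentIn_subset Z t) hs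
  have hord : OrdConnected (connectedComponentIn Z t) :=
    isPreconnected_connectedComponentIn.ordConnected
  obtain ⟨b, hbK, hb⟩ := (isCompact_connectedComponentIn_junctions j t).exists_isGreatest
    ⟨t, htK⟩
  have hev := (hF.right_dichotomy h.right).resolve_right
    fun ⟨e', d, hd⟩ => hF.not_both_crossing h hd
  obtain ⟨u, hu, hsub⟩ := (mem_nhdsGT_iff_exists_Ioo_subset' h1).1 hev
  obtain ⟨s, hs0, hs1⟩ := exists_between (mem_Ioi.1 hu)
  have hsK : s ∈ connectedComponentIn Z t := by
    refine isPreconnected_Icc.subset_connectedComponentIn (left_mem_Icc.2 hs0.le) (fun r hr => ?_)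
      (right_mem_Icc.2 hs0.le)
    rcases hr.1.lt_or_eq with hra | rfl
    · exact hsub ⟨hra, hr.2.trans_lt hs1⟩
    · exact h.right
  refine ⟨b, hs0.trans_le (hb hsK), Subset.antisymm (fun r hr => ⟨?_, hb hr⟩) (hord.out htK hbK)⟩
  by_contra hlt
  rw [not_le] at hlt
  obtain ⟨x, hx0, hx1⟩ := exists_between (max_lt h.lt hlt)
  exact notMem_junctions_of_mem_strip (h.mem_strip x ⟨(le_max_left _ _).trans_lt hx0, hx1⟩)
    (hsubZ x (hord.out hr htK ⟨(le_max_right _ _).trans hx0.le, hx1.le⟩))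

theorem IsMarkov.exists_isPushed_left (hF : IsMarkov T F) {j e : T.E} {t d : I}
    (h : IsCrossing T F j e t d) (h0 : 0 < t) : ∃ a, IsPushed T F j a t := by
  set Z := {t | coreImage T F j t ∈ T.junctions} with hZ
  have htK : t ∈ connectedComponentIn Z t := mem_connectedComponentIn h.left
  have hsubZ : ∀ s ∈ connectedComponentIn Z t, coreImage T F j s ∈ T.junctions := fun s hs =>
    (connectedComponentIn_subset Z t) hs
  have hord : OrdConnected (connectedComponentIn Z t) :=
    isPreconnected_connectedComponentIn.ordConnected
  obtain ⟨a, haK, ha⟩ := (isCompact_connectedComponentIn_junctions j t).exists_isLeast ⟨t, htK⟩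
  have hev := (hF.left_dichotomy h.left).resolve_right
    fun ⟨e', c, hc⟩ => hF.not_both_crossing hc h
  obtain ⟨l, hl, hsub⟩ := (mem_nhdsLT_iff_exists_Ioo_subset' h0).1 hev
  obtain ⟨s, hs0, hs1⟩ := exists_between (mem_Iio.1 hl)
  have hsK : s ∈ connectedComponentIn Z t := by
    refine isPreconnected_Icc.subset_connectedComponentIn (right_mem_Icc.2 hs1.le) (fun r hr => ?_)
      (left_mem_Icc.2 hs1.le)
    rcases hr.2.lt_or_eq with hra | rfl
    · exact hsub ⟨hs0.trans_le hr.1, hra⟩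
    · exact h.left
  refine ⟨a, (ha hsK).trans_lt hs1, ?_⟩
  rw [← connectedComponentIn_eq haK]
  refine Subset.antisymm (fun r hr => ⟨ha hr, ?_⟩) (hord.out haK htK)
  by_contra hlt
  rw [not_le] at hlt
  obtain ⟨x, hx0, hx1⟩ := exists_between (lt_min h.lt hlt)
  exact notMem_junctions_of_mem_strip (h.mem_strip x ⟨hx0, hx1.trans_le (min_le_left _ _)⟩)
    (hsubZ x (hord.out htK hr ⟨hx0.le, hx1.le.trans (min_le_right _ _)⟩))

/-- Every time at which the image of a core arc is at an end of a strip is an endpoint of a crossing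
of this strip. -/
theorem IsMarkov.exists_crossing_of_mem_endArc (hF : IsMarkov T F) {j e : T.E} {b : Bool} {t : I}
    (h : coreImage T F j t ∈ T.endArc (e, b)) :
    (∃ c, IsCrossing T F j e c t) ∨ ∃ d, IsCrossing T F j e t d := by
  have hl : (∃ e' c, IsCrossing T F j e' c t) → ∃ c, IsCrossing T F j e c t := by
    rintro ⟨e', c, hc⟩
    obtain ⟨b', hb'⟩ := hc.right_mem_endArc
    obtain rfl : e = e' := (Prod.ext_iff.1 (endArc_eq h hb')).1
    exact ⟨c, hc⟩
  have hr : (∃ e' d, IsCrossing T F j e' t d) → ∃ d, IsCrossing T F j e t d := by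
    rintro ⟨e', d, hd⟩
    obtain ⟨b', hb'⟩ := hd.left_mem_endArc
    obtain rfl : e = e' := (Prod.ext_iff.1 (endArc_eq h hb')).1
    exact ⟨d, hd⟩
  by_cases h0 : 0 < t
  · by_cases h1 : t < 1
    · have hJ := endArc_subset_junctions _ h
      rcases hF.left_dichotomy hJ with hevl | hex
      · rcases hF.right_dichotomy hJ with hevr | hex
        · refine absurd ?_ (hF.not_eventually_mem_junctions h0 h1 h)
          rw [← nhdsNE_sup_pure, ← nhdsLT_sup_nhdsGT]
          exact eventually_sup.2 ⟨eventually_sup.2 ⟨hevl, hevr⟩, hJ⟩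
        · exact Or.inr (hr hex)
      · exact Or.inl (hl hex)
    · obtain rfl : t = 1 := le_antisymm t.2.2 (not_lt.1 h1)
      exact Or.inl (hl (hF.exists_crossing_one j))
  · obtain rfl : t = 0 := le_antisymm (not_lt.1 h0) t.2.1
    exact Or.inr (hr (hF.exists_crossing_zero j))

open Classical in
/-- Crossings of a strip correspond to the times at which the image of the core arc is at a given end
of the strip. -/
theorem IsMarkov.bijOn_crossings (hF : IsMarkov T F) (j e : T.E) (b : Bool) :
    BijOn (fun x : I × I => if coreImage T F j x.1 ∈ T.endArc (e, b) then x.1 else x.2)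
      {x | IsCrossing T F j e x.1 x.2} {t | coreImage T F j t ∈ T.endArc (e, b)} := by
  obtain ⟨ℓ, -, hcr⟩ := hF.exists_crossing_length j e
  refine ⟨?_, ?_, ?_⟩
  · rintro ⟨c, d⟩ h
    by_cases hc : coreImage T F j c ∈ T.endArc (e, b)
    · simp [hc]
    · obtain ⟨-, b', h1, h2⟩ := hcr c d h
      have : (!b') = b := by
        cases b <;> cases b' <;> simp_all
      rw [this] at h2
      simpa [hc] using h2
  · rintro ⟨c, d⟩ h ⟨c', d'⟩ h' heq
    replace h : IsCrossing T F j e c d := h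
    replace h' : IsCrossing T F j e c' d' := h'
    simp only at heq
    split_ifs at heq
    · subst heq; exact Prod.ext rfl (h.right_unique h')
    · subst heq; exact (hF.not_both_crossing h' h).elim
    · subst heq; exact (hF.not_both_crossing h h').elim
    · subst heq; exact Prod.ext (h.left_unique h') rfl
  · intro t ht
    replace ht : coreImage T F j t ∈ T.endArc (e, b) := ht
    rcases hF.exists_crossing_of_mem_endArc ht with ⟨c, hc⟩ | ⟨d, hd⟩
    · refine ⟨(c, t), hc, if_neg fun h => ?_⟩
      obtain ⟨-, b', h1, h2⟩ := hcr c t hc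
      have h3 := (Prod.ext_iff.1 (endArc_eq h h1)).2
      have h4 := (Prod.ext_iff.1 (endArc_eq ht h2)).2
      simp only at h3 h4
      rw [← h3] at h4
      cases b <;> simp at h4
    · exact ⟨(t, d), hd, if_pos ht⟩

theorem IsMarkov.finite_mem_endArc (hF : IsMarkov T F) (j : T.E) (q : T.E × Bool) :
    {t | coreImage T F j t ∈ T.endArc q}.Finite := by
  rw [← (hF.bijOn_crossings j q.1 q.2).image_eq]
  exact (hF.finite_crossings j q.1).image _

/-- The image of a core arc crosses a strip as often as it is at a given end of the strip. -/
theorem IsMarkov.ncard_components (hF : IsMarkov T F) (j : T.E) (q : T.E × Bool) :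
    {C : Set I | ∃ t, coreImage T F j t ∈ T.strip q.1 ∧
      C = connectedComponentIn {t | coreImage T F j t ∈ T.strip q.1} t}.ncard =
    {t | coreImage T F j t ∈ T.endArc q}.ncard := by
  have h1 : {C : Set I | ∃ t, coreImage T F j t ∈ T.strip q.1 ∧
      C = connectedComponentIn {t | coreImage T F j t ∈ T.strip q.1} t} =
      (fun x : I × I => Ioo x.1 x.2) '' {x | IsCrossing T F j q.1 x.1 x.2} := by
    ext C
    constructor
    · rintro ⟨t, ht, rfl⟩
      obtain ⟨c, d, h, htcd⟩ := hF.exists_isCrossing ht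
      exact ⟨(c, d), h, (h.connectedComponentIn_eq htcd).symm⟩
    · rintro ⟨⟨c, d⟩, h, rfl⟩
      replace h : IsCrossing T F j q.1 c d := h
      obtain ⟨t, ht⟩ := nonempty_Ioo.2 h.lt
      exact ⟨t, h.mem_strip t ht, (h.connectedComponentIn_eq ht).symm⟩
  rw [h1, InjOn.ncard_image, ← (hF.bijOn_crossings j q.1 q.2).image_eq,
    (hF.bijOn_crossings j q.1 q.2).injOn.ncard_image]
  rintro ⟨c, d⟩ h ⟨c', d'⟩ h' heq
  replace h : IsCrossing T F j q.1 c d := h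
  replace h' : IsCrossing T F j q.1 c' d' := h'
  have heq' : Ioo c d = Ioo c' d' := heq
  refine Prod.ext ?_ ?_
  · rw [← csInf_Ioo h.lt, heq', csInf_Ioo h'.lt]
  · rw [← csSup_Ioo h.lt, heq', csSup_Ioo h'.lt]

open Classical in
/-- At each end of a strip, the crossings of the strip by the image of a core arc continue as pushed
edges, except at the two endpoints of the core arc. -/
theorem IsMarkov.ncard_mem_endArc (hF : IsMarkov T F) (j : T.E) (q : T.E × Bool) :
    {x : I × I | IsPushed T F j x.1 x.2 ∧ coreImage T F j x.1 ∈ T.endArc q}.ncard +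
      {x : I × I | IsPushed T F j x.1 x.2 ∧ coreImage T F j x.2 ∈ T.endArc q}.ncard +
      ∑ b : Bool, (if F (T.switch (j, b)) ∈ T.endArc q then 1 else 0) =
    {t | coreImage T F j t ∈ T.endArc q}.ncard := by
  set P := {t | coreImage T F j t ∈ T.endArc q} with hP
  set A := {x : I × I | IsPushed T F j x.1 x.2 ∧ coreImage T F j x.1 ∈ T.endArc q}
  set B := {x : I × I | IsPushed T F j x.1 x.2 ∧ coreImage T F j x.2 ∈ T.endArc q}
  have hfin : P.Finite := hF.finite_mem_endArc j q
  have hA : (Prod.fst '' A).ncard = A.ncard := InjOn.ncard_image <| by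
    rintro ⟨a, b⟩ h ⟨a', b'⟩ h' rfl
    exact Prod.ext rfl (IsPushed.right_unique h.1 h'.1)
  have hB : (Prod.snd '' B).ncard = B.ncard := InjOn.ncard_image <| by
    rintro ⟨a, b⟩ h ⟨a', b'⟩ h' rfl
    exact Prod.ext (IsPushed.left_unique h.1 h'.1) rfl
  have hAB : Disjoint (Prod.fst '' A) (Prod.snd '' B) := by
    rw [Set.disjoint_left]
    rintro _ ⟨⟨a, b⟩, h, rfl⟩ ⟨⟨a', b'⟩, h', rfl⟩
    obtain ⟨e, c, hc⟩ := hF.exists_crossing_left h.1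
    obtain ⟨e', d, hd⟩ := hF.exists_crossing_right h'.1
    exact hF.not_both_crossing hc hd
  have hAP : Prod.fst '' A ⊆ P := by rintro _ ⟨x, hx, rfl⟩; exact hx.2
  have hBP : Prod.snd '' B ⊆ P := by rintro _ ⟨x, hx, rfl⟩; exact hx.2
  have h1 : fromEnd true 0 = (1 : I) := by simp [fromEnd]
  have h0 : fromEnd false 0 = (0 : I) := by simp [fromEnd]
  have hends : (P ∩ {0, 1}).ncard =
      ∑ b : Bool, (if F (T.switch (j, b)) ∈ T.endArc q then 1 else 0) := by
    rw [Fintype.sum_bool, ← coreImage_fromEnd, ← coreImage_fromEnd, h0, h1]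
    have hi0 : (0 : I) ∈ P ↔ coreImage T F j 0 ∈ T.endArc q := Iff.rfl
    have hi1 : (1 : I) ∈ P ↔ coreImage T F j 1 ∈ T.endArc q := Iff.rfl
    rw [← hi0, ← hi1]
    by_cases p0 : (0 : I) ∈ P <;> by_cases p1 : (1 : I) ∈ P
    · rw [inter_eq_self_of_subset_right (by rintro _ (rfl | rfl) <;> assumption),
        ncard_pair (zero_ne_one' I), if_pos p0, if_pos p1]
    · rw [inter_insert_of_mem p0, inter_singleton_eq_empty.2 p1]
      simp [p0, p1]
    · rw [inter_insert_of_notMem p0, inter_eq_self_of_subset_right (singleton_subset_iff.2 p1)]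
      simp [p0, p1]
    · rw [inter_insert_of_notMem p0, inter_singleton_eq_empty.2 p1]
      simp [p0, p1]
  have hunion : P = (Prod.fst '' A ∪ Prod.snd '' B) ∪ (P ∩ {0, 1}) := by
    refine Subset.antisymm (fun t ht => ?_) (union_subset (union_subset hAP hBP) inter_subset_left)
    by_cases h01 : t ∈ ({0, 1} : Set I)
    · exact Or.inr ⟨ht, h01⟩
    · left
      simp only [mem_insert_iff, mem_singleton_iff, not_or] at h01
      rcases hF.exists_crossing_of_mem_endArc (e := q.1) (b := q.2) ht with ⟨c, hc⟩ | ⟨d, hd⟩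
      · obtain ⟨b, hb⟩ := hF.exists_isPushed_right hc (lt_of_le_of_ne t.2.2 h01.2)
        exact Or.inl ⟨(t, b), ⟨hb, ht⟩, rfl⟩
      · obtain ⟨a, ha⟩ := hF.exists_isPushed_left hd (lt_of_le_of_ne t.2.1 (Ne.symm h01.1))
        exact Or.inr ⟨(a, t), ⟨ha, ht⟩, rfl⟩
  have hdisj : Disjoint (Prod.fst '' A ∪ Prod.snd '' B) (P ∩ {0, 1}) := by
    rw [Set.disjoint_left]
    rintro _ (⟨⟨a, b⟩, h, rfl⟩ | ⟨⟨a, b⟩, h, rfl⟩) ⟨-, h01⟩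
    · obtain ⟨e, c, hc⟩ := hF.exists_crossing_left h.1
      rcases h01 with rfl | rfl
      · exact not_lt.2 c.2.1 hc.lt
      · exact not_lt.2 b.2.2 h.1.lt
    · obtain ⟨e, d, hd⟩ := hF.exists_crossing_right h.1
      rcases h01 with rfl | rfl
      · exact not_lt.2 a.2.1 h.1.lt
      · exact not_lt.2 d.2.2 hd.lt
  have hcard := ncard_union_eq hdisj ((hfin.subset hAP).union (hfin.subset hBP))
    (hfin.subset inter_subset_left)
  rw [← hunion, ncard_union_eq hAB (hfin.subset hAP) (hfin.subset hBP), hA, hB, hends] at hcard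
  exact hcard.symm

theorem IsMarkov.finite_isPushed (hF : IsMarkov T F) (j : T.E) :
    {x : I × I | IsPushed T F j x.1 x.2}.Finite := by
  refine Finite.of_injOn (f := Prod.fst)
    (t := (fun x : T.E × I × I => x.2.2) '' {x | IsCrossing T F j x.1 x.2.1 x.2.2}) ?_ ?_
    ((hF.finite_all_crossings j).image _)
  · rintro ⟨a, b⟩ h
    obtain ⟨e, c, hc⟩ := hF.exists_crossing_left h
    exact ⟨(e, c, a), hc, rfl⟩
  · rintro ⟨a, b⟩ h ⟨a', b'⟩ h' rfl
    exact Prod.ext rfl (IsPushed.right_unique h h')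

end Counting

/-! ### Pushed edges and the columns of the transition matrix -/

section Columns

open scoped ENNReal

variable {S : Type*} [MetricSpace S] [ChartedSpace ℂ S] {T : FiniteThickGraph S} {F : S ≃ₜ S}

open FiniteThickGraph

namespace GenTrainTrack

variable {A : Set S} {τ : GenTrainTrack T A}

/-- Infinitesimal edges, with their endpoints, lie in junctions, as junctions are closed. -/
theorem edge_mem_junctions (i : τ.Inf) (t : I) : τ.edge i t ∈ T.junctions := by
  obtain ⟨v, hv⟩ := τ.edge_interior i
  have h : ∀ t ∈ closure (Ioo (0 : I) 1), τ.edge i t ∈ T.junction v :=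
    closure_minimal (fun t ht => (interior_subset (hv t ht.1 ht.2).1 : τ.edge i t ∈ T.junction v))
      ((isClosed_junction v).preimage (τ.edge i).continuous)
  rw [closure_Ioo (zero_ne_one' I)] at h
  exact mem_iUnion.2 ⟨v, h t ⟨t.2.1, t.2.2⟩⟩

open Classical in
/-- The number of ends of an infinitesimal edge at a switch. -/
def endCount (τ : GenTrainTrack T A) (q : T.E × Bool) (i : τ.Inf) : ℕ :=
  (if τ.edge i 0 = T.switch q then 1 else 0) + if τ.edge i 1 = T.switch q then 1 else 0

theorem endCount_le_two (q : T.E × Bool) (i : τ.Inf) : τ.endCount q i ≤ 2 := by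
  unfold endCount
  split_ifs <;> omega

end GenTrainTrack

namespace PushedEdge

variable {A : Set S} {τ : GenTrainTrack T A}

theorem eq_of {p p' : PushedEdge τ F} (h : p.src = p'.src) (ha : p.a = p'.a) (hb : p.b = p'.b) :
    p = p' := by
  cases p; cases p'
  simp only at h ha hb
  subst h ha hb
  rfl

open Classical in
/-- The number of ends of a pushed edge at a switch, after the strips have been flattened. -/
def endCount (p : PushedEdge τ F) (q : T.E × Bool) : ℕ :=
  (if F (τ.path p.src p.a) ∈ T.endArc q then 1 else 0) +
    if F (τ.path p.src p.b) ∈ T.endArc q then 1 else 0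

theorem isPushed {p : PushedEdge τ F} {j : T.E} (h : p.src = Sum.inl j) :
    IsPushed T F j p.a p.b := by
  refine ⟨p.lt, ?_⟩
  have := p.comp
  rw [h] at this
  exact this

/-- The pushed edges that come from a real edge, as intervals. -/
theorem bijOn_isPushed (τ : GenTrainTrack T A) (F : S ≃ₜ S) (j : T.E) :
    BijOn (fun p : PushedEdge τ F => (p.a, p.b)) {p | p.src = Sum.inl j}
      {x | IsPushed T F j x.1 x.2} := by
  refine ⟨fun p hp => isPushed hp, fun p hp p' hp' h => ?_, fun x hx => ?_⟩
  · exact eq_of (hp.trans hp'.symm) (Prod.ext_iff.1 h).1 (Prod.ext_iff.1 h).2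
  · exact ⟨⟨Sum.inl j, x.1, x.2, hx.lt, hx.comp⟩, rfl, rfl⟩

theorem ncard_isPushed (τ : GenTrainTrack T A) (F : S ≃ₜ S) (j : T.E) (P : I × I → Prop) :
    {p : PushedEdge τ F | p.src = Sum.inl j ∧ P (p.a, p.b)}.ncard =
      {x : I × I | IsPushed T F j x.1 x.2 ∧ P x}.ncard := by
  have hbij := bijOn_isPushed τ F j
  have h : {x : I × I | IsPushed T F j x.1 x.2 ∧ P x} =
      (fun p : PushedEdge τ F => (p.a, p.b)) '' {p | p.src = Sum.inl j ∧ P (p.a, p.b)} := by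
    ext x
    constructor
    · rintro ⟨h1, h2⟩
      obtain ⟨p, hp, rfl⟩ := hbij.surjOn h1
      exact ⟨p, ⟨hp, h2⟩, rfl⟩
    · rintro ⟨p, ⟨hp, h2⟩, rfl⟩
      exact ⟨hbij.mapsTo hp, h2⟩
  rw [h, InjOn.ncard_image (hbij.injOn.mono fun p hp => hp.1)]

theorem a_eq_b_eq_of_inr (hF : IsThickGraphMap T F) {p : PushedEdge τ F} {i : τ.Inf}
    (h : p.src = Sum.inr i) : p.a = 0 ∧ p.b = 1 := by
  have hcomp := p.comp
  rw [h] at hcomp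
  have huniv : {t | F (τ.path (Sum.inr i) t) ∈ T.junctions} = univ :=
    eq_univ_of_forall fun t => hF.map_mem_junctions (τ.edge_mem_junctions i t)
  rw [huniv, connectedComponentIn_univ, PreconnectedSpace.connectedComponent_eq_univ] at hcomp
  have h0 : (0 : I) ∈ Icc p.a p.b := hcomp ▸ mem_univ _
  have h1 : (1 : I) ∈ Icc p.a p.b := hcomp ▸ mem_univ _
  exact ⟨le_antisymm h0.1 p.a.2.1, le_antisymm p.b.2.2 h1.2⟩

/-- The only pushed edge that comes from an infinitesimal edge: the whole image of the edge. -/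
def ofInf (hF : IsThickGraphMap T F) (i : τ.Inf) : PushedEdge τ F where
  src := Sum.inr i
  a := 0
  b := 1
  lt := zero_lt_one' I
  comp := by
    have huniv : {t | F (τ.path (Sum.inr i) t) ∈ T.junctions} = univ :=
      eq_univ_of_forall fun t => hF.map_mem_junctions (τ.edge_mem_junctions i t)
    rw [huniv, connectedComponentIn_univ, PreconnectedSpace.connectedComponent_eq_univ]
    exact Icc_bot_top.symm

theorem setOf_src_eq_inr (hF : IsThickGraphMap T F) (i : τ.Inf) :
    {p : PushedEdge τ F | p.src = Sum.inr i} = {ofInf hF i} := by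
  ext p
  constructor
  · intro h
    obtain ⟨ha, hb⟩ := a_eq_b_eq_of_inr hF h
    exact eq_of h ha hb
  · rintro rfl
    rfl

theorem finite_setOf_src_eq (hF : IsMarkov T F) (j : τ.Edge) :
    {p : PushedEdge τ F | p.src = j}.Finite := by
  rcases j with j | i
  · have h := bijOn_isPushed τ F j
    exact Finite.of_injOn h.mapsTo h.injOn (hF.finite_isPushed j)
  · rw [setOf_src_eq_inr hF.toIsThickGraphMap]
    exact finite_singleton _

/-- `F` maps the endpoints of a pushed edge to ends of strips. -/
theorem exists_mem_endArc (hF : IsMarkov T F) (p : PushedEdge τ F) :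
    (∃ q, F (τ.path p.src p.a) ∈ T.endArc q) ∧ ∃ q, F (τ.path p.src p.b) ∈ T.endArc q := by
  rcases h : p.src with j | i
  · obtain ⟨e, c, hc⟩ := hF.exists_crossing_left (isPushed h)
    obtain ⟨e', d, hd⟩ := hF.exists_crossing_right (isPushed h)
    obtain ⟨b, hb⟩ := hc.right_mem_endArc
    obtain ⟨b', hb'⟩ := hd.left_mem_endArc
    exact ⟨⟨_, hb⟩, ⟨_, hb'⟩⟩
  · obtain ⟨ha, hb⟩ := a_eq_b_eq_of_inr hF.toIsThickGraphMap h
    obtain ⟨⟨q, hq⟩, ⟨q', hq'⟩⟩ := τ.edge_ends i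
    rw [ha, hb]
    refine ⟨?_, ?_⟩
    · change ∃ q, F (τ.edge i 0) ∈ T.endArc q
      rw [← hq]
      exact hF.exists_map_mem_endArc (switch_mem_endArc q)
    · change ∃ q, F (τ.edge i 1) ∈ T.endArc q
      rw [← hq']
      exact hF.exists_map_mem_endArc (switch_mem_endArc q')

theorem flattening_map_endArc (ψ : Flattening T A) {x : S} {q : T.E × Bool}
    (h : x ∈ T.endArc q) : ψ.map (x, 1) = T.switch q := by
  obtain ⟨y, rfl⟩ := h
  rw [ψ.map_rect]
  have : mix y half 1 = half := Subtype.ext (by simp [mix])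
  rw [this]
  rfl

theorem path_zero (ψ : Flattening T A) (p : PushedEdge τ F) :
    p.path ψ 0 = ψ.map (F (τ.path p.src p.a), 1) := by
  have : mix p.a p.b 0 = p.a := Subtype.ext (by simp [mix])
  rw [PushedEdge.path, this]

theorem path_one (ψ : Flattening T A) (p : PushedEdge τ F) :
    p.path ψ 1 = ψ.map (F (τ.path p.src p.b), 1) := by
  have : mix p.a p.b 1 = p.b := Subtype.ext (by simp [mix])
  rw [PushedEdge.path, this]

open Classical in
theorem endCount_eq (hF : IsMarkov T F) (ψ : Flattening T A) (p : PushedEdge τ F)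
    (q : T.E × Bool) :
    p.endCount q = (if p.path ψ 0 = T.switch q then 1 else 0) +
      if p.path ψ 1 = T.switch q then 1 else 0 := by
  obtain ⟨⟨q₀, h₀⟩, ⟨q₁, h₁⟩⟩ := p.exists_mem_endArc hF
  have h : ∀ x : S, ∀ q', x ∈ T.endArc q' → (x ∈ T.endArc q ↔ ψ.map (x, 1) = T.switch q) := by
    intro x q' hx
    rw [flattening_map_endArc ψ hx]
    refine ⟨fun hx' => by rw [endArc_eq hx hx'], fun h' => switch_injective h' ▸ hx⟩
  simp only [PushedEdge.endCount, path_zero, path_one, h _ _ h₀, h _ _ h₁]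

end PushedEdge

/-- Isotopies supported on the junctions fix the switches, which are limits of points of strips. -/
theorem SupportedIsotopy.map_switch {A : Set S} (h : SupportedIsotopy (T.junctions \ A)) (t : I)
    (q : T.E × Bool) : h.map (T.switch q, t) = T.switch q := by
  have h1 := tendsto_rect_fromEnd (T := T) q.1 q.2 half
  have h2 : Tendsto (fun x => h.map (T.rect q.1 (fromEnd q.2 x, half), t)) (𝓝[>] 0)
      (𝓝 (h.map (T.switch q, t))) :=
    ((h.map.continuous.comp (continuous_id.prodMk continuous_const)).tendsto _).comp h1
  refine tendsto_nhds_unique (h2.congr' ?_) h1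
  filter_upwards [eventually_mem_nhdsWithin, eventually_lt_nhdsGT (zero_lt_one' I)] with x hx hx'
  obtain ⟨h3, h4⟩ := fromEnd_mem_Ioo (b := q.2) hx hx'
  exact h.map_off _ _ fun hmem => notMem_junctions_of_mem_strip ⟨_, half, h3, h4, rfl⟩ hmem.1

theorem homeomorph_unitInterval_ends (r : I ≃ₜ I) :
    (r 0 = 0 ∧ r 1 = 1) ∨ (r 0 = 1 ∧ r 1 = 0) := by
  obtain ⟨s₀, h₀⟩ := r.surjective 0
  obtain ⟨s₁, h₁⟩ := r.surjective 1
  rcases r.continuous.strictMono_of_inj r.injective with h | h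
  · exact Or.inl ⟨le_antisymm ((h.monotone (s₀.2.1 : 0 ≤ s₀)).trans_eq h₀) (r 0).2.1,
      le_antisymm (r 1).2.2 (h₁.symm.trans_le (h.monotone (s₁.2.2 : s₁ ≤ 1)))⟩
  · exact Or.inr ⟨le_antisymm (r 0).2.2 (h₁ ▸ h.antitone s₁.2.1),
      le_antisymm (h₀ ▸ h.antitone s₀.2.2) (r 1).2.1⟩

namespace InvariantTrackMap

variable {τ : GenTrainTrack T (attractors F)} (φ : InvariantTrackMap T F τ)

/-- The train track map carries a pushed edge onto an infinitesimal edge with the same ends. -/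
theorem endCount_carry (hF : IsMarkov T F) (p : PushedEdge τ F) (q : T.E × Bool) :
    τ.endCount q (φ.carry p) = p.endCount q := by
  have hK : ∀ k ∈ φ.K, τ.endCount q (φ.carry k) = k.endCount q := by
    intro k hk
    obtain ⟨r, hr⟩ := φ.carry_isotopy k hk
    obtain ⟨⟨q₀, h₀⟩, ⟨q₁, h₁⟩⟩ := k.exists_mem_endArc hF
    have hfix0 : φ.isotopy.map (k.path φ.ψ 0, 1) = k.path φ.ψ 0 := by
      rw [PushedEdge.path_zero, PushedEdge.flattening_map_endArc φ.ψ h₀, φ.isotopy.map_switch]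
    have hfix1 : φ.isotopy.map (k.path φ.ψ 1, 1) = k.path φ.ψ 1 := by
      rw [PushedEdge.path_one, PushedEdge.flattening_map_endArc φ.ψ h₁, φ.isotopy.map_switch]
    rw [k.endCount_eq hF φ.ψ, GenTrainTrack.endCount, ← hr 0, ← hr 1]
    rcases homeomorph_unitInterval_ends r with ⟨h0, h1⟩ | ⟨h0, h1⟩
    · rw [h0, h1, hfix0, hfix1]
    · rw [h0, h1, hfix0, hfix1, add_comm]
  by_cases hp : p ∈ φ.K
  · exact hK p hp
  · obtain ⟨k, hk, ⟨d, hd0, hd1, hdc, -⟩, hpk⟩ := φ.carry_parallel p hp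
    rw [hpk, hK k hk, k.endCount_eq hF φ.ψ, p.endCount_eq hF φ.ψ]
    rcases hd1 with hd1 | hd1
    · rw [← hd1 0, ← hd1 1, (hdc 1).1, (hdc 1).2]
    · have h0 := hd1 0
      have h1 := hd1 1
      rw [symm_zero, (hdc 1).1] at h0
      rw [symm_one, (hdc 1).2] at h1
      rw [← h0, ← h1, add_comm]

theorem toBlocks₁₂_eq_zero (hF : IsMarkov T F) : φ.transition.toBlocks₁₂ = 0 := by
  ext e i
  change Set.ncard {C : Set I | ∃ t, F (τ.edge i t) ∈ T.strip e ∧ _} = 0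
  rw [show (0 : ℕ) = (∅ : Set (Set I)).ncard from (ncard_empty _).symm]
  congr 1
  rw [eq_empty_iff_forall_notMem]
  rintro C ⟨t, ht, -⟩
  exact notMem_junctions_of_mem_strip ht (hF.map_mem_junctions (τ.edge_mem_junctions i t))

end InvariantTrackMap

open Classical in
/-- Summation over the fibres of a map on a finite set. -/
theorem tsum_mul_ncard_fiber {X Y : Type*} {Q : Set X} (hQ : Q.Finite) (f : X → Y) (w : Y → ℝ≥0∞) :
    ∑' y, w y * ({x | x ∈ Q ∧ f x = y}.ncard : ℝ≥0∞) = ∑ x ∈ hQ.toFinset, w (f x) := by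
  have h : ∀ y, w y * ({x | x ∈ Q ∧ f x = y}.ncard : ℝ≥0∞) =
      ∑ x ∈ hQ.toFinset, if y = f x then w y else 0 := by
    intro y
    have hset : {x | x ∈ Q ∧ f x = y} = ↑(hQ.toFinset.filter fun x => y = f x) := by
      ext x
      simp [eq_comm]
    rw [hset, ncard_coe_finset, ← Finset.sum_filter, Finset.sum_const, nsmul_eq_mul, mul_comm]
  simp_rw [h]
  rw [Summable.tsum_finsetSum fun _ _ => ENNReal.summable]
  exact Finset.sum_congr rfl fun x _ => tsum_ite_eq (f x) w

namespace InvariantTrackMap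

variable {τ : GenTrainTrack T (attractors F)} (φ : InvariantTrackMap T F τ)

/-- A weighted sum over the infinitesimal part of a column of the transition matrix is a sum over
pushed edges. -/
theorem tsum_mul_transition (hF : IsMarkov T F) (j : τ.Edge) (w : τ.Inf → ℝ≥0∞) :
    ∑' i, w i * (φ.transition (Sum.inr i) j : ℝ≥0∞) =
      ∑ p ∈ (PushedEdge.finite_setOf_src_eq hF j).toFinset, w (φ.carry p) :=
  tsum_mul_ncard_fiber (PushedEdge.finite_setOf_src_eq hF j) φ.carry w

theorem tsum_transition (hF : IsMarkov T F) (j : τ.Edge) :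
    ∑' i, (φ.transition (Sum.inr i) j : ℝ≥0∞) = {p : PushedEdge τ F | p.src = j}.ncard := by
  have h := φ.tsum_mul_transition hF j fun _ => 1
  simp only [one_mul, Finset.sum_const, nsmul_eq_mul, mul_one] at h
  rw [h, ncard_eq_toFinset_card _ (PushedEdge.finite_setOf_src_eq hF j)]

/-- Every infinitesimal edge is reached from the real edges. -/
theorem reachable (hF : IsMarkov T F) (P : τ.Inf → Prop)
    (h1 : ∀ i e, 0 < φ.transition (Sum.inr i) (Sum.inl e) → P i)
    (h2 : ∀ i j, P j → 0 < φ.transition (Sum.inr i) (Sum.inr j) → P i) (i : τ.Inf) : P i := by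
  have hpos : ∀ p : PushedEdge τ F, 0 < φ.transition (Sum.inr (φ.carry p)) p.src := fun p =>
    (ncard_pos ((PushedEdge.finite_setOf_src_eq hF p.src).subset fun _ h => h.1)).2 ⟨p, rfl, rfl⟩
  have hstage : ∀ n, ∀ i ∈ φ.stage n, P i := by
    intro n
    induction n with
    | zero =>
      intro i hi
      rw [φ.stage_zero] at hi
      exact hi.elim
    | succ n ih =>
      intro i hi
      rw [φ.stage_succ] at hi
      obtain ⟨p, hp, rfl⟩ := hi
      have hp' := (φ.stageK_isPushForward n).prop.1 hp
      have := hpos p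
      rcases hsrc : p.src with e | j
      · rw [hsrc] at this
        exact h1 _ e this
      · rw [hsrc] at this
        exact h2 _ j (ih j (hp' j hsrc)) this
  have hi : i ∈ ⋃ n, φ.stage n := φ.stage_iUnion ▸ mem_univ i
  obtain ⟨n, hn⟩ := mem_iUnion.1 hi
  exact hstage n i hn

open Classical in
/-- The number of ends at the switch `q` of the pushed edges coming from a real edge: all crossings
of the strip at `q` contribute, except those at the images of the endpoints of the edge. -/
theorem tsum_endCount_mul_transition_inl (hF : IsMarkov T F) (q : T.E × Bool) (j : T.E) :
    ∑' i, (τ.endCount q i : ℝ≥0∞) * (φ.transition (Sum.inr i) (Sum.inl j) : ℝ≥0∞) +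
      ∑ b : Bool, (if F (T.switch (j, b)) ∈ T.endArc q then 1 else 0) =
    φ.transition (Sum.inl q.1) (Sum.inl j) := by
  have hfin := PushedEdge.finite_setOf_src_eq (τ := τ) hF (Sum.inl j)
  have hcard : ∀ P : PushedEdge τ F → Prop, ∑ p ∈ hfin.toFinset, (if P p then 1 else 0) =
      {p : PushedEdge τ F | p.src = Sum.inl j ∧ P p}.ncard := by
    intro P
    have hset : {p : PushedEdge τ F | p.src = Sum.inl j ∧ P p} = ↑(hfin.toFinset.filter P) := by
      ext p; simp
    rw [hset, ncard_coe_finset, Finset.card_filter]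
  have hsum : ∑ p ∈ hfin.toFinset, p.endCount q =
      {x : I × I | IsPushed T F j x.1 x.2 ∧ coreImage T F j x.1 ∈ T.endArc q}.ncard +
      {x : I × I | IsPushed T F j x.1 x.2 ∧ coreImage T F j x.2 ∈ T.endArc q}.ncard := by
    rw [← PushedEdge.ncard_isPushed τ F j fun x => coreImage T F j x.1 ∈ T.endArc q,
      ← PushedEdge.ncard_isPushed τ F j fun x => coreImage T F j x.2 ∈ T.endArc q, ← hcard, ← hcard,
      ← Finset.sum_add_distrib]
    refine Finset.sum_congr rfl fun p hp => ?_
    have hp' : p.src = Sum.inl j := by simpa using hp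
    rw [PushedEdge.endCount, hp']
    rfl
  rw [φ.tsum_mul_transition hF]
  simp only [φ.endCount_carry hF]
  have h := hF.ncard_mem_endArc j q
  rw [← hsum, ← hF.ncard_components j q] at h
  have h' : (φ.transition (Sum.inl q.1) (Sum.inl j) : ℝ≥0∞) = _ := congrArg Nat.cast h.symm
  rw [h']
  push_cast
  rfl

open Classical in
/-- The image of an end of an infinitesimal edge at the switch `q'` is an end at the switch to which
`F` and the flattening map `q'`. -/
theorem tsum_endCount_mul_transition_inr (hF : IsMarkov T F) (q : T.E × Bool) (j : τ.Inf) :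
    ∑' i, (τ.endCount q i : ℝ≥0∞) * (φ.transition (Sum.inr i) (Sum.inr j) : ℝ≥0∞) =
      ∑ q', if F (T.switch q') ∈ T.endArc q then (τ.endCount q' j : ℝ≥0∞) else 0 := by
  have h1 : (PushedEdge.finite_setOf_src_eq (τ := τ) hF (Sum.inr j)).toFinset =
      {PushedEdge.ofInf hF.toIsThickGraphMap j} := by
    ext p
    have := congrArg (p ∈ ·) (PushedEdge.setOf_src_eq_inr (τ := τ) hF.toIsThickGraphMap j)
    simpa using this
  rw [φ.tsum_mul_transition hF, h1, Finset.sum_singleton, φ.endCount_carry hF]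
  obtain ⟨⟨q₀, h₀⟩, ⟨q₁, h₁⟩⟩ := τ.edge_ends j
  have hsw : ∀ a : T.E × Bool, (∑ q', if F (T.switch q') ∈ T.endArc q then
      (if T.switch a = T.switch q' then 1 else 0) else 0) =
      if F (T.switch a) ∈ T.endArc q then (1 : ℕ) else 0 := by
    intro a
    rw [Finset.sum_eq_single a]
    · simp
    · intro b _ hb
      simp [switch_injective.eq_iff, Ne.symm hb]
    · simp
  have h2 : (PushedEdge.ofInf hF.toIsThickGraphMap j).endCount q =
      ∑ q', if F (T.switch q') ∈ T.endArc q then τ.endCount q' j else 0 := by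
    change (if F (τ.edge j 0) ∈ T.endArc q then 1 else 0) +
      (if F (τ.edge j 1) ∈ T.endArc q then 1 else 0) = _
    simp only [GenTrainTrack.endCount]
    rw [← h₀, ← h₁, ← hsw, ← hsw, ← Finset.sum_add_distrib]
    refine Finset.sum_congr rfl fun q' _ => ?_
    split_ifs <;> rfl
  rw [h2]
  push_cast
  rfl

end InvariantTrackMap

end Columns

/-! ### The switch conditions -/

section Switches

open scoped ENNReal NNReal

/-- If each `d q`, multiplied by `lam > 1`, is the sum of `d` over the fibre of a self-map of a finite
set, then `d` vanishes: the sum of the `|d q|` would grow. -/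
theorem eq_zero_of_fiber_sums {Q : Type*} [Fintype Q] (θ : Q → Q → Prop)
    [∀ q q', Decidable (θ q' q)] (hθ : ∀ q' q₁ q₂, θ q' q₁ → θ q' q₂ → q₁ = q₂) {lam : ℝ}
    (hlam : 1 < lam) {d : Q → ℝ} (hd : ∀ q, lam * d q = ∑ q', if θ q' q then d q' else 0) (q : Q) :
    d q = 0 := by
  have h1 : lam * ∑ q, |d q| ≤ ∑ q, |d q| := by
    calc lam * ∑ q, |d q| = ∑ q, |∑ q', if θ q' q then d q' else 0| := by
          rw [Finset.mul_sum]
          refine Finset.sum_congr rfl fun q _ => ?_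
          rw [← hd, abs_mul, abs_of_pos (one_pos.trans hlam)]
      _ ≤ ∑ q, ∑ q', if θ q' q then |d q'| else 0 := by
          refine Finset.sum_le_sum fun q _ => (Finset.abs_sum_le_sum_abs _ _).trans_eq ?_
          refine Finset.sum_congr rfl fun q' _ => ?_
          split_ifs
          · rfl
          · exact abs_zero
      _ = ∑ q', ∑ q, if θ q' q then |d q'| else 0 := Finset.sum_comm
      _ ≤ ∑ q', |d q'| := by
          refine Finset.sum_le_sum fun q' _ => ?_
          rw [← Finset.sum_filter, Finset.sum_const, nsmul_eq_mul]
          refine mul_le_of_le_one_left (abs_nonneg _) ?_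
          exact_mod_cast Finset.card_le_one.2 fun a ha b hb =>
            hθ q' a b (Finset.mem_filter.1 ha).2 (Finset.mem_filter.1 hb).2
  have h2 : 0 ≤ ∑ q, |d q| := Finset.sum_nonneg fun q _ => abs_nonneg _
  have h3 : ∑ q, |d q| = 0 := by nlinarith
  exact abs_eq_zero.1 ((Finset.sum_eq_zero_iff_of_nonneg fun q _ => abs_nonneg _).1 h3 q
    (Finset.mem_univ q))

variable {S : Type*} [MetricSpace S] [ChartedSpace ℂ S] {T : FiniteThickGraph S} {F : S ≃ₜ S}

open FiniteThickGraph

/-- The switch conditions, in terms of the number of ends at each switch. -/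
theorem GenTrainTrack.switchConditions_of_endCount {A : Set S} {τ : GenTrainTrack T A}
    {y : τ.Edge → ℝ} (hy : ∀ e, 0 ≤ y e) (hsum : Summable fun i => y (Sum.inr i))
    (h : ∀ q, HasSum (fun i => (τ.endCount q i : ℝ) * y (Sum.inr i)) (y (Sum.inl q.1))) :
    τ.SwitchConditions y := by
  refine ⟨hy, fun q => ?_⟩
  set X : Set τ.Inf := {i | Xor (τ.edge i 0 = T.switch q) (τ.edge i 1 = T.switch q)}
  set D : Set τ.Inf := {i | τ.edge i 0 = T.switch q ∧ τ.edge i 1 = T.switch q}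
  have hX := (hsum.subtype X).hasSum
  have hD := (hsum.subtype D).hasSum
  refine ⟨_, _, hX, hD, (h q).unique ?_⟩
  have hX' : HasSum (X.indicator fun i => y (Sum.inr i)) _ :=
    hasSum_subtype_iff_indicator.1 hX
  have hD' : HasSum (D.indicator fun i => y (Sum.inr i)) _ :=
    hasSum_subtype_iff_indicator.1 hD
  convert! hX'.add (hD'.mul_left 2) using 2 with i
  by_cases h0 : τ.edge i 0 = T.switch q <;> by_cases h1 : τ.edge i 1 = T.switch q <;>
    simp [X, D, indicator, GenTrainTrack.endCount, h0, h1, Xor, one_add_one_eq_two]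

open Classical in
/-- A positive eigenvector of the transition matrix for an eigenvalue `lam > 1` satisfies the switch
conditions: by the count of the ends of pushed edges, the defects `y(e_q) - ∑ y(e) - 2 ∑ y(e')` are
multiplied by `lam` when they are summed over the fibres of the self-map of the switches induced
by `F`. -/
theorem InvariantTrackMap.switchConditions {τ : GenTrainTrack T (attractors F)}
    (φ : InvariantTrackMap T F τ) (hF : IsMarkov T F) {A : L1 ℝ τ.Edge →L[ℝ] L1 ℝ τ.Edge}
    (hA : ActsAs φ.transition A) {y : L1 ℝ τ.Edge} (hy : ∀ e, 0 < y e) {lam : ℝ} (hlam : 1 < lam)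
    (h : A y = lam • y) : τ.SwitchConditions fun e => y e := by
  have hlam0 : 0 < lam := one_pos.trans hlam
  have hsum : Summable fun i => y (Sum.inr i) := by
    have := (memℓp_one_iff.1 y.2).comp_injective Sum.inr_injective
    exact this.of_norm
  have hsumq : ∀ q, Summable fun i => (τ.endCount q i : ℝ) * y (Sum.inr i) := fun q => by
    refine Summable.of_nonneg_of_le (fun i => mul_nonneg (Nat.cast_nonneg _) (hy _).le)
      (fun i => ?_) (hsum.mul_left 2)
    exact mul_le_mul_of_nonneg_right (by exact_mod_cast GenTrainTrack.endCount_le_two q i) (hy _).le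
  set Y : τ.Edge → ℝ≥0∞ := fun e => ENNReal.ofReal (y e) with hY
  set s : T.E × Bool → ℝ := fun q => ∑' i, (τ.endCount q i : ℝ) * y (Sum.inr i) with hs
  have hs0 : ∀ q, 0 ≤ s q := fun q => tsum_nonneg fun i => mul_nonneg (Nat.cast_nonneg _) (hy _).le
  have hsE : ∀ q, ∑' i, (τ.endCount q i : ℝ≥0∞) * Y (Sum.inr i) = ENNReal.ofReal (s q) := by
    intro q
    rw [hs, ENNReal.ofReal_tsum_of_nonneg (fun i => mul_nonneg (Nat.cast_nonneg _) (hy _).le)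
      (hsumq q)]
    refine tsum_congr fun i => ?_
    rw [ENNReal.ofReal_mul (Nat.cast_nonneg _), ENNReal.ofReal_natCast]
  have hrow : ∀ i, ENNReal.ofReal lam * Y i = ∑' j, (φ.transition i j : ℝ≥0∞) * Y j := by
    intro i
    have h1 := hA y i
    rw [h] at h1
    have h2 : ENNReal.ofReal (lam * y i) = ∑' j, ENNReal.ofReal ((φ.transition i j : ℝ) * y j) := by
      rw [← ENNReal.ofReal_tsum_of_nonneg (fun j => mul_nonneg (Nat.cast_nonneg _) (hy _).le)
        h1.summable, h1.tsum_eq]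
      rfl
    rw [ENNReal.ofReal_mul hlam0.le] at h2
    rw [h2]
    refine tsum_congr fun j => ?_
    rw [ENNReal.ofReal_mul (Nat.cast_nonneg _), ENNReal.ofReal_natCast]
  -- the left-hand side counts the ends of the pushed edges at `q`, source by source
  have hcount : ∀ q, ENNReal.ofReal lam * ENNReal.ofReal (s q) =
      ∑ j, (∑' i, (τ.endCount q i : ℝ≥0∞) * φ.transition (Sum.inr i) (Sum.inl j)) * Y (Sum.inl j) +
      ∑' j, (∑' i, (τ.endCount q i : ℝ≥0∞) * φ.transition (Sum.inr i) (Sum.inr j)) *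
        Y (Sum.inr j) := by
    intro q
    calc ENNReal.ofReal lam * ENNReal.ofReal (s q)
        = ∑' i, ∑' j, (τ.endCount q i : ℝ≥0∞) * (φ.transition (Sum.inr i) j * Y j) := by
          rw [← hsE, ← ENNReal.tsum_mul_left]
          refine tsum_congr fun i => ?_
          rw [mul_left_comm, hrow, ENNReal.tsum_mul_left]
      _ = ∑' j, (∑' i, (τ.endCount q i : ℝ≥0∞) * φ.transition (Sum.inr i) j) * Y j := by
          rw [ENNReal.tsum_comm]
          refine tsum_congr fun j => ?_
          rw [← ENNReal.tsum_mul_right]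
          simp only [mul_assoc]
      _ = _ := by
          rw [ENNReal.summable.tsum_sum ENNReal.summable, tsum_fintype]
  have hinf : ∀ q, ∑' j, (∑' i, (τ.endCount q i : ℝ≥0∞) * φ.transition (Sum.inr i) (Sum.inr j)) *
      Y (Sum.inr j) =
      ∑ q', if F (T.switch q') ∈ T.endArc q then ENNReal.ofReal (s q') else 0 := by
    intro q
    simp only [φ.tsum_endCount_mul_transition_inr hF, Finset.sum_mul, ite_mul, zero_mul]
    rw [Summable.tsum_finsetSum fun _ _ => ENNReal.summable]
    refine Finset.sum_congr rfl fun q' _ => ?_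
    split_ifs
    · exact hsE q'
    · exact tsum_zero
  have hreal : ∀ q,
      ∑ j, (∑' i, (τ.endCount q i : ℝ≥0∞) * φ.transition (Sum.inr i) (Sum.inl j)) * Y (Sum.inl j) +
      ∑ q' : T.E × Bool, (if F (T.switch q') ∈ T.endArc q then Y (Sum.inl q'.1) else 0) =
      ENNReal.ofReal lam * Y (Sum.inl q.1) := by
    intro q
    rw [hrow, ENNReal.summable.tsum_sum ENNReal.summable, tsum_fintype]
    have h0 : ∀ i, φ.transition (Sum.inl q.1) (Sum.inr i) = 0 := fun i =>
      congrFun (congrFun (φ.toBlocks₁₂_eq_zero hF) q.1) i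
    simp only [h0, Nat.cast_zero, zero_mul, tsum_zero, add_zero]
    rw [Fintype.sum_prod_type, ← Finset.sum_add_distrib]
    refine Finset.sum_congr rfl fun j _ => ?_
    rw [← φ.tsum_endCount_mul_transition_inl hF q j, add_mul, Finset.sum_mul]
    simp only [ite_mul, one_mul, zero_mul]
  have hdef : ∀ q, lam * (y (Sum.inl q.1) - s q) =
      ∑ q' : T.E × Bool, if F (T.switch q') ∈ T.endArc q then y (Sum.inl q'.1) - s q' else 0 := by
    intro q
    have h1 := congrArg (· + ∑ q' : T.E × Bool,
      (if F (T.switch q') ∈ T.endArc q then Y (Sum.inl q'.1) else 0)) (hcount q)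
    beta_reduce at h1
    rw [hinf, add_right_comm, hreal] at h1
    have hof : ∀ f : T.E × Bool → ℝ, (∀ q, 0 ≤ f q) →
        ∑ q' : T.E × Bool, (if F (T.switch q') ∈ T.endArc q then ENNReal.ofReal (f q') else 0) =
        ENNReal.ofReal (∑ q' : T.E × Bool, if F (T.switch q') ∈ T.endArc q then f q' else 0) := by
      intro f hf
      rw [ENNReal.ofReal_sum_of_nonneg fun q' _ => by split_ifs; exacts [hf q', le_rfl]]
      refine Finset.sum_congr rfl fun q' _ => ?_
      split_ifs
      · rfl
      · exact ENNReal.ofReal_zero.symm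
    have hnn : ∀ f : T.E × Bool → ℝ, (∀ q, 0 ≤ f q) →
        0 ≤ ∑ q' : T.E × Bool, if F (T.switch q') ∈ T.endArc q then f q' else 0 := fun f hf =>
      Finset.sum_nonneg fun q' _ => by split_ifs; exacts [hf q', le_rfl]
    have hyq : ∀ q : T.E × Bool, 0 ≤ y (Sum.inl q.1) := fun q => (hy _).le
    rw [hof _ hs0, hof _ hyq, ← ENNReal.ofReal_mul hlam0.le, ← ENNReal.ofReal_mul hlam0.le,
      ← ENNReal.ofReal_add (mul_nonneg hlam0.le (hs0 q)) (hnn _ hyq),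
      ← ENNReal.ofReal_add (mul_nonneg hlam0.le (hyq q)) (hnn _ hs0),
      ENNReal.ofReal_eq_ofReal_iff (add_nonneg (mul_nonneg hlam0.le (hs0 q)) (hnn _ hyq))
        (add_nonneg (mul_nonneg hlam0.le (hyq q)) (hnn _ hs0))] at h1
    have h2 : (∑ q' : T.E × Bool, if F (T.switch q') ∈ T.endArc q then y (Sum.inl q'.1) - s q'
        else 0) = (∑ q' : T.E × Bool, if F (T.switch q') ∈ T.endArc q then y (Sum.inl q'.1) else 0) -
        ∑ q', if F (T.switch q') ∈ T.endArc q then s q' else 0 := by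
      rw [← Finset.sum_sub_distrib]
      refine Finset.sum_congr rfl fun q' _ => ?_
      split_ifs
      · rfl
      · exact (sub_zero 0).symm
    rw [h2]
    linarith
  refine GenTrainTrack.switchConditions_of_endCount (fun e => (hy e).le) hsum fun q => ?_
  have hq := eq_zero_of_fiber_sums (fun q' q => F (T.switch q') ∈ T.endArc q)
    (fun q' q₁ q₂ => endArc_eq) hlam hdef q
  rw [sub_eq_zero.1 hq]
  exact (hsumq q).hasSum

end Switches

end TrainTracks

end

theorem mainTheorem6 {S : Type*} [MetricSpace S] [CompactSpace S] [ConnectedSpace S]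
    [ChartedSpace ℂ S] (hS : TrainTracks.OrientedAtlas S)
    (T : TrainTracks.FiniteThickGraph S) (hT : T.OncePunctured)
    (F : S ≃ₜ S) (hF : TrainTracks.IsMarkov T F)
    (τ : TrainTracks.GenTrainTrack T (TrainTracks.attractors F))
    (φ : TrainTracks.InvariantTrackMap T F τ)
    (hprim : ∃ k : ℕ, 0 < k ∧ ∀ i j, 0 < (φ.transition.toBlocks₁₁ ^ k) i j)
    (hone : φ.transition.toBlocks₁₁ ≠ 1) :
    φ.transition.toBlocks₁₂ = 0 ∧
    ∃ lam : ℝ, 1 < lam ∧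
      TrainTracks.IsPerronFrobenius φ.transition.toBlocks₁₁ lam ∧
      TrainTracks.IsPerronFrobenius φ.transition lam ∧
      ∃ (M : TrainTracks.L1 ℝ τ.Edge →L[ℝ] TrainTracks.L1 ℝ τ.Edge)
        (N : TrainTracks.L1 ℝ T.E →L[ℝ] TrainTracks.L1 ℝ T.E)
        (B : TrainTracks.L1 ℝ T.E →L[ℝ] TrainTracks.L1 ℝ τ.Inf)
        (P : TrainTracks.L1 ℝ τ.Inf →L[ℝ] TrainTracks.L1 ℝ τ.Inf),
        TrainTracks.ActsAs φ.transition M ∧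
        TrainTracks.ActsAs φ.transition.toBlocks₁₁ N ∧
        TrainTracks.ActsAs φ.transition.toBlocks₂₁ B ∧
        TrainTracks.ActsAs φ.transition.toBlocks₂₂ P ∧
        IsUnit (lam • ContinuousLinearMap.id ℝ (TrainTracks.L1 ℝ τ.Inf) - P) ∧
        ∀ Y : TrainTracks.L1 ℝ T.E, (∀ e, 0 < Y e) → N Y = lam • Y →
          ∃ y : TrainTracks.L1 ℝ τ.Edge,
            (∀ e, y (Sum.inl e) = Y e) ∧
            (∀ i, y (Sum.inr i) =
              Ring.inverse (lam • ContinuousLinearMap.id ℝ (TrainTracks.L1 ℝ τ.Inf) - P) (B Y) i) ∧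
            (∀ e, 0 < y e) ∧
            M y = lam • y ∧
            τ.SwitchConditions (fun e => y e) := by

  have h12 := φ.toBlocks₁₂_eq_zero hF
  refine ⟨h12, ?_⟩
  set b : NNReal := ∑ e, ({p : TrainTracks.PushedEdge τ F | p.src = Sum.inl e}.ncard : NNReal)
  have hb : ∀ e, ∑' i, (φ.transition.toBlocks₂₁ i e : ENNReal) ≤ b := by
    intro e
    refine (φ.tsum_transition hF (Sum.inl e)).trans_le ?_
    have : ({p : TrainTracks.PushedEdge τ F | p.src = Sum.inl e}.ncard : NNReal) ≤ b :=
      Finset.single_le_sum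
        (f := fun e => ({p : TrainTracks.PushedEdge τ F | p.src = Sum.inl e}.ncard : NNReal))
        (fun _ _ => zero_le) (Finset.mem_univ e)
    exact_mod_cast this
  have hQ : ∀ j, ∑' i, (φ.transition.toBlocks₂₂ i j : ENNReal) ≤ 1 := by
    intro j
    refine (φ.tsum_transition hF (Sum.inr j)).trans_le ?_
    rw [TrainTracks.PushedEdge.setOf_src_eq_inr hF.toIsThickGraphMap, ncard_singleton, Nat.cast_one]
  obtain ⟨lam, hlam, hN, hM, A, N, B, P, hA, hNa, hB, hP, hunit, hY⟩ :=
    TrainTracks.perronFrobenius_of_blocks h12 hb hQ (φ.reachable hF) hprim hone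
  refine ⟨lam, hlam, hN, hM, A, N, B, P, hA, hNa, hB, hP, hunit, fun Y hYpos hNY => ?_⟩
  obtain ⟨y, h1, h2, h3, h4⟩ := hY Y hYpos hNY
  exact ⟨y, h1, h2, h3, h4, φ.switchConditions hF hA h3 hlam h4⟩
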